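/- Let $\pi:E\to M$ be a smooth real vector bundle of finite rank over a smooth finite-dimensional Hausdorff manifold without boundary, with a Lie algebroid structure: a Lie bracket $[\cdot,\cdot]$ on $\Gamma(E)$ and a smooth bundle map $\rho:E\to TM$ with $[\xi,f\eta]=f[\xi,\eta]+(\rho(\xi)f)\eta$. Let $\pounds^\pi E\to E$ be its prolongation, whose fibre at $e\in E$ is $\{(u,z)\in E_{\pi(e)}\times T_eE : \rho(u)=\pi_*z\}$, with its Lie algebroid bracket $[\![\cdot,\cdot]\!]$: the one with anchor $\rho_\pounds(u,z)=z$ for which $[\![(\xi\circ\pi,X),(\eta\circ\pi,Y)]\!]=([\xi,\eta]\circ\pi,[X,Y])$. On sections of $\pi^*E=E\times_ME$ and of $\pounds^\pi E$ let $i(e,u)=(0,u^\vee_e)$, where $u^\vee_e=\frac{d}{dt}\big|_{0}(e+tu)$; let $j(u,z)=(e,u)$ for $z\in T_eE$, $J=i\circ j$, $\delta(e)=(e,e)$, $C=i\delta$. For $\eta\in\Gamma(E)$ let $\hat\eta=\eta\circ\pi$, $\eta^V=i\hat\eta$, and $\eta^C=(\eta\circ\pi,\eta^c)$, where $\eta^c$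 is the complete lift, i.e. the vector field on $E$ that is $\pi$-projectable on $\rho(\eta)$ and satisfies $\eta^c\hat\theta=\widehat{\mathcal L_\eta\theta}$ for all $\theta\in\Gamma(E^*)$, with $\hat\theta(u)=\theta(u)$ and $(\mathcal L_\eta\theta)(\xi)=\rho(\eta)(\theta(\xi))-\theta([\eta,\xi])$. Let $S$ be a spray, i.e. a smooth section of $\pounds^\pi E$ (over all of $E$) with $JS=C$ and $[\![C,S]\!]=S$. Let $\mathcal H$ be its Berwald connection, the $C^\infty(E)$-linear map $\Gamma(\pi^*E)\to\Gamma(\pounds^\pi E)$ with $\mathcal H\hat\eta=\frac12(\eta^C+[\![\eta^V,S]\!])$, and let $\mathcal V$ be given by $i\circ\mathcal V=1-\mathcal H\circ j$. For sections $\bar\xi,\bar\eta,\bar\sigma$ of $\pi^*E$ and $F\in C^\infty(E)$ put $\nabla^vF(\bar\xi)=\rho_\pounds(i\bar\xi)F$ and $\nabla^v_{\bar\xi}\bar\eta=j[\![i\bar\xi,\mathcal H\bar\eta]\!]$; extend $\nabla^v_{\bar\xi}$ to tensor fields as a derivation and write $\nabla^vA(\bar\xi,\dots)=(\nabla^v_{\bar\xi}A)(\dots)$.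 The trace of a tensor field is taken over its first argument. Let $n$ be a real number with $n\ne\pm1$ (for instance $n=\dim M$ or $n=\operatorname{rank}E$, when different from $1$), and define $$K(\bar\eta)=\mathcal V[\![S,\mathcal H\bar\eta]\!],\qquad R(\bar\eta,\bar\xi)=\tfrac13\big(\nabla^vK(\bar\xi,\bar\eta)-\nabla^vK(\bar\eta,\bar\xi)\big),$$ $$W^\circ=K-\tfrac1{n-1}(\operatorname{tr}K)\,\mathrm{Id}+\tfrac3{n+1}(\operatorname{tr}R)\otimes\delta+\tfrac{2-n}{n^2-1}(\nabla^v\operatorname{tr}K)\otimes\delta,$$ $$W(\bar\eta,\bar\xi)=\tfrac13\big(\nabla^vW^\circ(\bar\xi,\bar\eta)-\nabla^vW^\circ(\bar\eta,\bar\xi)\big),\qquad W^*(\bar\eta,\bar\xi)\bar\sigma=\nabla^vW(\bar\sigma,\bar\eta,\bar\xi).$$ **Theorem.** Let $\eta\in\Gamma(E)$ be a Lie symmetry of $S$, i.e. $[\![S,\eta^C]\!]=0$. Then $\eta^C$ is a curvature collineation of the projective deviation tensor $W^\circ$, of the fundamental projective curvature $W$ and of the projective curvature $W^*$. That is, $\eta^C$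 is a smooth section of $\pounds^\pi E$ whose first component has the form $X\circ\pi$ with $X\in\Gamma(E)$ (a projectable section), and $\widetilde{\mathcal L}_{\eta^C}W^\circ=0$, $\widetilde{\mathcal L}_{\eta^C}W=0$, $\widetilde{\mathcal L}_{\eta^C}W^*=0$, where $\widetilde{\mathcal L}_{\eta^C}$ is the tensor derivation of $\pi^*E$ with $\widetilde{\mathcal L}_{\eta^C}\bar\sigma=i^{-1}[\![\eta^C,i\bar\sigma]\!]$ and $\widetilde{\mathcal L}_{\eta^C}F=\rho_\pounds(\eta^C)F$. -/

import Mathlib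

open Bundle
open scoped Manifold ContDiff

noncomputable section

namespace LieAlgd

/-! Throughout, `M` is a smooth manifold modelled on the finite-dimensional space `EM`, and `V` is
a smooth vector bundle over `M` with typical fibre `F`; its total space (the manifold `E` of the
mathematical text) is `TotalSpace F V`. -/

section Basic

variable (EM : Type*) [NormedAddCommGroup EM] [NormedSpace ℝ EM]
  {M : Type*} [TopologicalSpace M] [ChartedSpace EM M] [IsManifold 𝓘(ℝ, EM) ∞ M]
  (F : Type*) [NormedAddCommGroup F] [NormedSpace ℝ F]
  (V : M → Type*) [TopologicalSpace (TotalSpace F V)]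
  [∀ x, AddCommGroup (V x)] [∀ x, Module ℝ (V x)] [∀ x, TopologicalSpace (V x)]
  [FiberBundle F V] [VectorBundle ℝ F V] [ContMDiffVectorBundle ∞ F V 𝓘(ℝ, EM)]

/-- The space `Γ(E)` of smooth sections of the vector bundle. -/
abbrev Sec := Cₛ^∞⟮𝓘(ℝ, EM); F, V⟯

variable {EM F V}

/-- The product `f ξ` of a smooth function and a smooth section. -/
def smulSec (f : C^∞⟮𝓘(ℝ, EM), M; ℝ⟯) (ξ : Sec EM F V) : Sec EM F V :=
  ⟨fun x => f x • ξ x, ContMDiff.smul_section f.contMDiff ξ.contMDiff⟩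

variable (EM F V)

/-- A Lie algebroid structure on the vector bundle `V`: a Lie bracket on the space of smooth
sections and a smooth bundle map `ρ : E → TM` (the anchor), related by the Leibniz rule
`[ξ, f η] = f [ξ, η] + (ρ(ξ) f) η`. -/
structure LieAlgebroid where
  /-- The bracket, as an `ℝ`-bilinear map. -/
  bracket : Sec EM F V →ₗ[ℝ] Sec EM F V →ₗ[ℝ] Sec EM F V
  bracket_self : ∀ ξ, bracket ξ ξ = 0
  jacobi : ∀ ξ η ζ, bracket ξ (bracket η ζ) = bracket (bracket ξ η) ζ + bracket η (bracket ξ ζ)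
  /-- The anchor. -/
  anchor : ∀ x : M, V x →L[ℝ] TangentSpace 𝓘(ℝ, EM) x
  anchor_smooth : ContMDiff (𝓘(ℝ, EM).prod 𝓘(ℝ, F)) 𝓘(ℝ, EM).tangent ∞
    (fun e : TotalSpace F V => (⟨e.proj, anchor e.proj e.2⟩ : TangentBundle 𝓘(ℝ, EM) M))
  leibniz : ∀ (ξ η : Sec EM F V) (f : C^∞⟮𝓘(ℝ, EM), M; ℝ⟯) (x : M),
    bracket ξ (smulSec f η) x = f x • bracket ξ η x
      + mvfderiv 𝓘(ℝ, EM) f x (anchor x (ξ x)) • η x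

/-- Families `e ↦ σ(e) ∈ E_{π(e)}`, i.e. (not necessarily smooth) sections of the pullback
bundle `π^*E = E ×_M E → E`. -/
abbrev PullSec := ∀ e : TotalSpace F V, V e.proj

/-- Families `e ↦ (u, z) ∈ E_{π(e)} × T_e E`; the sections of the prolongation `£^πE` are among
them, see `LieAlgebroid.IsProlSection`. -/
abbrev PairSec :=
  ∀ e : TotalSpace F V, V e.proj × TangentSpace (𝓘(ℝ, EM).prod 𝓘(ℝ, F)) e

variable {EM F V}

variable (EM) in
/-- Smoothness of a section of the pullback bundle `π^*E`. -/
def IsSmoothPullSec (σ : PullSec F V) : Prop :=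
  ContMDiff (𝓘(ℝ, EM).prod 𝓘(ℝ, F)) (𝓘(ℝ, EM).prod 𝓘(ℝ, F)) ∞
    (fun e : TotalSpace F V => (⟨e.proj, σ e⟩ : TotalSpace F V))

/-- The lift `ξ̂ = ξ ∘ π` of a section of `E` to a section of `π^*E`. -/
def hat (ξ : Sec EM F V) : PullSec F V := fun e => ξ e.proj

/-- The canonical section `δ(e) = (e, e)` of `π^*E`. -/
def delta : PullSec F V := fun e => e.2

variable (EM) in
/-- The vertical lift `u^∨_e = d/dt|_{t = 0} (e + t u) ∈ T_e E` of `u ∈ E_{π(e)}`. -/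
def vert (e : TotalSpace F V) (u : V e.proj) : TangentSpace (𝓘(ℝ, EM).prod 𝓘(ℝ, F)) e :=
  mfderiv 𝓘(ℝ, ℝ) (𝓘(ℝ, EM).prod 𝓘(ℝ, F))
    (fun t : ℝ => (⟨e.proj, e.2 + t • u⟩ : TotalSpace F V)) (0 : ℝ) (1 : ℝ)

variable (EM) in
/-- The injection `i : π^*E → £^πE`, `i(e, u) = (0, u^∨_e)`. -/
def iMap (e : TotalSpace F V) (u : V e.proj) :
    V e.proj × TangentSpace (𝓘(ℝ, EM).prod 𝓘(ℝ, F)) e :=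
  (0, vert EM e u)

/-- The inverse `i⁻¹` of the injection `i`, meaningful on the vertical elements. -/
def iInv (e : TotalSpace F V) : V e.proj × TangentSpace (𝓘(ℝ, EM).prod 𝓘(ℝ, F)) e → V e.proj :=
  Function.invFun (iMap EM e)

variable (EM) in
/-- The map `i` on sections. -/
def iSec (σ : PullSec F V) : PairSec EM F V := fun e => iMap EM e (σ e)

/-- The map `j : £^πE → π^*E`, `j(u, z) = (e, u)` for `z ∈ T_e E`, on sections. -/
def jSec (s : PairSec EM F V) : PullSec F V := fun e => (s e).1

/-- The vertical endomorphism `J = i ∘ j`. -/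
def Jmap (s : PairSec EM F V) : PairSec EM F V := iSec EM (jSec s)

variable (EM F V) in
/-- The Liouville (Euler) section `C = i ∘ δ`. -/
def liouville : PairSec EM F V := iSec EM delta

/-- The vertical lift `η^V = (0, η^∨)`. -/
def vLift (η : Sec EM F V) : PairSec EM F V := iSec EM (hat η)

/-- The derivative at `e`, in the direction `z ∈ T_e E`, of a section `σ` of `π^*E`, computed in
the preferred trivialization of `E` around `π(e)`. It is only used for sections with `σ(e) = 0`, for
which the result does not depend on the trivialization. -/
def fibreDeriv (σ : PullSec F V) (e : TotalSpace F V)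
    (z : TangentSpace (𝓘(ℝ, EM).prod 𝓘(ℝ, F)) e) : V e.proj :=
  (trivializationAt F V e.proj).symm e.proj
    (mvfderiv (𝓘(ℝ, EM).prod 𝓘(ℝ, F))
      (fun e' : TotalSpace F V =>
        (trivializationAt F V e.proj (⟨e'.proj, σ e'⟩ : TotalSpace F V)).2) e z)

open Classical in
/-- The trace of a self-map of a vector space that is linear. -/
def fibreTrace {W : Type*} [AddCommGroup W] [Module ℝ W] (f : W → W) : ℝ :=
  if h : IsLinearMap ℝ f then LinearMap.trace ℝ W h.mk' else 0

variable (EM) in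
/-- The vertical differential of a function, `(∇^v f)(ξ̄) = ρ_£(i ξ̄) f`. -/
def vertDiff (f : TotalSpace F V → ℝ) (ξ : PullSec F V) (e : TotalSpace F V) : ℝ :=
  mvfderiv (𝓘(ℝ, EM).prod 𝓘(ℝ, F)) f e (vert EM e (ξ e))

variable (F V) in
/-- Operations with `k` arguments from sections of `π^*E` to sections of `π^*E`; the tensor fields
of type `(1, k)` of `π^*E` are the `C^∞(E)`-multilinear ones. -/
abbrev Tens (k : ℕ) := (Fin k → PullSec F V) → PullSec F V

/-- The extension of a derivation `D` of the sections of `π^*E` to tensor fields of type `(1, k)`: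
`(D A)(ξ₁, …, ξ_k) = D (A(ξ₁, …, ξ_k)) - ∑ᵢ A(ξ₁, …, D ξᵢ, …, ξ_k)`. -/
def derivTens {k : ℕ} (D : PullSec F V → PullSec F V) (A : Tens F V k) : Tens F V k :=
  fun ξ => D (A ξ) - ∑ i, A (Function.update ξ i (D (ξ i)))

end Basic

section Extend

variable {EM : Type*} [NormedAddCommGroup EM] [NormedSpace ℝ EM] [FiniteDimensional ℝ EM]
  {M : Type*} [TopologicalSpace M] [ChartedSpace EM M] [IsManifold 𝓘(ℝ, EM) ∞ M] [T2Space M]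
  {F : Type*} [NormedAddCommGroup F] [NormedSpace ℝ F]
  {V : M → Type*} [TopologicalSpace (TotalSpace F V)]
  [∀ x, AddCommGroup (V x)] [∀ x, Module ℝ (V x)] [∀ x, TopologicalSpace (V x)]
  [FiberBundle F V] [VectorBundle ℝ F V] [ContMDiffVectorBundle ∞ F V 𝓘(ℝ, EM)]

/-- Every vector of the bundle is the value of a smooth section. -/
theorem exists_section {x : M} (u : V x) : ∃ ξ : Sec EM F V, ξ x = u := by
  obtain ⟨s, hs, hsm⟩ := FiberBundle.exists_contMDiffOn_extend (k := ∞) 𝓘(ℝ, EM) F u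
  obtain ⟨t, hts, hto, hxt⟩ := mem_nhds_iff.1 hs
  obtain ⟨f, -, hf⟩ := (SmoothBumpFunction.nhds_basis_tsupport (I := 𝓘(ℝ, EM)) x).mem_iff.1
    (hto.mem_nhds hxt)
  refine ⟨⟨(f : M → ℝ) • FiberBundle.extend F u, ContMDiffOn.smul_section_of_tsupport
    f.contMDiff.contMDiffOn hto hf (hsm.mono hts)⟩, ?_⟩
  change f x • FiberBundle.extend F u x = u
  simp

/-- A smooth section of `E` with the value `u` at `x`. -/
def ext (EM : Type*) [NormedAddCommGroup EM] [NormedSpace ℝ EM] [FiniteDimensional ℝ EM]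
    {M : Type*} [TopologicalSpace M] [ChartedSpace EM M] [IsManifold 𝓘(ℝ, EM) ∞ M] [T2Space M]
    (F : Type*) [NormedAddCommGroup F] [NormedSpace ℝ F]
    {V : M → Type*} [TopologicalSpace (TotalSpace F V)]
    [∀ x, AddCommGroup (V x)] [∀ x, Module ℝ (V x)] [∀ x, TopologicalSpace (V x)]
    [FiberBundle F V] [VectorBundle ℝ F V] [ContMDiffVectorBundle ∞ F V 𝓘(ℝ, EM)]
    {x : M} (u : V x) : Sec EM F V :=
  Classical.choose (exists_section (EM := EM) (F := F) u)

theorem ext_apply {x : M} (u : V x) : ext EM F u x = u :=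
  Classical.choose_spec (exists_section (EM := EM) (F := F) u)

variable (EM) in
/-- The trace of a tensor field of type `(1, k + 1)` over its first argument: at `e`, the trace
of `u ↦ A(Z, X₁, …, X_k)(e)`, where `Z` is a section with `Z(e) = u`. -/
def tr {k : ℕ} (A : Tens F V (k + 1)) (X : Fin k → PullSec F V) (e : TotalSpace F V) : ℝ :=
  fibreTrace fun u : V e.proj => A (Fin.cons (hat (ext EM F u)) X) e

namespace LieAlgebroid

variable (L : LieAlgebroid EM F V)

/-- The fibre `{(u, z) ∈ E_{π(e)} × T_e E | ρ(u) = π_*(z)}` of the prolongation `£^πE` at `e`. -/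
def prolongation (e : TotalSpace F V) :
    Set (V e.proj × TangentSpace (𝓘(ℝ, EM).prod 𝓘(ℝ, F)) e) :=
  {p | L.anchor e.proj p.1 =
    mfderiv (𝓘(ℝ, EM).prod 𝓘(ℝ, F)) 𝓘(ℝ, EM) (TotalSpace.proj : TotalSpace F V → M) e p.2}

/-- The smooth sections of `£^πE → E`. -/
structure IsProlSection (s : PairSec EM F V) : Prop where
  mem : ∀ e, s e ∈ L.prolongation e
  smooth_fst : IsSmoothPullSec EM (jSec s)
  smooth_snd : ContMDiff (𝓘(ℝ, EM).prod 𝓘(ℝ, F)) (𝓘(ℝ, EM).prod 𝓘(ℝ, F)).tangent ∞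
    (fun e : TotalSpace F V =>
      (⟨e, (s e).2⟩ : TangentBundle (𝓘(ℝ, EM).prod 𝓘(ℝ, F)) (TotalSpace F V)))

/-- The bracket `⟦s₁, s₂⟧` of sections `s₁ = (σ₁, Z₁)`, `s₂ = (σ₂, Z₂)` of the prolongation. Its
second component is the Lie bracket `[Z₁, Z₂]` of vector fields on `E`. Its first component at `e`
is `[ξ₁, ξ₂](π(e)) + Z₁(σ₂ - ξ₂ ∘ π) - Z₂(σ₁ - ξ₁ ∘ π)`, where `ξ₁`, `ξ₂` are any sections of `E`
such that `ξᵢ(π(e)) = σᵢ(e)`. In terms of a local frame `e_α` with `[e_α, e_β] = L^γ_{αβ} e_γ` the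
first component is `(σ₁^α σ₂^β L^γ_{αβ} ∘ π + Z₁(σ₂^γ) - Z₂(σ₁^γ)) e_γ`. This is the Lie algebroid
bracket with anchor `(u, z) ↦ z` which is `([ξ₁, ξ₂] ∘ π, [Z₁, Z₂])` when `σᵢ = ξᵢ ∘ π`. -/
def pbracket (s₁ s₂ : PairSec EM F V) : PairSec EM F V := fun e =>
  (L.bracket (ext EM F (s₁ e).1) (ext EM F (s₂ e).1) e.proj
      + fibreDeriv (jSec s₂ - hat (ext EM F (s₂ e).1)) e (s₁ e).2
      - fibreDeriv (jSec s₁ - hat (ext EM F (s₁ e).1)) e (s₂ e).2,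
    VectorField.mlieBracket (𝓘(ℝ, EM).prod 𝓘(ℝ, F))
      (fun e' => (s₁ e').2) (fun e' => (s₂ e').2) e)

/-- The complete lift `η^c` of `η ∈ Γ(E)`, a vector field on `E`: at `e`, it is
`dξ(ρ(η)) - [η, ξ]^∨`, where `ξ` is any section of `E` through `e`, that is, `ξ(π(e)) = e`.
In coordinates this is
`η^α ρ^i_α ∂/∂x^i + y^β (ρ^j_β ∂η^α/∂x^j - η^γ L^α_{γβ}) ∂/∂y^α`. Equivalently, `η^c` is
the vector field that projects to `ρ(η)` and satisfies, for all `θ ∈ Γ(E^*)` and `ξ ∈ Γ(E)`,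
`(η^c θ̂) ∘ ξ = ρ(η)(θ(ξ)) - θ([η, ξ])`. -/
def completeLiftField (η : Sec EM F V) (e : TotalSpace F V) :
    TangentSpace (𝓘(ℝ, EM).prod 𝓘(ℝ, F)) e :=
  let z : TangentSpace (𝓘(ℝ, EM).prod 𝓘(ℝ, F)) e :=
    mfderiv 𝓘(ℝ, EM) (𝓘(ℝ, EM).prod 𝓘(ℝ, F))
      (fun x => (⟨x, ext EM F e.2 x⟩ : TotalSpace F V)) e.proj (L.anchor e.proj (η e.proj))
  z - vert EM e (L.bracket η (ext EM F e.2) e.proj)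

/-- The complete lift `η^C = (η ∘ π, η^c)` of `η ∈ Γ(E)`, a section of the prolongation. -/
def cLift (η : Sec EM F V) : PairSec EM F V := fun e => (η e.proj, L.completeLiftField η e)

/-- A spray: a section `S` of the prolongation with `J S = C` and `⟦C, S⟧ = S`. -/
structure IsSpray (S : PairSec EM F V) : Prop where
  isSection : L.IsProlSection S
  semispray : Jmap S = liouville EM F V
  homogeneous : L.pbracket (liouville EM F V) S = S

/-- A Lie symmetry of `S`: a section `η` of `E` with `⟦S, η^C⟧ = 0`. -/
def IsLieSymmetry (S : PairSec EM F V) (η : Sec EM F V) : Prop :=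
  L.pbracket S (L.cLift η) = 0

/-- The Berwald connection `𝓗` of the spray `S`: the `C^∞(E)`-linear map with
`𝓗(η̂) = (η^C + ⟦η^V, S⟧) / 2` for `η ∈ Γ(E)`. -/
def berwald (S : PairSec EM F V) (σ : PullSec F V) : PairSec EM F V := fun e =>
  (1 / 2 : ℝ) • (L.cLift (ext EM F (σ e)) e + L.pbracket (vLift (ext EM F (σ e))) S e)

/-- The vertical map `𝓥` of the Berwald connection, given by `i ∘ 𝓥 = 1 - 𝓗 ∘ j`. -/
def vmap (S : PairSec EM F V) (s : PairSec EM F V) : PullSec F V := fun e =>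
  iInv e (s e - L.berwald S (jSec s) e)

/-- The vertical differential `∇^v_ξ̄ η̄ = j ⟦i ξ̄, 𝓗 η̄⟧` of a section `η̄` of `π^*E`. -/
def vertDeriv (S : PairSec EM F V) (ξ η : PullSec F V) : PullSec F V :=
  jSec (L.pbracket (iSec EM ξ) (L.berwald S η))

/-- The vertical differential of a tensor field of type `(1, k)`:
`(∇^v A)(X₀, X₁, …, X_k) = (∇^v_{X₀} A)(X₁, …, X_k)`. -/
def vertDerivTens (S : PairSec EM F V) {k : ℕ} (A : Tens F V k) : Tens F V (k + 1) :=
  fun X => derivTens (L.vertDeriv S (X 0)) A (Fin.tail X)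

/-- The Lie derivation along the projectable section `s`, `σ̄ ↦ i⁻¹ ⟦s, i σ̄⟧`. -/
def lieDer (s : PairSec EM F V) (σ : PullSec F V) : PullSec F V := fun e =>
  iInv e (L.pbracket s (iSec EM σ) e)

/-- The Jacobi endomorphism `K(η̄) = 𝓥 ⟦S, 𝓗 η̄⟧`. -/
def jacobiEndo (S : PairSec EM F V) : Tens F V 1 :=
  fun X => L.vmap S (L.pbracket S (L.berwald S (X 0)))

/-- For `A` of type `(1, 1)`, the tensor
`(η̄, ξ̄) ↦ ((∇^v A)(ξ̄, η̄) - (∇^v A)(η̄, ξ̄)) / 3` of type `(1, 2)`. -/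
def altVertDeriv (S : PairSec EM F V) (A : Tens F V 1) : Tens F V 2 :=
  fun X => (1 / 3 : ℝ) • (L.vertDerivTens S A ![X 1, X 0] - L.vertDerivTens S A ![X 0, X 1])

/-- The fundamental affine curvature `R`. -/
def affineCurv (S : PairSec EM F V) : Tens F V 2 := L.altVertDeriv S (L.jacobiEndo S)

/-- The projective deviation tensor
`W° = K - (tr K) Id / (n - 1) + 3 (tr R) ⊗ δ / (n + 1) + (2 - n) (∇^v tr K) ⊗ δ / (n² - 1)`. -/
def projDeviation (S : PairSec EM F V) (n : ℝ) : Tens F V 1 := fun X e =>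
  L.jacobiEndo S X e
    - (1 / (n - 1) * tr EM (L.jacobiEndo S) ![] e) • X 0 e
    + (3 / (n + 1) * tr EM (L.affineCurv S) X e) • delta e
    + ((2 - n) / (n ^ 2 - 1) * vertDiff EM (tr EM (L.jacobiEndo S) ![]) (X 0) e) • delta e

/-- The fundamental projective curvature `W`,
`W(η̄, ξ̄) = ((∇^v W°)(ξ̄, η̄) - (∇^v W°)(η̄, ξ̄)) / 3`. -/
def projCurv (S : PairSec EM F V) (n : ℝ) : Tens F V 2 := L.altVertDeriv S (L.projDeviation S n)

/-- The projective curvature `W*`, `W*(η̄, ξ̄) σ̄ = (∇^v W)(σ̄, η̄, ξ̄)`. -/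
def projCurvStar (S : PairSec EM F V) (n : ℝ) : Tens F V 3 :=
  fun X => L.vertDerivTens S (L.projCurv S n) ![X 2, X 0, X 1]

/-- A section `s` of the prolongation is projectable if its first component is `X ∘ π` for a
section `X` of `E`. -/
def IsProjectable (s : PairSec EM F V) : Prop :=
  L.IsProlSection s ∧ ∃ X : Sec EM F V, jSec s = hat X

/-- `s` is a curvature collineation of the tensor field `A` of type `(1, k)`: it is a projectable
section, and the Lie derivative of `A` along `s` vanishes. -/
def IsCurvatureCollineation (s : PairSec EM F V) {k : ℕ} (A : Tens F V k) : Prop :=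
  L.IsProjectable s ∧
    ∀ X : Fin k → PullSec F V, (∀ i, IsSmoothPullSec EM (X i)) → derivTens (L.lieDer s) A X = 0

end LieAlgebroid

end Extend

end LieAlgd

end

/-!
The Lie derivative `D` along `η^C` is a derivation of all the data from which the projective tensors
are built, and a Lie symmetry makes each of them invariant.

Everything is read off vector fields on the total space: the vertical lift `σ ↦ σ^∨` embeds the
sections of `π^*E` into the vector fields, and `(Dσ)^∨ = [η^c, σ^∨]` (`vf_lieDer`). This turns the
invariance statements into instances of the Jacobi identity for vector fields. The bracket of the
prolongation is given by an explicit formula, and it takes values in the prolongation because the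
anchor is a morphism of Lie algebras (`anchor_bracket`, `pbracket_mem`); in a local frame `D` has
the form `σ ↦ η^c σ - B σ`, where `B` is the matrix of `η^c` along the fibres (`coord_lieDer`).

* The horizontal lift of `ξ̂` is the vector field `½ (ξ^c + [ξ^∨, S])`. As `[η^c, ξ^c] = [η, ξ]^c`,
  `[η^c, ξ^∨] = [η, ξ]^∨` and `[η^c, S] = 0`, the Jacobi identity gives `[η^c, 𝓗σ] = 𝓗 Dσ`
  (`cl_bracket_hor`).
* The section `Γσ = j ⟦S, 𝓗σ⟧` has the vertical lift `[S, σ^∨] + 𝓗σ`, and `Kσ` has the vertical lift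
  `[S, 𝓗σ] - 𝓗Γσ`. Hence `D` commutes with `Γ` and with `K` (`lieDer_dyn`, `lieDer_jac`).
* The derivative `∇^v` is the componentwise derivative along the fibres, and `D` is a derivation of
  it, because `η^c` is linear along the fibres (`lieDer_vderiv`). So `R` is invariant along with `K`
  (`lieC_altOp`).
* The trace commutes with `D`, since the matrix `B` enters through a commutator (`along_cl_trOp`).
  So the functions `tr K`, `(tr R)(σ)` and `∇^v tr K (σ)` have the derivatives expected of invariant
  tensor fields. With `D δ = 0` (`lieDer_delta`) this gives the invariance of `W°` (`lieC_devOp`),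
  and by two more vertical derivatives that of `W` and `W*`.

Traces and vertical derivatives only behave in this way for genuine tensor fields; the fibrewise
linearity of `K`, `R` and `W°` is established in `jac_isEndo`, `altOp_isBi` and `devOp_isEndo`.
-/

open Bundle
open scoped Manifold ContDiff

noncomputable section

namespace LieAlgd

open Filter Topology VectorField

set_option linter.unusedSectionVars false

/-! ### Vector fields and vector-valued functions on manifolds -/

section Manifold

variable {EN : Type*} [NormedAddCommGroup EN] [NormedSpace ℝ EN]
  {HN : Type*} [TopologicalSpace HN] {I : ModelWithCorners ℝ EN HN}
  {N : Type*} [TopologicalSpace N] [ChartedSpace HN N]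
  {G : Type*} [NormedAddCommGroup G] [NormedSpace ℝ G]
  {G' : Type*} [NormedAddCommGroup G'] [NormedSpace ℝ G']

variable (I) in
/-- The derivative `Z f` of a vector-valued function `f` along a vector field `Z`. -/
def along (Z : ∀ e : N, TangentSpace I e) (f : N → G) (e : N) : G := mvfderiv I f e (Z e)

theorem mdiff_of_smooth {f : N → G} {e : N} (hf : ContMDiffAt I 𝓘(ℝ, G) ∞ f e) :
    MDifferentiableAt I 𝓘(ℝ, G) f e := hf.mdifferentiableAt (by simp)

theorem mvfderiv_congr {f g : N → G} {e : N} (h : f =ᶠ[𝓝 e] g) :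
    mvfderiv I f e = mvfderiv I g e := by
  ext v
  have := h.mfderiv_eq (I := I) (I' := 𝓘(ℝ, G))
  exact DFunLike.congr_fun this v

theorem mvfderiv_clm_comp (ℓ : G →L[ℝ] G') {f : N → G} {e : N}
    (hf : MDifferentiableAt I 𝓘(ℝ, G) f e) (z : TangentSpace I e) :
    mvfderiv I (fun e' => ℓ (f e')) e z = ℓ (mvfderiv I f e z) := by
  have h := mfderiv_comp_apply (I' := 𝓘(ℝ, G)) (I'' := 𝓘(ℝ, G')) e
    (g := ℓ) (f := f) (ℓ.mdifferentiableAt) hf z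
  rw [ℓ.mfderiv_eq] at h
  exact h

theorem mvfderiv_comp_map {EN' : Type*} [NormedAddCommGroup EN'] [NormedSpace ℝ EN']
    {HN' : Type*} [TopologicalSpace HN'] {I' : ModelWithCorners ℝ EN' HN'}
    {N' : Type*} [TopologicalSpace N'] [ChartedSpace HN' N']
    {f : N → G} {φ : N' → N} {e : N'}
    (hf : MDifferentiableAt I 𝓘(ℝ, G) f (φ e)) (hφ : MDifferentiableAt I' I φ e)
    (z : TangentSpace I' e) :
    mvfderiv I' (fun e' => f (φ e')) e z = mvfderiv I f (φ e) (mfderiv I' I φ e z) :=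
  mfderiv_comp_apply e hf hφ z

/-- The product rule for the application of a family of linear maps to a family of vectors. -/
theorem mvfderiv_clm_apply {B : N → G →L[ℝ] G'} {g : N → G} {e : N}
    (hB : MDifferentiableAt I 𝓘(ℝ, G →L[ℝ] G') B e) (hg : MDifferentiableAt I 𝓘(ℝ, G) g e)
    (z : TangentSpace I e) :
    mvfderiv I (fun e' => B e' (g e')) e z =
      mvfderiv I B e z (g e) + B e (mvfderiv I g e z) := by
  have hb : MDifferentiableAt 𝓘(ℝ, (G →L[ℝ] G') × G) 𝓘(ℝ, G')
      (fun p : (G →L[ℝ] G') × G => p.1 p.2) (B e, g e) :=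
    (isBoundedBilinearMap_apply (𝕜 := ℝ).differentiableAt _).mdifferentiableAt
  have hd : HasFDerivAt (fun p : (G →L[ℝ] G') × G => p.1 p.2)
      (isBoundedBilinearMap_apply (𝕜 := ℝ) (E := G) (F := G') |>.deriv (B e, g e)) (B e, g e) :=
    isBoundedBilinearMap_apply.hasFDerivAt _
  have h := mfderiv_comp_apply (I' := 𝓘(ℝ, (G →L[ℝ] G') × G)) (I'' := 𝓘(ℝ, G')) e
    (g := fun p : (G →L[ℝ] G') × G => p.1 p.2) (f := fun e' => (B e', g e')) hb
    (hB.prodMk_space hg) z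
  have hp : HasMFDerivAt I 𝓘(ℝ, (G →L[ℝ] G') × G) (fun e' => (B e', g e')) e
      ((mvfderiv I B e).prod (mvfderiv I g e)) :=
    ⟨hB.continuousAt.prodMk hg.continuousAt, hB.hasMFDerivAt.2.prodMk hg.hasMFDerivAt.2⟩
  rw [hp.mfderiv, hd.hasMFDerivAt.mfderiv] at h
  refine Eq.trans h ?_
  exact add_comm _ _

theorem mvfderiv_finset_sum {ι : Type*} (s : Finset ι) {f : ι → N → G} {e : N}
    (hf : ∀ i ∈ s, MDifferentiableAt I 𝓘(ℝ, G) (f i) e) (z : TangentSpace I e) :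
    mvfderiv I (fun e' => ∑ i ∈ s, f i e') e z = ∑ i ∈ s, mvfderiv I (f i) e z := by
  classical
  suffices h : MDifferentiableAt I 𝓘(ℝ, G) (fun e' => ∑ i ∈ s, f i e') e ∧
    mvfderiv I (fun e' => ∑ i ∈ s, f i e') e z = ∑ i ∈ s, mvfderiv I (f i) e z from h.2
  induction s using Finset.induction_on with
  | empty => simpa [mvfderiv_const] using mdifferentiableAt_const
  | insert i s hi ih =>
    obtain ⟨h1, h2⟩ := ih fun j hj => hf j (by simp [hj])
    have hi' := hf i (by simp)
    simp only [Finset.sum_insert hi]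
    refine ⟨hi'.add h1, ?_⟩
    rw [mvfderiv_fun_add hi' h1, ← h2]
    rfl

variable [IsManifold I ∞ N]

variable (I) in
/-- Smoothness of a vector field at a point. -/
def SmoothFieldAt (Z : ∀ e : N, TangentSpace I e) (e : N) : Prop :=
  ContMDiffAt I I.tangent ∞ (fun e' => (⟨e', Z e'⟩ : TangentBundle I N)) e

theorem SmoothFieldAt.mdiff {Z : ∀ e : N, TangentSpace I e} {e : N}
    (h : SmoothFieldAt I Z e) :
    MDifferentiableAt I I.tangent (fun e' => (⟨e', Z e'⟩ : TangentBundle I N)) e :=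
  ContMDiffAt.mdifferentiableAt h (by simp)

theorem eventually_mdiff {f : N → G} {e : N}
    (hf : ContMDiffAt I 𝓘(ℝ, G) ∞ f e) :
    ∀ᶠ e' in 𝓝 e, MDifferentiableAt I 𝓘(ℝ, G) f e' :=
  ((contMDiffAt_iff_contMDiffAt_nhds (by simp)).1
    (ContMDiffAt.of_le hf (m := 1) ENat.LEInfty.out)).mono
    fun _ h => h.mdifferentiableAt (by simp)

theorem SmoothFieldAt.eventually_mdiff {Z : ∀ e : N, TangentSpace I e} {e : N}
    (h : SmoothFieldAt I Z e) :
    ∀ᶠ e' in 𝓝 e, MDifferentiableAt I I.tangent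
      (fun e' => (⟨e', Z e'⟩ : TangentBundle I N)) e' := by
  exact ((contMDiffAt_iff_contMDiffAt_nhds (by simp)).1
    (ContMDiffAt.of_le h (m := 1) ENat.LEInfty.out)).mono
    fun _ h => h.mdifferentiableAt (by simp)

/-- The derivative of a smooth function along a smooth vector field is smooth. -/
theorem contMDiffAt_along {Z : ∀ e : N, TangentSpace I e} {f : N → G} {e : N}
    (hf : ContMDiffAt I 𝓘(ℝ, G) ∞ f e) (hZ : SmoothFieldAt I Z e) :
    ContMDiffAt I 𝓘(ℝ, G) ∞ (along I Z f) e := by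
  have h1 := hf.mfderiv_const (m := ∞) (by simp)
  have h2 := ContMDiffAt.clm_apply_of_inCoordinates (b₁ := id) (b₂ := f)
    (E₁ := (TangentSpace I : N → Type _)) (E₂ := (TangentSpace 𝓘(ℝ, G) : G → Type _))
    (v := Z) h1 hZ hf
  have h3 := (contMDiffAt_totalSpace.1 h2).2
  refine h3.congr_of_eventuallyEq (Eventually.of_forall fun e' => ?_)
  simp only [along, mvfderiv, trivializationAt_model_space_apply]
  rfl

/-- A tangent vector is determined by its coordinates in a chart. -/
theorem eq_of_mvfderiv_chart {e₀ e : N} (he : e ∈ (chartAt HN e₀).source)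
    {z w : TangentSpace I e}
    (h : mvfderiv I (extChartAt I e₀) e z = mvfderiv I (extChartAt I e₀) e w) : z = w := by
  obtain ⟨L, hL⟩ := isInvertible_mfderiv_extChartAt (I := I) (x := e₀) (y := e)
    (by rwa [extChartAt_source])
  apply L.injective
  have h' : mfderiv I 𝓘(ℝ, EN) (extChartAt I e₀) e z =
    mfderiv I 𝓘(ℝ, EN) (extChartAt I e₀) e w := h
  rw [← hL] at h'
  exact h'

/-- A vector field is smooth if and only if its components in a chart are. -/
theorem smoothFieldAt_iff {Z : ∀ e : N, TangentSpace I e} {e₀ : N} :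
    SmoothFieldAt I Z e₀ ↔ ContMDiffAt I 𝓘(ℝ, EN) ∞ (along I Z (extChartAt I e₀)) e₀ := by
  unfold SmoothFieldAt
  rw [contMDiffAt_section (E := (TangentSpace I : N → Type _)) e₀]
  refine Filter.EventuallyEq.contMDiffAt_iff ?_
  filter_upwards [(chartAt HN e₀).open_source.mem_nhds (mem_chart_source HN e₀)] with e he
  have h := TangentBundle.continuousLinearMapAt_trivializationAt (I := I) he
  have h2 := DFunLike.congr_fun h (Z e)
  rw [Trivialization.continuousLinearMapAt_apply, Trivialization.linearMapAt_apply,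
    if_pos (by simpa using he)] at h2
  exact h2

theorem SmoothFieldAt.congr {Z W : ∀ e : N, TangentSpace I e} {e : N}
    (h : SmoothFieldAt I Z e) (hW : W =ᶠ[𝓝 e] Z) : SmoothFieldAt I W e :=
  ContMDiffAt.congr_of_eventuallyEq h (hW.mono fun e' he' => by simp [he'])

theorem SmoothFieldAt.add {Z W : ∀ e : N, TangentSpace I e} {e : N}
    (h : SmoothFieldAt I Z e) (hW : SmoothFieldAt I W e) : SmoothFieldAt I (Z + W) e :=
  ContMDiffAt.add_section h hW

theorem SmoothFieldAt.sub {Z W : ∀ e : N, TangentSpace I e} {e : N}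
    (h : SmoothFieldAt I Z e) (hW : SmoothFieldAt I W e) : SmoothFieldAt I (Z - W) e :=
  ContMDiffAt.sub_section h hW

theorem SmoothFieldAt.smul {f : N → ℝ} {Z : ∀ e : N, TangentSpace I e} {e : N}
    (hf : ContMDiffAt I 𝓘(ℝ, ℝ) ∞ f e) (h : SmoothFieldAt I Z e) :
    SmoothFieldAt I (f • Z) e :=
  ContMDiffAt.smul_section hf h

theorem SmoothFieldAt.const_smul (c : ℝ) {Z : ∀ e : N, TangentSpace I e} {e : N}
    (h : SmoothFieldAt I Z e) : SmoothFieldAt I (c • Z) e :=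
  SmoothFieldAt.smul (f := fun _ => c) contMDiffAt_const h

theorem SmoothFieldAt.sum {ι : Type*} (s : Finset ι) {Z : ι → ∀ e : N, TangentSpace I e} {e : N}
    (h : ∀ i ∈ s, SmoothFieldAt I (Z i) e) : SmoothFieldAt I (∑ i ∈ s, Z i) e := by
  classical
  induction s using Finset.induction_on with
  | empty =>
    exact contMDiffAt_zeroSection (IB := I) (F := EN) (n := ∞) ℝ (TangentSpace I : N → Type _)
  | insert i s hi ih =>
    rw [Finset.sum_insert hi]
    exact (h i (by simp)).add (ih fun j hj => h j (by simp [hj]))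

variable [CompleteSpace EN]

theorem SmoothFieldAt.bracket {Z W : ∀ e : N, TangentSpace I e} {e : N}
    (h : SmoothFieldAt I Z e) (hW : SmoothFieldAt I W e) :
    SmoothFieldAt I (mlieBracket I Z W) e := by
  have : IsManifold I (((⊤ : ℕ∞) : WithTop ℕ∞) + 1) N := by simpa using ‹IsManifold I ∞ N›
  have : IsManifold I (minSmoothness ℝ 2) N := by
    simp only [minSmoothness_of_isRCLikeNormedField]; exact IsManifold.of_le (n := ∞) (by norm_cast)
  have := ContMDiffAt.mlieBracket_vectorField (I := I) (m := ⊤) (n := ⊤) h hW (by simp)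
  exact this

theorem bracket_jacobi {U V W : ∀ e : N, TangentSpace I e} {e : N}
    (hU : SmoothFieldAt I U e) (hV : SmoothFieldAt I V e) (hW : SmoothFieldAt I W e) :
    mlieBracket I U (mlieBracket I V W) e =
      mlieBracket I (mlieBracket I U V) W e + mlieBracket I V (mlieBracket I U W) e := by
  have : IsManifold I (minSmoothness ℝ 3) N := by
    simp only [minSmoothness_of_isRCLikeNormedField]; exact IsManifold.of_le (n := ∞) (by norm_cast)
  refine leibniz_identity_mlieBracket_apply ?_ ?_ ?_
  all_goals simp only [minSmoothness_of_isRCLikeNormedField]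
  · exact ContMDiffAt.of_le hU ENat.LEInfty.out
  · exact ContMDiffAt.of_le hV ENat.LEInfty.out
  · exact ContMDiffAt.of_le hW ENat.LEInfty.out

theorem bracket_smul_right {f : N → ℝ} {V W : ∀ e : N, TangentSpace I e} {e : N}
    (hf : MDifferentiableAt I 𝓘(ℝ, ℝ) f e)
    (hW : MDifferentiableAt I I.tangent (fun e' => (⟨e', W e'⟩ : TangentBundle I N)) e) :
    mlieBracket I V (f • W) e = along I V f e • W e + f e • mlieBracket I V W e :=
  mlieBracket_smul_right hf hW

theorem bracket_sum_right {ι : Type*} (s : Finset ι) {V : ∀ e : N, TangentSpace I e}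
    {W : ι → ∀ e : N, TangentSpace I e} {e : N} (hW : ∀ i ∈ s, SmoothFieldAt I (W i) e) :
    mlieBracket I V (∑ i ∈ s, W i) e = ∑ i ∈ s, mlieBracket I V (W i) e := by
  classical
  induction s using Finset.induction_on with
  | empty =>
    rw [Finset.sum_empty, Finset.sum_empty, mlieBracket_zero_right]
    rfl
  | insert i s hi ih =>
    have hs : ∀ j ∈ s, SmoothFieldAt I (W j) e := fun j hj => hW j (Finset.mem_insert_of_mem hj)
    rw [Finset.sum_insert hi, Finset.sum_insert hi, mlieBracket_add_right
      (hW i (Finset.mem_insert_self i s)).mdiff (SmoothFieldAt.sum s hs).mdiff, ih hs]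

/-- The bracket of vector fields acts on functions as the commutator. This follows from the Jacobi
identity for `V`, `W` and `f U`, expanded by the Leibniz rule, where `U` does not vanish at `e`. -/
theorem along_bracket_real {V W : ∀ e : N, TangentSpace I e} {f : N → ℝ} {e : N}
    (hf : ContMDiffAt I 𝓘(ℝ, ℝ) ∞ f e) (hV : SmoothFieldAt I V e) (hW : SmoothFieldAt I W e) :
    along I (mlieBracket I V W) f e =
      along I V (along I W f) e - along I W (along I V f) e := by
  -- In dimension zero there is no nonvanishing `U`, but all tangent vectors vanish.
  rcases subsingleton_or_nontrivial EN with h | h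
  · have : ∀ z : TangentSpace I e, z = 0 := fun z => h.elim (α := EN) z 0
    simp [along, this (V e), this (W e), this (mlieBracket I V W e)]
  obtain ⟨u, hu⟩ := exists_ne (0 : EN)
  let u' : TangentSpace I e := u
  have hu' : u' ≠ 0 := hu
  let U : ∀ e : N, TangentSpace I e := FiberBundle.extend EN u'
  have hU : SmoothFieldAt I U e := FiberBundle.contMDiffAt_extend I EN u'
  have hUe : U e = u' := FiberBundle.extend_apply_self EN u'
  have hJ := bracket_jacobi hV hW (hU.smul hf)
  have hVf := contMDiffAt_along hf hV
  have hWf := contMDiffAt_along hf hW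
  have key : ∀ {X Y : ∀ e : N, TangentSpace I e}, SmoothFieldAt I X e → SmoothFieldAt I Y e →
      mlieBracket I X (mlieBracket I Y (f • U)) e =
        along I X (along I Y f) e • U e + along I Y f e • mlieBracket I X U e +
        (along I X f e • mlieBracket I Y U e + f e • mlieBracket I X (mlieBracket I Y U) e) := by
    intro X Y hX hY
    have h1 : mlieBracket I Y (f • U) =ᶠ[𝓝 e] along I Y f • U + f • mlieBracket I Y U := by
      filter_upwards [eventually_mdiff hf, hU.eventually_mdiff] with e' h1 h2
      exact bracket_smul_right h1 h2
    have hYf := contMDiffAt_along hf hY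
    rw [EventuallyEq.mlieBracket_vectorField_eq (EventuallyEq.refl _ X) h1,
      mlieBracket_add_right (hU.smul hYf).mdiff ((hY.bracket hU).smul hf).mdiff,
      bracket_smul_right (mdiff_of_smooth hYf) hU.mdiff,
      bracket_smul_right (mdiff_of_smooth hf) (hY.bracket hU).mdiff]
  rw [key hV hW, key hW hV, bracket_smul_right (mdiff_of_smooth hf) hU.mdiff,
    bracket_jacobi hV hW hU, hUe] at hJ
  rw [← sub_eq_zero] at hJ ⊢
  refine (smul_eq_zero.1 (?_ : _ • u' = 0)).resolve_right hu'
  rw [← neg_eq_zero, ← hJ]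
  module

/-- The bracket of vector fields acts on vector-valued functions as the commutator. -/
theorem along_bracket [FiniteDimensional ℝ G] {V W : ∀ e : N, TangentSpace I e} {f : N → G}
    {e : N} (hf : ContMDiffAt I 𝓘(ℝ, G) ∞ f e) (hV : SmoothFieldAt I V e)
    (hW : SmoothFieldAt I W e) :
    along I (mlieBracket I V W) f e =
      along I V (along I W f) e - along I W (along I V f) e := by
  let b := Module.finBasis ℝ G
  refine b.ext_elem fun i => ?_
  let ℓ : G →L[ℝ] ℝ := LinearMap.toContinuousLinearMap (b.coord i)
  change ℓ _ = ℓ _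
  have hℓ : ContMDiffAt I 𝓘(ℝ, ℝ) ∞ (fun e => ℓ (f e)) e :=
    ℓ.contMDiff.contMDiffAt.comp e hf
  have h := along_bracket_real hℓ hV hW
  have key : ∀ {X Y : ∀ e : N, TangentSpace I e}, SmoothFieldAt I X e → SmoothFieldAt I Y e →
      along I X (along I Y fun e => ℓ (f e)) e = ℓ (along I X (along I Y f) e) := by
    intro X Y hX hY
    have h1 : along I Y (fun e => ℓ (f e)) =ᶠ[𝓝 e] fun e => ℓ (along I Y f e) := by
      filter_upwards [eventually_mdiff hf] with e' h1
      exact mvfderiv_clm_comp ℓ h1 _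
    unfold along at h1 ⊢
    rw [mvfderiv_congr h1]
    exact mvfderiv_clm_comp ℓ (mdiff_of_smooth (contMDiffAt_along hf hY)) _
  rw [key hV hW, key hW hV] at h
  rw [map_sub, ← h]
  exact (mvfderiv_clm_comp ℓ (mdiff_of_smooth hf) _).symm

end Manifold

/-! ### Preferred trivializations -/

section Bundle

variable {EM : Type*} [NormedAddCommGroup EM] [NormedSpace ℝ EM]
  {M : Type*} [TopologicalSpace M] [ChartedSpace EM M]
  {F : Type*} [NormedAddCommGroup F] [NormedSpace ℝ F]
  {V : M → Type*} [TopologicalSpace (TotalSpace F V)]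
  [∀ x, AddCommGroup (V x)] [∀ x, Module ℝ (V x)] [∀ x, TopologicalSpace (V x)]
  [FiberBundle F V] [VectorBundle ℝ F V]

local notation "IE" => ModelWithCorners.prod 𝓘(ℝ, EM) 𝓘(ℝ, F)
local notation "dπ" =>
  mfderiv (ModelWithCorners.prod 𝓘(ℝ, EM) 𝓘(ℝ, F)) 𝓘(ℝ, EM) (TotalSpace.proj : TotalSpace F V → M)

variable (EM F V) in
/-- The domain, around `x₀`, of both the preferred chart and the preferred trivialization. -/
def dom (x₀ : M) : Set M := (trivializationAt F V x₀).baseSet ∩ (chartAt EM x₀).source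

theorem isOpen_dom (x₀ : M) : IsOpen (dom EM F V x₀) :=
  (trivializationAt F V x₀).open_baseSet.inter (chartAt EM x₀).open_source

theorem mem_dom (x₀ : M) : x₀ ∈ dom EM F V x₀ :=
  ⟨FiberBundle.mem_baseSet_trivializationAt' x₀, mem_chart_source EM x₀⟩

theorem eventually_proj {p : M → Prop} {e : TotalSpace F V} (h : ∀ᶠ x in 𝓝 e.proj, p x) :
    ∀ᶠ e' : TotalSpace F V in 𝓝 e, p e'.proj :=
  (FiberBundle.continuous_proj F V).continuousAt.eventually h

theorem eventually_dom {x₀ x : M} (hx : x ∈ dom EM F V x₀) : ∀ᶠ x' in 𝓝 x, x' ∈ dom EM F V x₀ :=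
  (isOpen_dom x₀).mem_nhds hx

theorem eventually_proj_dom {x₀ : M} {e : TotalSpace F V} (hx : e.proj ∈ dom EM F V x₀) :
    ∀ᶠ e' : TotalSpace F V in 𝓝 e, e'.proj ∈ dom EM F V x₀ :=
  eventually_proj (eventually_dom hx)

variable (F) in
/-- The fibre coordinate of a vector `u ∈ V x` in the preferred trivialization around `x₀`. -/
def loc (x₀ x : M) (u : V x) : F := (trivializationAt F V x₀ (⟨x, u⟩ : TotalSpace F V)).2

/-- The fibre coordinate on the total space. -/
def fc (x₀ : M) (e : TotalSpace F V) : F := loc F x₀ e.proj e.2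

variable (EM) in
/-- The base coordinate on the total space. -/
def bc (x₀ : M) (e : TotalSpace F V) : EM := extChartAt 𝓘(ℝ, EM) x₀ e.proj

/-- The local representative of a section of `π^*E`. -/
def coord (x₀ : M) (σ : PullSec F V) (e : TotalSpace F V) : F := loc F x₀ e.proj (σ e)

variable {x₀ x : M}

theorem loc_isLinear (hx : x ∈ dom EM F V x₀) : IsLinearMap ℝ (loc F x₀ x : V x → F) :=
  (trivializationAt F V x₀).linear ℝ hx.1

theorem loc_add (hx : x ∈ dom EM F V x₀) (u v : V x) :
    loc F x₀ x (u + v) = loc F x₀ x u + loc F x₀ x v :=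
  (loc_isLinear hx).map_add u v

theorem loc_smul (hx : x ∈ dom EM F V x₀) (c : ℝ) (u : V x) :
    loc F x₀ x (c • u) = c • loc F x₀ x u :=
  (loc_isLinear hx).map_smul c u

theorem loc_sub (hx : x ∈ dom EM F V x₀) (u v : V x) :
    loc F x₀ x (u - v) = loc F x₀ x u - loc F x₀ x v :=
  (loc_isLinear hx).map_sub u v

theorem loc_neg (hx : x ∈ dom EM F V x₀) (u : V x) : loc F x₀ x (-u) = -loc F x₀ x u :=
  (loc_isLinear hx).map_neg u

theorem loc_zero (hx : x ∈ dom EM F V x₀) : loc F x₀ x (0 : V x) = 0 :=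
  (loc_isLinear hx).map_zero

variable (F) in
/-- The inverse of `loc`. -/
def locSymm (x₀ x : M) (v : F) : V x := (trivializationAt F V x₀).symm x v

theorem loc_locSymm (hx : x ∈ dom EM F V x₀) (v : F) :
    loc F x₀ x (locSymm F x₀ x v : V x) = v := by
  simp [loc, locSymm, Trivialization.apply_mk_symm _ hx.1]

theorem locSymm_loc (hx : x ∈ dom EM F V x₀) (u : V x) : locSymm F x₀ x (loc F x₀ x u) = u :=
  Trivialization.symm_apply_apply_mk _ hx.1 u

theorem loc_inj (hx : x ∈ dom EM F V x₀) {u v : V x} (h : loc F x₀ x u = loc F x₀ x v) : u = v := by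
  rw [← locSymm_loc hx u, h, locSymm_loc hx]

theorem locSymm_add (hx : x ∈ dom EM F V x₀) (v w : F) :
    (locSymm F x₀ x (v + w) : V x) = locSymm F x₀ x v + locSymm F x₀ x w :=
  loc_inj hx (by simp [loc_locSymm hx, loc_add hx])

theorem locSymm_smul (hx : x ∈ dom EM F V x₀) (c : ℝ) (v : F) :
    (locSymm F x₀ x (c • v) : V x) = c • locSymm F x₀ x v :=
  loc_inj hx (by simp [loc_locSymm hx, loc_smul hx])

/-- The linear isomorphism `V x ≃ F` given by the trivialization. -/
def locEquiv (hx : x ∈ dom EM F V x₀) : V x ≃ₗ[ℝ] F where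
  toFun := loc F x₀ x
  map_add' := loc_add hx
  map_smul' := loc_smul hx
  invFun := locSymm F x₀ x
  left_inv := locSymm_loc hx
  right_inv := loc_locSymm hx

theorem coord_delta (x₀ : M) : coord x₀ (delta : PullSec F V) = fc x₀ := rfl

variable [IsManifold 𝓘(ℝ, EM) ∞ M] [ContMDiffVectorBundle ∞ F V 𝓘(ℝ, EM)]

/-! ### Coordinates on the total space -/

theorem contMDiff_totalProj : ContMDiff IE 𝓘(ℝ, EM) ∞ (TotalSpace.proj : TotalSpace F V → M) :=
  contMDiff_proj V

theorem mdiff_proj (e : TotalSpace F V) :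
    MDifferentiableAt IE 𝓘(ℝ, EM) (TotalSpace.proj : TotalSpace F V → M) e :=
  contMDiff_totalProj.contMDiffAt.mdifferentiableAt (by simp)

/-- Smoothness of a map into the total space, in terms of the fibre coordinate around `x₀`. -/
theorem contMDiffAt_totalSpace_iff {EN : Type*} [NormedAddCommGroup EN] [NormedSpace ℝ EN]
    {HN : Type*} [TopologicalSpace HN] {I : ModelWithCorners ℝ EN HN}
    {N : Type*} [TopologicalSpace N] [ChartedSpace HN N] {f : N → TotalSpace F V} {n : N}
    (hx : (f n).proj ∈ dom EM F V x₀) :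
    ContMDiffAt I IE ∞ f n ↔ ContMDiffAt I 𝓘(ℝ, EM) ∞ (fun n => (f n).proj) n ∧
      ContMDiffAt I 𝓘(ℝ, F) ∞ (fun n => fc x₀ (f n)) n :=
  Trivialization.contMDiffAt_iff (e := trivializationAt F V x₀)
    ((Trivialization.mem_source _).2 hx.1)

theorem fc_smooth {e : TotalSpace F V} (hx : e.proj ∈ dom EM F V x₀) :
    ContMDiffAt IE 𝓘(ℝ, F) ∞ (fc x₀ : TotalSpace F V → F) e :=
  ((contMDiffAt_totalSpace_iff (f := id) hx).1 contMDiffAt_id).2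

theorem chart_smooth (hx : x ∈ dom EM F V x₀) :
    ContMDiffAt 𝓘(ℝ, EM) 𝓘(ℝ, EM) ∞ (extChartAt 𝓘(ℝ, EM) x₀) x :=
  contMDiffAt_extChartAt' hx.2

theorem bc_smooth {e : TotalSpace F V} (hx : e.proj ∈ dom EM F V x₀) :
    ContMDiffAt IE 𝓘(ℝ, EM) ∞ (bc EM x₀ : TotalSpace F V → EM) e :=
  (chart_smooth hx).comp e contMDiff_totalProj.contMDiffAt

theorem smooth_comp_proj {G : Type*} [NormedAddCommGroup G] [NormedSpace ℝ G] {f : M → G}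
    {e : TotalSpace F V} (hf : ContMDiffAt 𝓘(ℝ, EM) 𝓘(ℝ, G) ∞ f e.proj) :
    ContMDiffAt IE 𝓘(ℝ, G) ∞ (fun e : TotalSpace F V => f e.proj) e :=
  hf.comp e contMDiff_totalProj.contMDiffAt

theorem mvfderiv_comp_proj {G : Type*} [NormedAddCommGroup G] [NormedSpace ℝ G] {f : M → G}
    {e : TotalSpace F V} (hf : MDifferentiableAt 𝓘(ℝ, EM) 𝓘(ℝ, G) f e.proj)
    (z : TangentSpace IE e) :
    mvfderiv IE (fun e : TotalSpace F V => f e.proj) e z =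
      mvfderiv 𝓘(ℝ, EM) f e.proj
        (dπ e z) :=
  mvfderiv_comp_map hf (mdiff_proj e) z

theorem mvfderiv_bc {e : TotalSpace F V} (hx : e.proj ∈ dom EM F V x₀) (z : TangentSpace IE e) :
    mvfderiv IE (bc EM x₀ : TotalSpace F V → EM) e z =
      mvfderiv 𝓘(ℝ, EM) (extChartAt 𝓘(ℝ, EM) x₀) e.proj
        (dπ e z) :=
  mvfderiv_comp_proj (mdiff_of_smooth (chart_smooth hx)) z

/-- The chart of the total space around a point consists of the base coordinate and the fibre
coordinate. -/
theorem extChartAt_total_eq {e : TotalSpace F V} {e₀ : TotalSpace F V}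
    (hx : e.proj ∈ dom EM F V e₀.proj) :
    extChartAt IE e₀ e = (bc EM e₀.proj e, fc e₀.proj e) := by
  rw [FiberBundle.extChartAt]
  simp [bc, fc, loc, Trivialization.coe_fst' _ hx.1]

theorem mvfderiv_extChartAt_total {e : TotalSpace F V} {e₀ : TotalSpace F V}
    (hx : e.proj ∈ dom EM F V e₀.proj) (z : TangentSpace IE e) :
    mvfderiv IE (extChartAt IE e₀) e z =
      (mvfderiv IE (bc EM e₀.proj : TotalSpace F V → EM) e z, mvfderiv IE (fc e₀.proj) e z) := by
  have h : (extChartAt IE e₀ : TotalSpace F V → EM × F) =ᶠ[𝓝 e]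
      fun e' => (bc EM e₀.proj e', fc e₀.proj e') := by
    filter_upwards [eventually_proj_dom hx] with e' he' using extChartAt_total_eq he'
  rw [mvfderiv_congr h]
  have h1 := mdiff_of_smooth (bc_smooth hx)
  have h2 := mdiff_of_smooth (fc_smooth hx)
  have hp : HasMFDerivAt IE 𝓘(ℝ, EM × F) (fun e' => (bc EM e₀.proj e', fc e₀.proj e')) e
      ((mvfderiv IE (bc EM e₀.proj) e).prod (mvfderiv IE (fc e₀.proj) e)) :=
    ⟨h1.continuousAt.prodMk h2.continuousAt, h1.hasMFDerivAt.2.prodMk h2.hasMFDerivAt.2⟩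
  exact DFunLike.congr_fun hp.mfderiv z

theorem mem_total_chart {e e₀ : TotalSpace F V} (hx : e.proj ∈ dom EM F V e₀.proj) :
    e ∈ (chartAt (ModelProd EM F) e₀).source := by
  rw [FiberBundle.chartedSpace_chartAt]
  simp [hx.1, hx.2, Trivialization.mem_source]

/-- A tangent vector of the total space is determined by its coordinates. -/
theorem tangent_ext {e : TotalSpace F V} (hx : e.proj ∈ dom EM F V x₀) {z w : TangentSpace IE e}
    (h1 : mvfderiv IE (bc EM x₀ : TotalSpace F V → EM) e z = mvfderiv IE (bc EM x₀) e w)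
    (h2 : mvfderiv IE (fc x₀ : TotalSpace F V → F) e z = mvfderiv IE (fc x₀) e w) : z = w := by
  refine eq_of_mvfderiv_chart (I := IE) (e₀ := (⟨x₀, 0⟩ : TotalSpace F V)) (mem_total_chart hx) ?_
  rw [mvfderiv_extChartAt_total hx, mvfderiv_extChartAt_total hx, h1, h2]

theorem tangent_ext_base {y : M} (hx : y ∈ dom EM F V x₀)
    {z w : TangentSpace 𝓘(ℝ, EM) y}
    (h : mvfderiv 𝓘(ℝ, EM) (extChartAt 𝓘(ℝ, EM) x₀) y z =
      mvfderiv 𝓘(ℝ, EM) (extChartAt 𝓘(ℝ, EM) x₀) y w) : z = w :=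
  eq_of_mvfderiv_chart hx.2 h

/-- A vector field on the total space is smooth if and only if the derivatives of the coordinates
along it are. -/
theorem smoothField_iff {Z : ∀ e : TotalSpace F V, TangentSpace IE e} {e : TotalSpace F V} :
    SmoothFieldAt IE Z e ↔
      ContMDiffAt IE 𝓘(ℝ, EM) ∞ (along IE Z (bc EM e.proj)) e ∧
      ContMDiffAt IE 𝓘(ℝ, F) ∞ (along IE Z (fc e.proj)) e := by
  rw [smoothFieldAt_iff]
  have h : along IE Z (extChartAt IE e) =ᶠ[𝓝 e]
      fun e' => (along IE Z (bc EM e.proj) e', along IE Z (fc e.proj) e') := by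
    filter_upwards [eventually_proj_dom (mem_dom (EM := EM) e.proj)] with e' he'
    exact mvfderiv_extChartAt_total he' _
  have h2 := Filter.EventuallyEq.contMDiffAt_iff (I := IE) (I' := 𝓘(ℝ, EM × F)) (n := ∞) h
  refine h2.trans ?_
  exact contMDiffAt_prod_module_iff _

/-! ### Vertical vectors -/

theorem vert_curve (e : TotalSpace F V) (u : V e.proj) :
    ContMDiffAt 𝓘(ℝ, ℝ) IE ∞ (fun t : ℝ => (⟨e.proj, e.2 + t • u⟩ : TotalSpace F V)) 0 := by
  rw [contMDiffAt_totalSpace_iff (mem_dom e.proj)]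
  refine ⟨contMDiffAt_const, ?_⟩
  have : (fun t : ℝ => fc e.proj (⟨e.proj, e.2 + t • u⟩ : TotalSpace F V)) =
      fun t : ℝ => loc F e.proj e.proj e.2 + t • loc F e.proj e.proj u := by
    funext t
    simp only [fc, loc_add (mem_dom (EM := EM) e.proj), loc_smul (mem_dom (EM := EM) e.proj)]
  rw [this]
  exact (contDiff_const.add (contDiff_id.smul contDiff_const)).contMDiff.contMDiffAt

theorem mfderiv_proj_vert (e : TotalSpace F V) (u : V e.proj) :
    dπ e (vert EM e u) = 0 := by
  have hc : MDifferentiableAt 𝓘(ℝ, ℝ) IE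
      (fun t : ℝ => (⟨e.proj, e.2 + t • u⟩ : TotalSpace F V)) 0 :=
    (vert_curve e u).mdifferentiableAt (by simp)
  have h0 : (⟨e.proj, e.2 + (0 : ℝ) • u⟩ : TotalSpace F V) = e := by simp
  have h := mfderiv_comp_apply_of_eq (0 : ℝ) (mdiff_proj e) hc h0 (1 : ℝ)
  rw [show (TotalSpace.proj : TotalSpace F V → M) ∘
    (fun t : ℝ => (⟨e.proj, e.2 + t • u⟩ : TotalSpace F V)) = fun _ => e.proj from rfl,
    mfderiv_const] at h
  rw [h0] at h
  exact h.symm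

theorem mvfderiv_fc_vert {e : TotalSpace F V} (hx : e.proj ∈ dom EM F V x₀) (u : V e.proj) :
    mvfderiv IE (fc x₀ : TotalSpace F V → F) e (vert EM e u) = loc F x₀ e.proj u := by
  have hc : MDifferentiableAt 𝓘(ℝ, ℝ) IE
      (fun t : ℝ => (⟨e.proj, e.2 + t • u⟩ : TotalSpace F V)) 0 :=
    (vert_curve e u).mdifferentiableAt (by simp)
  have h0 : (⟨e.proj, e.2 + (0 : ℝ) • u⟩ : TotalSpace F V) = e := by simp
  have h := mfderiv_comp_apply_of_eq (0 : ℝ) (mdiff_of_smooth (fc_smooth hx)) hc h0 (1 : ℝ)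
  rw [h0] at h
  have h1 : (fc x₀ : TotalSpace F V → F) ∘
      (fun t : ℝ => (⟨e.proj, e.2 + t • u⟩ : TotalSpace F V)) =
      fun t : ℝ => loc F x₀ e.proj e.2 + t • loc F x₀ e.proj u := by
    funext t
    simp only [fc, Function.comp, loc_add hx, loc_smul hx]
  have h2 : HasFDerivAt (fun t : ℝ => loc F x₀ e.proj e.2 + t • loc F x₀ e.proj u)
      (ContinuousLinearMap.toSpanSingleton ℝ (loc F x₀ e.proj u)) 0 :=
    HasFDerivAt.const_add _ (ContinuousLinearMap.toSpanSingleton ℝ _).hasFDerivAt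
  rw [h1, h2.hasMFDerivAt.mfderiv] at h
  refine Eq.trans h.symm ?_
  exact one_smul ℝ _

theorem mvfderiv_bc_vert {e : TotalSpace F V} (hx : e.proj ∈ dom EM F V x₀) (u : V e.proj) :
    mvfderiv IE (bc EM x₀ : TotalSpace F V → EM) e (vert EM e u) = 0 := by
  rw [mvfderiv_bc hx, mfderiv_proj_vert, map_zero]

/-- The vertical tangent vectors are the vertical lifts. -/
theorem eq_vert {e : TotalSpace F V} (hx : e.proj ∈ dom EM F V x₀) {z : TangentSpace IE e}
    (hz : dπ e z = 0) : z = vert EM e (locSymm F x₀ e.proj (mvfderiv IE (fc x₀) e z)) := by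
  refine tangent_ext hx ?_ ?_
  · rw [mvfderiv_bc_vert hx, mvfderiv_bc hx, hz, map_zero]
  · rw [mvfderiv_fc_vert hx, loc_locSymm hx]

theorem vert_injective (e : TotalSpace F V) : Function.Injective (vert EM e) := by
  intro u v h
  have hx := mem_dom (EM := EM) (F := F) (V := V) e.proj
  refine loc_inj hx ?_
  rw [← mvfderiv_fc_vert hx, ← mvfderiv_fc_vert hx, h]

theorem vert_add (e : TotalSpace F V) (u v : V e.proj) :
    vert EM e (u + v) = vert EM e u + vert EM e v := by
  have hx := mem_dom (EM := EM) (F := F) (V := V) e.proj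
  refine tangent_ext hx ?_ ?_
  · simp only [map_add, mvfderiv_bc_vert hx, add_zero]
  · simp only [map_add, mvfderiv_fc_vert hx, loc_add hx]

theorem vert_smul (e : TotalSpace F V) (c : ℝ) (u : V e.proj) :
    vert EM e (c • u) = c • vert EM e u := by
  have hx := mem_dom (EM := EM) (F := F) (V := V) e.proj
  refine tangent_ext hx ?_ ?_
  · simp only [map_smul, mvfderiv_bc_vert hx, smul_zero]
  · simp only [map_smul, mvfderiv_fc_vert hx, loc_smul hx]

variable (EM) in
/-- The vertical lift at `e` as a linear map. -/
def vertL (e : TotalSpace F V) : V e.proj →ₗ[ℝ] TangentSpace IE e where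
  toFun := vert EM e
  map_add' := vert_add e
  map_smul' := vert_smul e

theorem iMap_injective (e : TotalSpace F V) : Function.Injective (iMap EM e) :=
  fun _ _ h => vert_injective e (Prod.ext_iff.1 h).2

theorem iInv_iMap (e : TotalSpace F V) (u : V e.proj) : iInv (EM := EM) e (iMap EM e u) = u :=
  Function.leftInverse_invFun (iMap_injective e) u

/-- `i⁻¹` is a genuine inverse on the vertical elements. -/
theorem vert_iInv {e : TotalSpace F V} {p : V e.proj × TangentSpace IE e} (h1 : p.1 = 0)
    (h2 : dπ e p.2 = 0) : vert EM e (iInv e p) = p.2 := by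
  have h : p = iMap EM e (locSymm F e.proj e.proj (mvfderiv IE (fc e.proj) e p.2)) :=
    Prod.ext h1 (eq_vert (mem_dom e.proj) h2)
  rw [h, iInv_iMap]
  rfl

/-! ### Sections of the pullback bundle -/

variable (EM) in
/-- The vertical vector field `σ^∨` of a section `σ` of `π^*E`. -/
def vf (σ : PullSec F V) : ∀ e : TotalSpace F V, TangentSpace IE e := fun e => vert EM e (σ e)

theorem isSmoothPullSec_iff {σ : PullSec F V} :
    IsSmoothPullSec EM σ ↔ ∀ (x₀ : M) (e : TotalSpace F V), e.proj ∈ dom EM F V x₀ →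
      ContMDiffAt IE 𝓘(ℝ, F) ∞ (coord x₀ σ) e := by
  constructor
  · intro h x₀ e hx
    exact ((contMDiffAt_totalSpace_iff (f := fun e : TotalSpace F V =>
      (⟨e.proj, σ e⟩ : TotalSpace F V)) hx).1 (h e)).2
  · intro h e
    exact (contMDiffAt_totalSpace_iff (mem_dom e.proj)).2
      ⟨contMDiff_totalProj.contMDiffAt, h e.proj e (mem_dom e.proj)⟩

theorem IsSmoothPullSec.coord {σ : PullSec F V} (h : IsSmoothPullSec EM σ) {e : TotalSpace F V}
    (hx : e.proj ∈ dom EM F V x₀) : ContMDiffAt IE 𝓘(ℝ, F) ∞ (coord x₀ σ) e :=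
  isSmoothPullSec_iff.1 h x₀ e hx

theorem isSmoothPullSec_of_coord {σ : PullSec F V}
    (h : ∀ e, ContMDiffAt IE 𝓘(ℝ, F) ∞ (LieAlgd.coord e.proj σ) e) : IsSmoothPullSec EM σ :=
  fun e => (contMDiffAt_totalSpace_iff (mem_dom e.proj)).2
      ⟨contMDiff_totalProj.contMDiffAt, h e⟩

theorem along_vf_bc {σ : PullSec F V} {e : TotalSpace F V} (hx : e.proj ∈ dom EM F V x₀) :
    along IE (vf EM σ) (bc EM x₀) e = 0 := mvfderiv_bc_vert hx _

theorem along_vf_fc {σ : PullSec F V} {e : TotalSpace F V} (hx : e.proj ∈ dom EM F V x₀) :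
    along IE (vf EM σ) (fc x₀) e = coord x₀ σ e := mvfderiv_fc_vert hx _

/-- Functions on the base are constant along the fibres. -/
theorem along_vf_comp_proj {G : Type*} [NormedAddCommGroup G] [NormedSpace ℝ G] {f : M → G}
    {σ : PullSec F V} {e : TotalSpace F V}
    (hf : MDifferentiableAt 𝓘(ℝ, EM) 𝓘(ℝ, G) f e.proj) :
    along IE (vf EM σ) (fun e => f e.proj) e = 0 := by
  rw [along, mvfderiv_comp_proj hf, vf, mfderiv_proj_vert, map_zero]

/-- A section of `π^*E` is smooth if and only if its vertical lift is. Since the operators below are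
identified through vertical lifts, this is how their values are seen to be smooth. -/
theorem vf_smooth_iff {σ : PullSec F V} :
    (∀ e, SmoothFieldAt IE (vf EM σ) e) ↔ IsSmoothPullSec EM σ := by
  have key : ∀ e : TotalSpace F V, along IE (vf EM σ) (fc e.proj) =ᶠ[𝓝 e] coord e.proj σ :=
    fun e => (eventually_proj_dom (mem_dom (EM := EM) e.proj)).mono fun e' he' => along_vf_fc he'
  constructor
  · intro h
    exact isSmoothPullSec_of_coord fun e =>
      ((smoothField_iff.1 (h e)).2).congr_of_eventuallyEq (key e).symm
  · intro h e
    refine smoothField_iff.2 ⟨?_, (h.coord (mem_dom e.proj)).congr_of_eventuallyEq (key e)⟩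
    refine (contMDiffAt_const (c := (0 : EM))).congr_of_eventuallyEq ?_
    exact (eventually_proj_dom (mem_dom (EM := EM) e.proj)).mono fun e' he' => along_vf_bc he'

theorem IsSmoothPullSec.vf {σ : PullSec F V} (h : IsSmoothPullSec EM σ) (e : TotalSpace F V) :
    SmoothFieldAt IE (vf EM σ) e := vf_smooth_iff.2 h e

theorem hat_smooth (ξ : Sec EM F V) : IsSmoothPullSec EM (hat ξ) :=
  ξ.contMDiff.comp contMDiff_totalProj

theorem delta_smooth : IsSmoothPullSec EM (delta : PullSec F V) := contMDiff_id

theorem sec_smooth (ξ : Sec EM F V) (hx : x ∈ dom EM F V x₀) :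
    ContMDiffAt 𝓘(ℝ, EM) 𝓘(ℝ, F) ∞ (fun x => loc F x₀ x (ξ x)) x :=
  ((contMDiffAt_totalSpace_iff (f := fun x => (⟨x, ξ x⟩ : TotalSpace F V)) hx).1
    (ξ.contMDiff x)).2

/-- Smooth sections are closed under sums. -/
theorem IsSmoothPullSec.add {σ τ : PullSec F V} (h : IsSmoothPullSec EM σ)
    (h' : IsSmoothPullSec EM τ) : IsSmoothPullSec EM (σ + τ) :=
  isSmoothPullSec_of_coord fun e => by
    refine ((h.coord (mem_dom e.proj)).add (h'.coord (mem_dom e.proj))).congr_of_eventuallyEq ?_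
    exact (eventually_proj_dom (mem_dom (EM := EM) e.proj)).mono fun e' he' => loc_add he' _ _

/-- The product of a function and a section of `π^*E`. -/
def fmul (f : TotalSpace F V → ℝ) (σ : PullSec F V) : PullSec F V := fun e => f e • σ e

theorem IsSmoothPullSec.fmul {f : TotalSpace F V → ℝ} {σ : PullSec F V}
    (hf : ContMDiff IE 𝓘(ℝ, ℝ) ∞ f) (h : IsSmoothPullSec EM σ) : IsSmoothPullSec EM (fmul f σ) :=
  isSmoothPullSec_of_coord fun e => by
    refine ((hf e).smul (h.coord (mem_dom e.proj))).congr_of_eventuallyEq ?_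
    exact (eventually_proj_dom (mem_dom (EM := EM) e.proj)).mono fun e' he' => loc_smul he' _ _

theorem smul_eq_fmul (c : ℝ) (σ : PullSec F V) : c • σ = fmul (fun _ => c) σ := rfl

theorem IsSmoothPullSec.const_smul (c : ℝ) {σ : PullSec F V} (h : IsSmoothPullSec EM σ) :
    IsSmoothPullSec EM (c • σ) := by
  rw [smul_eq_fmul]
  exact IsSmoothPullSec.fmul contMDiff_const h

theorem IsSmoothPullSec.sub {σ τ : PullSec F V} (h : IsSmoothPullSec EM σ)
    (h' : IsSmoothPullSec EM τ) : IsSmoothPullSec EM (σ - τ) := by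
  have := h.add (h'.const_smul (-1))
  rwa [neg_smul, one_smul, ← sub_eq_add_neg] at this

theorem zero_smooth : IsSmoothPullSec EM (0 : PullSec F V) := by
  have := (delta_smooth (EM := EM) (F := F) (V := V)).const_smul 0
  rwa [zero_smul] at this

/-! ### Vertical derivatives -/

theorem loc_fibreDeriv (σ : PullSec F V) (e : TotalSpace F V) (z : TangentSpace IE e) :
    loc F e.proj e.proj (fibreDeriv σ e z) = mvfderiv IE (coord e.proj σ) e z :=
  loc_locSymm (mem_dom (EM := EM) e.proj) _

/-- The change of the local representative of a section under a change of the trivialization. -/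
theorem coord_change {x₁ : M} (hx : x ∈ dom EM F V x₀) (hx' : x ∈ dom EM F V x₁) (u : V x) :
    loc F x₁ x u = ((trivializationAt F V x₀).coordChangeL ℝ (trivializationAt F V x₁) x :
      F →L[ℝ] F) (loc F x₀ x u) := by
  rw [ContinuousLinearEquiv.coe_coe, Trivialization.coordChangeL_apply _ _ ⟨hx.1, hx'.1⟩]
  change _ = loc F x₁ x (locSymm F x₀ x (loc F x₀ x u) : V x)
  rw [locSymm_loc hx]

/-- The derivative of a section of `π^*E` in a vertical direction does not depend on the
trivialization, as the transition functions are constant along the fibres. -/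
theorem mvfderiv_coord_change {x₁ : M} {e : TotalSpace F V} (hx : e.proj ∈ dom EM F V x₀)
    (hx' : e.proj ∈ dom EM F V x₁) {σ : PullSec F V} (hσ : IsSmoothPullSec EM σ)
    {z : TangentSpace IE e} (hz : dπ e z = 0) :
    mvfderiv IE (coord x₁ σ) e z =
      loc F x₁ e.proj (locSymm F x₀ e.proj (mvfderiv IE (coord x₀ σ) e z) : V e.proj) := by
  let Φ : M → F →L[ℝ] F := fun x =>
    ((trivializationAt F V x₀).coordChangeL ℝ (trivializationAt F V x₁) x : F →L[ℝ] F)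
  have hΦ : ContMDiffAt 𝓘(ℝ, EM) 𝓘(ℝ, F →L[ℝ] F) ∞ Φ e.proj :=
    contMDiffAt_coordChangeL hx.1 hx'.1
  have h : coord x₁ σ =ᶠ[𝓝 e] fun e' => Φ e'.proj (coord x₀ σ e') := by
    filter_upwards [eventually_proj_dom hx, eventually_proj_dom hx'] with e' h1 h2
    exact coord_change h1 h2 _
  rw [mvfderiv_congr h, mvfderiv_clm_apply (mdiff_of_smooth (smooth_comp_proj hΦ))
    (mdiff_of_smooth (hσ.coord hx)), mvfderiv_comp_proj (mdiff_of_smooth hΦ), hz, map_zero,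
    coord_change hx hx', loc_locSymm hx]
  simp [Φ]

/-- The derivative of `τ` along the vertical lift of `σ`: the differential of `τ` on the fibres. -/
def vderiv (EM : Type*) [NormedAddCommGroup EM] [NormedSpace ℝ EM] {M : Type*}
    [TopologicalSpace M] [ChartedSpace EM M]
    {F : Type*} [NormedAddCommGroup F] [NormedSpace ℝ F]
    {V : M → Type*} [TopologicalSpace (TotalSpace F V)]
    [∀ x, AddCommGroup (V x)] [∀ x, Module ℝ (V x)] [∀ x, TopologicalSpace (V x)]
    [FiberBundle F V] (σ τ : PullSec F V) : PullSec F V := fun e =>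
  fibreDeriv (EM := EM) τ e (vert EM e (σ e))

/-- In every trivialization, the vertical derivative is the componentwise derivative along `σ^∨`. -/
theorem coord_vderiv {e : TotalSpace F V} (hx : e.proj ∈ dom EM F V x₀) {σ τ : PullSec F V}
    (hτ : IsSmoothPullSec EM τ) :
    coord x₀ (vderiv EM σ τ) e = along IE (vf EM σ) (coord x₀ τ) e :=
  (mvfderiv_coord_change (mem_dom e.proj) hx hτ (mfderiv_proj_vert e _)).symm

theorem vderiv_smooth {σ τ : PullSec F V} (hσ : IsSmoothPullSec EM σ)
    (hτ : IsSmoothPullSec EM τ) : IsSmoothPullSec EM (vderiv EM σ τ) :=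
  isSmoothPullSec_of_coord fun e => by
    refine (contMDiffAt_along (hτ.coord (mem_dom e.proj)) (hσ.vf e)).congr_of_eventuallyEq ?_
    exact (eventually_proj_dom (mem_dom (EM := EM) e.proj)).mono fun e' he' => coord_vderiv he' hτ

theorem vderiv_add {ζ τ τ' : PullSec F V} (hτ : IsSmoothPullSec EM τ)
    (hτ' : IsSmoothPullSec EM τ') :
    vderiv EM ζ (τ + τ') = vderiv EM ζ τ + vderiv EM ζ τ' := by
  funext e
  have hx := mem_dom (EM := EM) (F := F) (V := V) e.proj
  refine loc_inj hx ?_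
  rw [Pi.add_apply, loc_add hx, vderiv, vderiv, vderiv, loc_fibreDeriv, loc_fibreDeriv,
    loc_fibreDeriv]
  have h : coord e.proj (τ + τ') =ᶠ[𝓝 e] fun e' => coord e.proj τ e' + coord e.proj τ' e' :=
    (eventually_proj_dom hx).mono fun e' he' => loc_add he' _ _
  rw [mvfderiv_congr h]
  exact DFunLike.congr_fun (mvfderiv_fun_add (mdiff_of_smooth (hτ.coord hx))
    (mdiff_of_smooth (hτ'.coord hx))) _

end Bundle

section Algebroid

variable {EM : Type*} [NormedAddCommGroup EM] [NormedSpace ℝ EM] [FiniteDimensional ℝ EM]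
  {M : Type*} [TopologicalSpace M] [ChartedSpace EM M] [IsManifold 𝓘(ℝ, EM) ∞ M] [T2Space M]
  {F : Type*} [NormedAddCommGroup F] [NormedSpace ℝ F] [FiniteDimensional ℝ F]
  {V : M → Type*} [TopologicalSpace (TotalSpace F V)]
  [∀ x, AddCommGroup (V x)] [∀ x, Module ℝ (V x)] [∀ x, TopologicalSpace (V x)]
  [FiberBundle F V] [VectorBundle ℝ F V] [ContMDiffVectorBundle ∞ F V 𝓘(ℝ, EM)]

local notation "IE" => ModelWithCorners.prod 𝓘(ℝ, EM) 𝓘(ℝ, F)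
local notation "dπ" =>
  mfderiv (ModelWithCorners.prod 𝓘(ℝ, EM) 𝓘(ℝ, F)) 𝓘(ℝ, EM) (TotalSpace.proj : TotalSpace F V → M)

/-! ### Local frames -/

theorem exists_bump {x : M} {U : Set M} (hU : U ∈ 𝓝 x) :
    ∃ χ : C^∞⟮𝓘(ℝ, EM), M; ℝ⟯, (∀ᶠ y in 𝓝 x, χ y = 1) ∧ tsupport χ ⊆ U := by
  obtain ⟨f, -, hf⟩ := (SmoothBumpFunction.nhds_basis_tsupport (I := 𝓘(ℝ, EM)) x).mem_iff.1 hU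
  exact ⟨⟨f, f.contMDiff⟩, f.eventuallyEq_one, hf⟩

/-- A function that is smooth near a point agrees there, locally, with a globally smooth one. -/
theorem exists_smooth_ext {G : Type*} [NormedAddCommGroup G] [NormedSpace ℝ G] {x : M} {U : Set M}
    (hU : IsOpen U) (hx : x ∈ U) {f : M → G}
    (hf : ∀ y ∈ U, ContMDiffAt 𝓘(ℝ, EM) 𝓘(ℝ, G) ∞ f y) :
    ∃ g : C^∞⟮𝓘(ℝ, EM), M; 𝓘(ℝ, G), G⟯, ∀ᶠ y in 𝓝 x, g y = f y := by
  obtain ⟨χ, h1, h2⟩ := exists_bump (EM := EM) (hU.mem_nhds hx)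
  refine ⟨⟨fun y => χ y • f y, contMDiff_of_tsupport fun y hy => ?_⟩,
    h1.mono fun y hy => by simp [hy]⟩
  have hy' : y ∈ U := h2 (tsupport_smul_subset_left _ _ hy)
  exact (χ.contMDiff y).smul (hf y hy')

theorem exists_frame (x₀ : M) : ∃ c : F →ₗ[ℝ] Sec EM F V,
    ∀ᶠ x in 𝓝 x₀, x ∈ dom EM F V x₀ ∧ ∀ v, loc F x₀ x (c v x) = v := by
  obtain ⟨χ, h1, h2⟩ := exists_bump (EM := EM) ((isOpen_dom (EM := EM) (F := F) (V := V)
    x₀).mem_nhds (mem_dom x₀))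
  have h0 : ∀ x, x ∉ dom EM F V x₀ → χ x = 0 := fun x hx =>
    image_eq_zero_of_notMem_tsupport fun h => hx (h2 h)
  have hs : ∀ v, ContMDiff 𝓘(ℝ, EM) IE ∞
      (fun x => (⟨x, χ x • locSymm F x₀ x v⟩ : TotalSpace F V)) := by
    intro v
    refine ContMDiffOn.smul_section_of_tsupport (u := dom EM F V x₀)
      (s := fun x => (locSymm F x₀ x v : V x)) χ.contMDiff.contMDiffOn (isOpen_dom x₀) h2 ?_
    intro x hx
    refine ContMDiffAt.contMDiffWithinAt ((contMDiffAt_totalSpace_iff hx).2 ⟨contMDiffAt_id, ?_⟩)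
    refine (contMDiffAt_const (c := v)).congr_of_eventuallyEq ?_
    exact (eventually_dom hx).mono fun y hy => loc_locSymm hy v
  refine ⟨{ toFun := fun v => ⟨fun x => χ x • locSymm F x₀ x v, hs v⟩
            map_add' := fun v w => ?_
            map_smul' := fun a v => ?_ }, ?_⟩
  · ext x
    change χ x • (locSymm F x₀ x (v + w) : V x) =
      χ x • (locSymm F x₀ x v : V x) + χ x • (locSymm F x₀ x w : V x)
    by_cases hx : x ∈ dom EM F V x₀
    · rw [locSymm_add hx, smul_add]
    · simp [h0 x hx]
  · ext x
    change χ x • (locSymm F x₀ x (a • v) : V x) = a • (χ x • (locSymm F x₀ x v : V x))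
    by_cases hx : x ∈ dom EM F V x₀
    · rw [locSymm_smul hx, smul_comm]
    · simp [h0 x hx]
  · filter_upwards [h1, eventually_dom (mem_dom (EM := EM) (F := F) (V := V) x₀)] with x hx hx'

    refine ⟨hx', fun v => ?_⟩
    change loc F x₀ x (χ x • (locSymm F x₀ x v : V x)) = v
    rw [hx, one_smul, loc_locSymm hx']

variable (EM F V) in
/-- Global sections `cst x₀ v`, linear in `v`, which near `x₀` are constant with value `v` in the
preferred trivialization. -/
def cst (x₀ : M) : F →ₗ[ℝ] Sec EM F V := Classical.choose (exists_frame x₀)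

variable (EM F V) in
/-- The open set where the sections `cst x₀ v` form a constant frame. -/
def frameDom (x₀ : M) : Set M :=
  interior {x | x ∈ dom EM F V x₀ ∧ ∀ v, loc F x₀ x (cst EM F V x₀ v x) = v}

variable {x₀ x : M}

theorem mem_frameDom (x₀ : M) : x₀ ∈ frameDom EM F V x₀ :=
  mem_interior_iff_mem_nhds.2 (Classical.choose_spec (exists_frame (EM := EM) (F := F) (V := V) x₀))

theorem eventually_frameDom (hx : x ∈ frameDom EM F V x₀) : ∀ᶠ y in 𝓝 x, y ∈ frameDom EM F V x₀ :=
  isOpen_interior.mem_nhds hx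

theorem eventually_proj_frameDom {e : TotalSpace F V} (hx : e.proj ∈ frameDom EM F V x₀) :
    ∀ᶠ e' : TotalSpace F V in 𝓝 e, e'.proj ∈ frameDom EM F V x₀ :=
  eventually_proj (eventually_frameDom hx)

theorem dom_of_frame (hx : x ∈ frameDom EM F V x₀) : x ∈ dom EM F V x₀ := (interior_subset hx).1

theorem loc_cst (hx : x ∈ frameDom EM F V x₀) (v : F) : loc F x₀ x (cst EM F V x₀ v x) = v :=
  (interior_subset hx).2 v

/-- The frame `cst x₀` reproduces every vector from its fibre coordinate. -/
theorem cst_loc (hx : x ∈ frameDom EM F V x₀) (u : V x) : cst EM F V x₀ (loc F x₀ x u) x = u :=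
  loc_inj (dom_of_frame hx) (loc_cst hx _)

/-- A family of continuous linear maps with prescribed values on a basis of `F`. -/
def matL {N G : Type*} [NormedAddCommGroup G] [NormedSpace ℝ G] (g : F → N → G) (x : N) :
    F →L[ℝ] G :=
  ∑ i, (LinearMap.toContinuousLinearMap ((Module.finBasis ℝ F).coord i)).smulRight
    (g (Module.finBasis ℝ F i) x)

theorem matL_apply {N G : Type*} [NormedAddCommGroup G] [NormedSpace ℝ G] {g : F → N → G} {y : N}
    (hg : IsLinearMap ℝ fun v => g v y) (v : F) : matL g y v = g v y := by
  have h := congrArg (IsLinearMap.mk' _ hg) ((Module.finBasis ℝ F).sum_repr v)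
  rw [map_sum] at h
  simp only [map_smul] at h
  change _ = IsLinearMap.mk' _ hg v
  rw [← h, matL, sum_apply]
  rfl

theorem matL_smooth {EN : Type*} [NormedAddCommGroup EN] [NormedSpace ℝ EN]
    {HN : Type*} [TopologicalSpace HN] {I : ModelWithCorners ℝ EN HN}
    {N : Type*} [TopologicalSpace N] [ChartedSpace HN N]
    {G : Type*} [NormedAddCommGroup G] [NormedSpace ℝ G] {g : F → N → G} {y : N}
    (hg : ∀ v, ContMDiffAt I 𝓘(ℝ, G) ∞ (g v) y) :
    ContMDiffAt I 𝓘(ℝ, F →L[ℝ] G) ∞ (matL g) y := by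
  refine contMDiffAt_finsetSum fun i _ => ?_
  exact (ContinuousLinearMap.smulRightL ℝ F G (LinearMap.toContinuousLinearMap
    ((Module.finBasis ℝ F).coord i))).contMDiff.contMDiffAt.comp y (hg _)

/-! ### The bracket of sections -/

namespace LieAlgebroid

variable (L : LieAlgebroid EM F V)

theorem bracket_neg_swap (ξ η : Sec EM F V) : L.bracket ξ η = -L.bracket η ξ := by
  have h := L.bracket_self (ξ + η)
  simp only [map_add, LinearMap.add_apply, L.bracket_self, zero_add, add_zero] at h
  exact eq_neg_of_add_eq_zero_right h

/-- The vector field `ρ(ξ)` on the base. -/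
def rho (ξ : Sec EM F V) (x : M) : TangentSpace 𝓘(ℝ, EM) x := L.anchor x (ξ x)

theorem rho_smooth (ξ : Sec EM F V) (x : M) : SmoothFieldAt 𝓘(ℝ, EM) (L.rho ξ) x :=
  (L.anchor_smooth.comp ξ.contMDiff) x

/-- The bracket is a local operator. -/
theorem bracket_congr (η : Sec EM F V) {ξ ξ' : Sec EM F V} (h : ∀ᶠ y in 𝓝 x, ξ y = ξ' y) :
    L.bracket η ξ x = L.bracket η ξ' x := by
  obtain ⟨χ, h1, h2⟩ := exists_bump (EM := EM) h
  have h0 : smulSec χ (ξ - ξ') = 0 := by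
    ext y
    change χ y • (ξ y - ξ' y) = 0
    by_cases hy : y ∈ tsupport χ
    · rw [show ξ y = ξ' y from h2 hy, sub_self, smul_zero]
    · rw [image_eq_zero_of_notMem_tsupport hy, zero_smul]
  have hl := L.leibniz η (ξ - ξ') χ x
  rw [h0, map_zero, h1.self_of_nhds, map_sub] at hl
  change (0 : V x) = (1 : ℝ) • (L.bracket η ξ x - L.bracket η ξ' x) + _ • (ξ x - ξ' x) at hl
  rw [h.self_of_nhds, sub_self, smul_zero, add_zero, one_smul] at hl
  exact (sub_eq_zero.1 hl.symm)

theorem sec_sum_apply {ι : Type*} (s : Finset ι) (ξ : ι → Sec EM F V) (x : M) :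
    (∑ i ∈ s, ξ i) x = ∑ i ∈ s, ξ i x :=
  map_sum (⟨⟨fun ξ : Sec EM F V => ξ x, rfl⟩, fun _ _ => rfl⟩ : Sec EM F V →+ V x) ξ s

/-- The bracket with a section, in a trivialization: its value differs from the derivative of the
local representative by a term of order zero. -/
theorem loc_bracket (hx : x ∈ frameDom EM F V x₀) (η ξ : Sec EM F V) :
    loc F x₀ x (L.bracket η ξ x) =
      along 𝓘(ℝ, EM) (L.rho η) (fun y => loc F x₀ y (ξ y)) x +
        loc F x₀ x (L.bracket η (cst EM F V x₀ (loc F x₀ x (ξ x))) x) := by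
  let b := Module.finBasis ℝ F
  have hs : ∀ i, ∀ y ∈ frameDom EM F V x₀, ContMDiffAt 𝓘(ℝ, EM) 𝓘(ℝ, ℝ) ∞
      (fun y => b.coord i (loc F x₀ y (ξ y))) y := fun i y hy =>
    (LinearMap.toContinuousLinearMap (b.coord i)).contMDiff.contMDiffAt.comp y
      (sec_smooth ξ (dom_of_frame hy))
  choose f hf using fun i => exists_smooth_ext (isOpen_interior (s := _)) hx (hs i)
  have hf' : ∀ᶠ y in 𝓝 x, ∀ i, f i y = b.coord i (loc F x₀ y (ξ y)) := eventually_all.2 hf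
  have hξ : ∀ᶠ y in 𝓝 x, ξ y = (∑ i, smulSec (f i) (cst EM F V x₀ (b i))) y := by
    filter_upwards [hf', eventually_frameDom hx] with y hy hy'
    refine loc_inj (dom_of_frame hy') ?_
    rw [sec_sum_apply]
    change _ = (locEquiv (dom_of_frame hy')) _
    rw [map_sum]
    have : ∀ i, locEquiv (dom_of_frame hy') (smulSec (f i) (cst EM F V x₀ (b i)) y) =
        b.coord i (loc F x₀ y (ξ y)) • b i := by
      intro i
      change loc F x₀ y (f i y • cst EM F V x₀ (b i) y) = _
      rw [loc_smul (dom_of_frame hy'), loc_cst hy', hy]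
    rw [Finset.sum_congr rfl fun i _ => this i]
    exact (b.sum_repr _).symm
  have hd : along 𝓘(ℝ, EM) (L.rho η) (fun y => loc F x₀ y (ξ y)) x =
      ∑ i, along 𝓘(ℝ, EM) (L.rho η) (f i) x • b i := by
    have h1 : (fun y => loc F x₀ y (ξ y)) =ᶠ[𝓝 x] fun y => ∑ i, f i y • b i := by
      filter_upwards [hf'] with y hy
      simp only [hy]
      exact (b.sum_repr _).symm
    rw [along, mvfderiv_congr h1, mvfderiv_finset_sum]
    · refine Finset.sum_congr rfl fun i _ => ?_
      exact mvfderiv_clm_comp ((ContinuousLinearMap.id ℝ ℝ).smulRight (b i))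
        ((f i).contMDiff.contMDiffAt.mdifferentiableAt (by simp)) _
    · intro i _
      exact mdiff_of_smooth (((f i).contMDiff x).smul contMDiffAt_const)
  have hv : cst EM F V x₀ (loc F x₀ x (ξ x)) = ∑ i, f i x • cst EM F V x₀ (b i) := by
    conv_lhs => rw [← b.sum_repr (loc F x₀ x (ξ x))]
    rw [map_sum]
    refine Finset.sum_congr rfl fun i _ => ?_
    rw [map_smul, hf'.self_of_nhds i]
    rfl
  rw [L.bracket_congr η hξ, hd, hv, map_sum, map_sum, sec_sum_apply, sec_sum_apply]
  change locEquiv (dom_of_frame hx) _ = _ + locEquiv (dom_of_frame hx) _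
  rw [map_sum, map_sum, ← Finset.sum_add_distrib]
  refine Finset.sum_congr rfl fun i _ => ?_
  rw [L.leibniz, map_add, map_smul, map_smul, add_comm]
  congr 1
  · congr 1
    exact loc_cst hx _
  · rw [map_smul]
    exact (map_smul (locEquiv (dom_of_frame hx)) _ _).symm

/-- The local formula for the bracket. -/
theorem loc_bracket' (hx : x ∈ frameDom EM F V x₀) (η ξ : Sec EM F V) :
    loc F x₀ x (L.bracket η ξ x) =
      along 𝓘(ℝ, EM) (L.rho η) (fun y => loc F x₀ y (ξ y)) x -
      along 𝓘(ℝ, EM) (L.rho ξ) (fun y => loc F x₀ y (η y)) x +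
        loc F x₀ x (L.bracket (cst EM F V x₀ (loc F x₀ x (η x)))
          (cst EM F V x₀ (loc F x₀ x (ξ x))) x) := by
  have hn : ∀ ξ η : Sec EM F V, loc F x₀ x (L.bracket ξ η x) = -loc F x₀ x (L.bracket η ξ x) := by
    intro ξ η
    rw [L.bracket_neg_swap ξ η, ← loc_neg (dom_of_frame hx)]
    rfl
  have hr : L.rho (cst EM F V x₀ (loc F x₀ x (ξ x))) x = L.rho ξ x := by
    simp [rho, cst_loc hx]
  rw [L.loc_bracket hx, hn η, L.loc_bracket hx, hn _ (cst EM F V x₀ (loc F x₀ x (ξ x)))]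
  simp only [along, hr]
  abel

/-- The anchor is a morphism of Lie algebras. This is not among the axioms of a Lie algebroid: it
follows from the Jacobi identity and the Leibniz rule. -/
theorem anchor_bracket (ξ η : Sec EM F V) (x : M) :
    L.anchor x (L.bracket ξ η x) = mlieBracket 𝓘(ℝ, EM) (L.rho ξ) (L.rho η) x := by
  -- In rank zero both sides vanish; otherwise the identity is read off the coefficient of a section
  -- `ζ` that does not vanish at `x`.
  rcases subsingleton_or_nontrivial F with hF | hF
  · have hV : ∀ y, ∀ u : V y, u = 0 := fun y u => loc_inj
      (mem_dom (EM := EM) (F := F) (V := V) y)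
      (Subsingleton.elim _ _)
    have hr : ∀ ξ, L.rho ξ = 0 := fun ξ => by ext y; simp [rho, hV y (ξ y)]
    rw [hr, hr, mlieBracket_zero_left, hV x (L.bracket ξ η x), map_zero]
    rfl
  obtain ⟨v, hv⟩ := exists_ne (0 : F)
  let ζ := cst EM F V x v
  have hζ : ζ x ≠ 0 := by
    intro h
    have := loc_cst (mem_frameDom (EM := EM) (V := V) x) v
    rw [show cst EM F V x v x = 0 from h, loc_zero (mem_dom (EM := EM) x)] at this
    exact hv this.symm
  -- The Jacobi identity for `ξ`, `η`, `f ζ`, expanded by the Leibniz rule.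
  have key : ∀ f : C^∞⟮𝓘(ℝ, EM), M; ℝ⟯, mvfderiv 𝓘(ℝ, EM) f x (L.anchor x (L.bracket ξ η x)) =
      mvfderiv 𝓘(ℝ, EM) f x (mlieBracket 𝓘(ℝ, EM) (L.rho ξ) (L.rho η) x) := by
    intro f
    refine Eq.trans ?_ (along_bracket_real (f.contMDiff x) (L.rho_smooth ξ x)
      (L.rho_smooth η x)).symm
    let D : Sec EM F V → C^∞⟮𝓘(ℝ, EM), M; ℝ⟯ := fun ξ => ⟨along 𝓘(ℝ, EM) (L.rho ξ) f,
      fun y => contMDiffAt_along (f.contMDiff y) (L.rho_smooth ξ y)⟩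
    have h1 : ∀ ξ ζ, L.bracket ξ (smulSec f ζ) = smulSec f (L.bracket ξ ζ) + smulSec (D ξ) ζ := by
      intro ξ ζ; ext y; exact L.leibniz ξ ζ f y
    have hJ := DFunLike.congr_fun (L.jacobi ξ η (smulSec f ζ)) x
    have hJ' := DFunLike.congr_fun (L.jacobi ξ η ζ) x
    simp only [h1, map_add] at hJ
    have hadd : ∀ ξ η : Sec EM F V, (ξ + η) x = ξ x + η x := fun _ _ => rfl
    have hsm : ∀ (f : C^∞⟮𝓘(ℝ, EM), M; ℝ⟯) (ξ : Sec EM F V), smulSec f ξ x = f x • ξ x :=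
      fun _ _ => rfl
    simp only [hadd, hsm, L.leibniz] at hJ
    rw [hJ'] at hJ
    change _ = L.bracket (L.bracket ξ η) ζ x + L.bracket η (L.bracket ξ ζ) x at hJ'
    rw [← sub_eq_zero] at hJ ⊢
    refine (smul_eq_zero.1 (?_ : _ • ζ x = 0)).resolve_right hζ
    rw [← neg_eq_zero, ← hJ]
    change -((mvfderiv 𝓘(ℝ, EM) f x (L.anchor x (L.bracket ξ η x)) -
      (mvfderiv 𝓘(ℝ, EM) (D η) x (L.rho ξ x) - mvfderiv 𝓘(ℝ, EM) (D ξ) x (L.rho η x))) • ζ x) =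
      (f x • (L.bracket (L.bracket ξ η) ζ x + L.bracket η (L.bracket ξ ζ) x) +
        mvfderiv 𝓘(ℝ, EM) f x (L.rho ξ x) • L.bracket η ζ x +
        (mvfderiv 𝓘(ℝ, EM) f x (L.rho η x) • L.bracket ξ ζ x +
          mvfderiv 𝓘(ℝ, EM) (D η) x (L.rho ξ x) • ζ x)) -
      (f x • L.bracket (L.bracket ξ η) ζ x +
        mvfderiv 𝓘(ℝ, EM) f x (L.anchor x (L.bracket ξ η x)) • ζ x +
        (f x • L.bracket η (L.bracket ξ ζ) x +
        mvfderiv 𝓘(ℝ, EM) f x (L.rho η x) • L.bracket ξ ζ x +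
        (mvfderiv 𝓘(ℝ, EM) f x (L.rho ξ x) • L.bracket η ζ x +
          mvfderiv 𝓘(ℝ, EM) (D ξ) x (L.rho η x) • ζ x)))
    module
  have hx := mem_dom (EM := EM) (F := F) (V := V) x
  refine tangent_ext_base hx ?_
  let b := Module.finBasis ℝ EM
  refine b.ext_elem fun i => ?_
  let ℓ : EM →L[ℝ] ℝ := LinearMap.toContinuousLinearMap (b.coord i)
  change ℓ _ = ℓ _
  obtain ⟨f, hf⟩ := exists_smooth_ext (isOpen_dom (EM := EM) (F := F) (V := V) x) hx
    (f := fun y => ℓ (extChartAt 𝓘(ℝ, EM) x y))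
    fun y hy => ℓ.contMDiff.contMDiffAt.comp y (chart_smooth hy)
  have hc := mdiff_of_smooth (chart_smooth hx)
  rw [← mvfderiv_clm_comp ℓ hc, ← mvfderiv_clm_comp ℓ hc,
    ← mvfderiv_congr (f := f) (EventuallyEq.of_eq rfl |>.trans hf)]
  exact key f

/-! ### Local matrices of the Lie derivative and of the anchor -/

/-- The matrix `B`, in a trivialization, for which the Lie derivative along `η` of a section with
local representative `ξ` has the local representative `ρ(η) ξ - B ξ`. -/
def lieMat (x₀ : M) (η : Sec EM F V) : M → F →L[ℝ] F :=
  matL fun v x => -loc F x₀ x (L.bracket η (cst EM F V x₀ v) x)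

/-- The matrix of the anchor in a trivialization and a chart. -/
def anchorMat (x₀ : M) : M → F →L[ℝ] EM :=
  matL fun v x => mvfderiv 𝓘(ℝ, EM) (extChartAt 𝓘(ℝ, EM) x₀) x (L.rho (cst EM F V x₀ v) x)

theorem lieMat_apply (hx : x ∈ dom EM F V x₀) (η : Sec EM F V) (v : F) :
    L.lieMat x₀ η x v = -loc F x₀ x (L.bracket η (cst EM F V x₀ v) x) := by
  refine matL_apply (g := fun v x => -loc F x₀ x (L.bracket η (cst EM F V x₀ v) x))
    ⟨fun v w => ?_, fun a v => ?_⟩ v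
  · rw [map_add, map_add, ← neg_add, ← loc_add hx]; rfl
  · rw [map_smul, map_smul, smul_neg, ← loc_smul hx]; rfl

theorem lieMat_smooth (hx : x ∈ dom EM F V x₀) (η : Sec EM F V) :
    ContMDiffAt 𝓘(ℝ, EM) 𝓘(ℝ, F →L[ℝ] F) ∞ (L.lieMat x₀ η) x :=
  matL_smooth fun _ => (sec_smooth _ hx).neg

theorem anchorMat_apply (v : F) : L.anchorMat x₀ x v =
    mvfderiv 𝓘(ℝ, EM) (extChartAt 𝓘(ℝ, EM) x₀) x (L.rho (cst EM F V x₀ v) x) := by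
  refine matL_apply (g := fun v x => mvfderiv 𝓘(ℝ, EM) (extChartAt 𝓘(ℝ, EM) x₀) x
    (L.rho (cst EM F V x₀ v) x)) ⟨fun v w => ?_, fun a v => ?_⟩ v
  · rw [← map_add, map_add]; congr 1; exact map_add _ _ _
  · rw [← map_smul, map_smul]; congr 1; exact map_smul _ _ _

theorem anchorMat_smooth (hx : x ∈ dom EM F V x₀) :
    ContMDiffAt 𝓘(ℝ, EM) 𝓘(ℝ, F →L[ℝ] EM) ∞ (L.anchorMat x₀) x :=
  matL_smooth fun _ => contMDiffAt_along (chart_smooth hx) (L.rho_smooth _ x)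

theorem anchorMat_loc (hx : x ∈ frameDom EM F V x₀) (u : V x) : L.anchorMat x₀ x (loc F x₀ x u) =
    mvfderiv 𝓘(ℝ, EM) (extChartAt 𝓘(ℝ, EM) x₀) x (L.anchor x u) := by
  rw [anchorMat_apply, rho, cst_loc hx]

theorem loc_bracket_lieMat (hx : x ∈ frameDom EM F V x₀) (η ξ : Sec EM F V) :
    loc F x₀ x (L.bracket η ξ x) =
      along 𝓘(ℝ, EM) (L.rho η) (fun y => loc F x₀ y (ξ y)) x -
        L.lieMat x₀ η x (loc F x₀ x (ξ x)) := by
  rw [L.loc_bracket hx, lieMat_apply L (dom_of_frame hx), sub_neg_eq_add]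

/-- The integrability condition on the anchor, in coordinates. -/
theorem anchorMat_bracket (x : M) (v w : F) :
    L.anchorMat x x (loc F x x (L.bracket (cst EM F V x v) (cst EM F V x w) x)) =
      mvfderiv 𝓘(ℝ, EM) (L.anchorMat x) x (L.rho (cst EM F V x v) x) w -
      mvfderiv 𝓘(ℝ, EM) (L.anchorMat x) x (L.rho (cst EM F V x w) x) v := by
  have hx := mem_dom (EM := EM) (F := F) (V := V) x
  have key : ∀ v w, along 𝓘(ℝ, EM) (L.rho (cst EM F V x v))
      (along 𝓘(ℝ, EM) (L.rho (cst EM F V x w)) (extChartAt 𝓘(ℝ, EM) x)) x =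
      mvfderiv 𝓘(ℝ, EM) (L.anchorMat x) x (L.rho (cst EM F V x v) x) w := by
    intro v w
    have h : along 𝓘(ℝ, EM) (L.rho (cst EM F V x w)) (extChartAt 𝓘(ℝ, EM) x) =
        fun y => L.anchorMat x y w := by
      funext y; exact (L.anchorMat_apply w).symm
    rw [h, along, mvfderiv_clm_apply (mdiff_of_smooth (L.anchorMat_smooth hx))
      (g := fun _ => w) (mdiff_of_smooth contMDiffAt_const), mvfderiv_const]
    simp
  rw [L.anchorMat_loc (mem_frameDom x), L.anchor_bracket, ← key, ← key]
  exact along_bracket (chart_smooth hx) (L.rho_smooth _ x) (L.rho_smooth _ x)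

/-- For an element `(u, z)` of the prolongation, the base coordinates of `z` are the image of `u`
under the anchor. -/
theorem mvfderiv_bc_of_mem {e : TotalSpace F V} (hx : e.proj ∈ frameDom EM F V x₀)
    {p : V e.proj × TangentSpace IE e} (hp : p ∈ L.prolongation e) :
    mvfderiv IE (bc EM x₀ : TotalSpace F V → EM) e p.2 =
      L.anchorMat x₀ e.proj (loc F x₀ e.proj p.1) := by
  rw [L.anchorMat_loc hx, mvfderiv_bc (dom_of_frame hx)]
  exact congrArg _ (Eq.symm hp)

/-! ### The bracket of the prolongation -/

theorem pbracket_swap (s₁ s₂ : PairSec EM F V) : L.pbracket s₁ s₂ = -L.pbracket s₂ s₁ := by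
  funext e
  refine Prod.ext ?_ (mlieBracket_swap_apply ..)
  change L.bracket _ _ e.proj + _ - _ = -(L.bracket _ _ e.proj + _ - _)
  rw [L.bracket_neg_swap]
  change -L.bracket _ _ e.proj + _ - _ = _
  abel

/-- The coordinate formula for the first component of the bracket. -/
theorem loc_pbracket {s₁ s₂ : PairSec EM F V} (h₁ : L.IsProlSection s₁)
    (h₂ : L.IsProlSection s₂) (e : TotalSpace F V) :
    loc F e.proj e.proj (L.pbracket s₁ s₂ e).1 =
      mvfderiv IE (coord e.proj (jSec s₂)) e (s₁ e).2 -
      mvfderiv IE (coord e.proj (jSec s₁)) e (s₂ e).2 +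
      loc F e.proj e.proj (L.bracket (cst EM F V e.proj (loc F e.proj e.proj (s₁ e).1))
        (cst EM F V e.proj (loc F e.proj e.proj (s₂ e).1)) e.proj) := by
  have hx := mem_dom (EM := EM) (F := F) (V := V) e.proj
  have key : ∀ (s : PairSec EM F V) (hs : L.IsProlSection s) (ξ ζ : Sec EM F V)
      (z : TangentSpace IE e) (hz : L.rho ζ e.proj = dπ e z),
      loc F e.proj e.proj (fibreDeriv (jSec s - hat ξ) e z) =
        mvfderiv IE (coord e.proj (jSec s)) e z -
        along 𝓘(ℝ, EM) (L.rho ζ) (fun y => loc F e.proj y (ξ y)) e.proj := by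
    intro s hs ξ ζ z hz
    have h : coord e.proj (jSec s - hat ξ) =ᶠ[𝓝 e]
        coord e.proj (jSec s) - coord e.proj (hat ξ) :=
      (eventually_proj_dom hx).mono fun e' he' => loc_sub he' _ _
    rw [loc_fibreDeriv, mvfderiv_congr h]
    have h1 := mdiff_of_smooth (hs.smooth_fst.coord hx)
    have h2 := mdiff_of_smooth ((hat_smooth ξ).coord hx)
    have h3 := mvfderiv_fun_sub h1 h2
    refine (DFunLike.congr_fun h3 z).trans ?_
    change (_ : F) - (_ : F) = _ - _
    congr 1
    rw [along, hz]
    exact mvfderiv_comp_proj (mdiff_of_smooth (sec_smooth ξ hx)) z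
  have hρ : ∀ s : PairSec EM F V, L.IsProlSection s →
      L.rho (ext EM F (s e).1) e.proj = dπ e (s e).2 := by
    intro s hs
    rw [rho, ext_apply]
    exact hs.mem e
  change loc F e.proj e.proj (L.bracket _ _ e.proj + _ - _) = _
  rw [loc_sub hx, loc_add hx, key s₂ h₂ _ _ _ (hρ s₁ h₁), key s₁ h₁ _ _ _ (hρ s₂ h₂),
    L.loc_bracket' (mem_frameDom e.proj), ext_apply, ext_apply]
  abel

/-- The prolongation is closed under its bracket. -/
theorem pbracket_mem {s₁ s₂ : PairSec EM F V} (h₁ : L.IsProlSection s₁)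
    (h₂ : L.IsProlSection s₂) (e : TotalSpace F V) :
    L.pbracket s₁ s₂ e ∈ L.prolongation e := by
  have hx := mem_dom (EM := EM) (F := F) (V := V) e.proj
  have hg := mem_frameDom (EM := EM) (F := F) (V := V) e.proj
  have key : ∀ s s' : PairSec EM F V, L.IsProlSection s → L.IsProlSection s' →
      along IE (fun e => (s e).2) (along IE (fun e => (s' e).2) (bc EM e.proj)) e =
        mvfderiv 𝓘(ℝ, EM) (L.anchorMat e.proj) e.proj (L.anchor e.proj (s e).1)
          (loc F e.proj e.proj (s' e).1) +
        L.anchorMat e.proj e.proj (mvfderiv IE (coord e.proj (jSec s')) e (s e).2) := by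
    intro s s' hs hs'
    have h : along IE (fun e => (s' e).2) (bc EM e.proj) =ᶠ[𝓝 e]
        fun e' => L.anchorMat e.proj e'.proj (coord e.proj (jSec s') e') :=
      (eventually_proj_frameDom hg).mono fun e' he' => L.mvfderiv_bc_of_mem he' (hs'.mem e')
    rw [along, mvfderiv_congr h, mvfderiv_clm_apply
      (mdiff_of_smooth (smooth_comp_proj (L.anchorMat_smooth hx)))
      (mdiff_of_smooth (hs'.smooth_fst.coord hx)),
      mvfderiv_comp_proj (mdiff_of_smooth (L.anchorMat_smooth hx)), ← hs.mem e]
    rfl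
  have hr : ∀ u : V e.proj,
      L.rho (cst EM F V e.proj (loc F e.proj e.proj u)) e.proj = L.anchor e.proj u := by
    intro u
    rw [rho, cst_loc hg]
  refine tangent_ext_base hx ?_
  rw [← mvfderiv_bc hx, ← L.anchorMat_loc hg, L.loc_pbracket h₁ h₂, map_add, map_sub,
    L.anchorMat_bracket, hr, hr]
  refine Eq.trans ?_ (along_bracket (bc_smooth hx) (h₁.smooth_snd e) (h₂.smooth_snd e)).symm
  rw [key s₁ s₂ h₁ h₂, key s₂ s₁ h₂ h₁]
  abel

/-- The image of a section of `π^*E` under `i` is a section of the prolongation. -/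
theorem iSec_isProl {σ : PullSec F V} (hσ : IsSmoothPullSec EM σ) :
    L.IsProlSection (iSec EM σ) where
  mem e := by
    change L.anchor e.proj 0 = dπ e (vert EM e (σ e))
    rw [mfderiv_proj_vert, map_zero]
  smooth_fst := zero_smooth
  smooth_snd := hσ.vf

/-- The first component of the bracket with a vertical section is the vertical derivative of the
first component. -/
theorem jSec_pbracket_iSec {σ : PullSec F V} (hσ : IsSmoothPullSec EM σ) {s : PairSec EM F V}
    (hs : L.IsProlSection s) :
    jSec (L.pbracket (iSec EM σ) s) = vderiv EM σ (jSec s) := by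
  funext e
  have hx := mem_dom (EM := EM) (F := F) (V := V) e.proj
  refine loc_inj hx ?_
  refine (L.loc_pbracket (L.iSec_isProl hσ) hs e).trans ?_
  have h0 : coord e.proj (jSec (iSec EM σ)) =ᶠ[𝓝 e] fun _ => (0 : F) :=
    (eventually_proj_dom hx).mono fun e' he' => loc_zero he'
  have h1 : loc F e.proj e.proj (iSec EM σ e).1 = 0 := loc_zero hx
  rw [mvfderiv_congr h0, h1, map_zero, map_zero, mvfderiv_const]
  simp only [LinearMap.zero_apply]
  change _ - (0 : F) + loc F e.proj e.proj (0 : V e.proj) = _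
  rw [loc_zero hx, vderiv, loc_fibreDeriv, sub_zero, add_zero]
  rfl

theorem vderiv_hat (σ : PullSec F V) (ξ : Sec EM F V) : vderiv EM σ (hat ξ) = 0 := by
  funext e
  have hx := mem_dom (EM := EM) (F := F) (V := V) e.proj
  refine loc_inj hx ?_
  rw [vderiv, loc_fibreDeriv]
  refine (along_vf_comp_proj (σ := σ) (mdiff_of_smooth (sec_smooth ξ hx))).trans (loc_zero hx).symm

theorem vderiv_delta (σ : PullSec F V) : vderiv EM σ delta = σ := by
  funext e
  have hx := mem_dom (EM := EM) (F := F) (V := V) e.proj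
  refine loc_inj hx ?_
  rw [vderiv, loc_fibreDeriv, coord_delta, mvfderiv_fc_vert hx]

/-! ### The complete lift -/

/-- The complete lift at `e` is the image of `ρ(η)` under the differential of a section `ξ` through
`e`, corrected by the vertical vector `[η, ξ]^∨`. -/
theorem exists_cl_eq (η : Sec EM F V) (e : TotalSpace F V) :
    ∃ z : TangentSpace IE e,
      L.completeLiftField η e = z - vert EM e (L.bracket η (ext EM F e.2) e.proj) ∧
      dπ e z = L.anchor e.proj (η e.proj) ∧
      ∀ x₀, e.proj ∈ dom EM F V x₀ → mvfderiv IE (fc x₀ : TotalSpace F V → F) e z =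
        along 𝓘(ℝ, EM) (L.rho η) (fun y => loc F x₀ y (ext EM F e.2 y)) e.proj := by
  let ξ := ext EM F e.2
  have h0 : (⟨e.proj, ξ e.proj⟩ : TotalSpace F V) = e := by rw [ext_apply]
  have hs : MDifferentiableAt 𝓘(ℝ, EM) IE (fun x => (⟨x, ξ x⟩ : TotalSpace F V)) e.proj :=
    (ξ.contMDiff e.proj).mdifferentiableAt (by simp)
  refine ⟨_, rfl, ?_, fun x₀ hx => ?_⟩
  · have h := mfderiv_comp_apply_of_eq e.proj (mdiff_proj e) hs h0 (L.anchor e.proj (η e.proj))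
    rw [show (TotalSpace.proj : TotalSpace F V → M) ∘ (fun x => (⟨x, ξ x⟩ : TotalSpace F V)) = id
      from rfl, mfderiv_id, h0] at h
    exact h.symm
  · have h := mfderiv_comp_apply_of_eq e.proj (mdiff_of_smooth (fc_smooth hx)) hs h0
      (L.anchor e.proj (η e.proj))
    rw [h0] at h
    exact h.symm

theorem mfderiv_proj_cl (η : Sec EM F V) (e : TotalSpace F V) :
    dπ e (L.completeLiftField η e) = L.anchor e.proj (η e.proj) := by
  obtain ⟨z, h1, h2, -⟩ := L.exists_cl_eq η e
  rw [h1, map_sub, mfderiv_proj_vert, sub_zero, h2]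

/-- The complete lift is linear along the fibres, with matrix `lieMat`. -/
theorem mvfderiv_fc_cl {e : TotalSpace F V} (hx : e.proj ∈ frameDom EM F V x₀) (η : Sec EM F V) :
    mvfderiv IE (fc x₀ : TotalSpace F V → F) e (L.completeLiftField η e) =
      L.lieMat x₀ η e.proj (fc x₀ e) := by
  obtain ⟨z, h1, -, h2⟩ := L.exists_cl_eq η e
  rw [h1, map_sub, mvfderiv_fc_vert (dom_of_frame hx), L.loc_bracket_lieMat hx, ext_apply,
    h2 _ (dom_of_frame hx)]
  exact sub_sub_cancel _ _

theorem along_cl_bc {e : TotalSpace F V} (hx : e.proj ∈ dom EM F V x₀) (η : Sec EM F V) :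
    along IE (L.completeLiftField η) (bc EM x₀) e =
      along 𝓘(ℝ, EM) (L.rho η) (extChartAt 𝓘(ℝ, EM) x₀) e.proj := by
  rw [along, mvfderiv_bc hx, mfderiv_proj_cl]
  rfl

theorem cl_smooth (η : Sec EM F V) (e : TotalSpace F V) :
    SmoothFieldAt IE (L.completeLiftField η) e := by
  have hx := mem_dom (EM := EM) (F := F) (V := V) e.proj
  refine smoothField_iff.2 ⟨?_, ?_⟩
  · refine (smooth_comp_proj (contMDiffAt_along (chart_smooth hx)
      (L.rho_smooth η e.proj))).congr_of_eventuallyEq ?_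
    exact (eventually_proj_dom hx).mono fun e' he' => L.along_cl_bc he' η
  · refine ((smooth_comp_proj (L.lieMat_smooth hx η)).clm_apply
      (fc_smooth hx)).congr_of_eventuallyEq ?_
    exact (eventually_proj_frameDom (mem_frameDom e.proj)).mono fun e' he' => L.mvfderiv_fc_cl he' η

theorem cLift_isProl (η : Sec EM F V) : L.IsProlSection (L.cLift η) where
  mem e := (L.mfderiv_proj_cl η e).symm
  smooth_fst := hat_smooth η
  smooth_snd := L.cl_smooth η

theorem cLift_isProjectable (η : Sec EM F V) : L.IsProjectable (L.cLift η) :=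
  ⟨L.cLift_isProl η, η, rfl⟩

/-! ### The Lie derivative along a complete lift -/

/-- The Lie derivative of `σ` along `η^C` is the section whose vertical lift is `[η^c, σ^∨]`. -/
theorem vf_lieDer (η : Sec EM F V) {σ : PullSec F V} (hσ : IsSmoothPullSec EM σ) :
    vf EM (L.lieDer (L.cLift η) σ) = mlieBracket IE (L.completeLiftField η) (vf EM σ) := by
  have h1 : jSec (L.pbracket (L.cLift η) (iSec EM σ)) = 0 := by
    rw [pbracket_swap]
    change -jSec (L.pbracket (iSec EM σ) (L.cLift η)) = 0
    rw [L.jSec_pbracket_iSec hσ (L.cLift_isProl η)]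
    exact neg_eq_zero.2 (vderiv_hat σ η)
  funext e
  have h1' : (L.pbracket (L.cLift η) (iSec EM σ) e).1 = 0 := congrFun h1 e
  refine vert_iInv h1' ?_
  have h := L.pbracket_mem (L.cLift_isProl η) (L.iSec_isProl hσ) e
  refine Eq.trans (Eq.symm h) ?_
  rw [h1', map_zero]

theorem lieDer_smooth (η : Sec EM F V) {σ : PullSec F V} (hσ : IsSmoothPullSec EM σ) :
    IsSmoothPullSec EM (L.lieDer (L.cLift η) σ) := by
  rw [← vf_smooth_iff, L.vf_lieDer η hσ]
  exact fun e => (L.cl_smooth η e).bracket (hσ.vf e)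

/-- The coordinate expression of the Lie derivative along `η^C`. -/
theorem coord_lieDer (η : Sec EM F V) {σ : PullSec F V} (hσ : IsSmoothPullSec EM σ)
    {e : TotalSpace F V} (hx : e.proj ∈ frameDom EM F V x₀) :
    coord x₀ (L.lieDer (L.cLift η) σ) e =
      along IE (L.completeLiftField η) (coord x₀ σ) e -
        L.lieMat x₀ η e.proj (coord x₀ σ e) := by
  have hd := dom_of_frame hx
  rw [← along_vf_fc hd, L.vf_lieDer η hσ, along_bracket (fc_smooth hd) (L.cl_smooth η e) (hσ.vf e)]
  have h1 : along IE (vf EM σ) (fc x₀) =ᶠ[𝓝 e] coord x₀ σ :=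
    (eventually_proj_dom hd).mono fun e' he' => along_vf_fc he'
  have h2 : along IE (L.completeLiftField η) (fc x₀) =ᶠ[𝓝 e]
      fun e' => L.lieMat x₀ η e'.proj (fc x₀ e') :=
    (eventually_proj_frameDom hx).mono fun e' he' => L.mvfderiv_fc_cl he' η
  have h3 : along IE (vf EM σ) (along IE (L.completeLiftField η) (fc x₀)) e =
      L.lieMat x₀ η e.proj (coord x₀ σ e) := by
    rw [along, mvfderiv_congr h2, mvfderiv_clm_apply
      (mdiff_of_smooth (smooth_comp_proj (L.lieMat_smooth hd η))) (mdiff_of_smooth (fc_smooth hd))]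
    have h4 := along_vf_comp_proj (σ := σ) (mdiff_of_smooth (L.lieMat_smooth hd η))
    rw [along] at h4
    rw [h4]
    simp only [zero_apply, zero_add]
    congr 1
    exact along_vf_fc hd
  rw [h3, along, mvfderiv_congr h1]
  rfl

theorem lieDer_hat (η ξ : Sec EM F V) :
    L.lieDer (L.cLift η) (hat ξ) = hat (L.bracket η ξ) := by
  funext e
  have hx := mem_frameDom (EM := EM) (F := F) (V := V) e.proj
  refine loc_inj (dom_of_frame hx) ?_
  refine (L.coord_lieDer η (hat_smooth ξ) hx).trans ?_
  refine Eq.trans ?_ (L.loc_bracket_lieMat hx η ξ).symm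
  congr 1
  refine (mvfderiv_comp_proj (mdiff_of_smooth (sec_smooth ξ (dom_of_frame hx))) _).trans ?_
  rw [mfderiv_proj_cl]
  rfl

/-- The canonical section is invariant, as the complete lift is linear along the fibres. -/
theorem lieDer_delta (η : Sec EM F V) : L.lieDer (L.cLift η) delta = 0 := by
  funext e
  have hx := mem_frameDom (EM := EM) (F := F) (V := V) e.proj
  refine loc_inj (dom_of_frame hx) ?_
  refine (L.coord_lieDer η delta_smooth hx).trans ?_
  rw [coord_delta, along, L.mvfderiv_fc_cl hx, sub_self]
  exact (loc_zero (dom_of_frame hx)).symm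

theorem lieDer_add (η : Sec EM F V) {σ τ : PullSec F V} (hσ : IsSmoothPullSec EM σ)
    (hτ : IsSmoothPullSec EM τ) :
    L.lieDer (L.cLift η) (σ + τ) = L.lieDer (L.cLift η) σ + L.lieDer (L.cLift η) τ := by
  funext e
  have hx := mem_frameDom (EM := EM) (F := F) (V := V) e.proj
  refine loc_inj (dom_of_frame hx) ?_
  have h : coord e.proj (σ + τ) =ᶠ[𝓝 e] fun e' => coord e.proj σ e' + coord e.proj τ e' :=
    (eventually_proj_dom (dom_of_frame hx)).mono fun e' he' => loc_add he' _ _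
  refine (L.coord_lieDer η (hσ.add hτ) hx).trans ?_
  refine Eq.trans ?_ (loc_add (dom_of_frame hx) _ _).symm
  refine Eq.trans ?_ (congrArg₂ _ (L.coord_lieDer η hσ hx) (L.coord_lieDer η hτ hx)).symm
  rw [along, mvfderiv_congr h, h.self_of_nhds, map_add]
  have h2 := DFunLike.congr_fun (mvfderiv_fun_add (mdiff_of_smooth (hσ.coord (dom_of_frame hx)))
    (mdiff_of_smooth (hτ.coord (dom_of_frame hx)))) (L.completeLiftField η e)
  refine (congrArg (fun w : F => w - _) h2).trans ?_
  exact add_sub_add_comm ..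

theorem lieDer_fmul (η : Sec EM F V) {f : TotalSpace F V → ℝ} (hf : ContMDiff IE 𝓘(ℝ, ℝ) ∞ f)
    {σ : PullSec F V} (hσ : IsSmoothPullSec EM σ) :
    L.lieDer (L.cLift η) (fmul f σ) =
      fmul (along IE (L.completeLiftField η) f) σ + fmul f (L.lieDer (L.cLift η) σ) := by
  have h := L.vf_lieDer η (IsSmoothPullSec.fmul hf hσ)
  have h' := L.vf_lieDer η hσ
  funext e
  refine vert_injective (EM := EM) e ?_
  refine (congrFun h e).trans ?_
  have h1 : vf EM (fmul f σ) = f • vf EM σ := by funext e'; exact vert_smul e' _ _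
  rw [h1, bracket_smul_right (mdiff_of_smooth (hf e)) (hσ.vf e).mdiff, ← h']
  refine Eq.trans ?_ (vert_add e _ _).symm
  exact congrArg₂ _ (vert_smul e _ _).symm (vert_smul e _ _).symm

theorem lieDer_const_smul (η : Sec EM F V) (c : ℝ) {σ : PullSec F V} (hσ : IsSmoothPullSec EM σ) :
    L.lieDer (L.cLift η) (c • σ) = c • L.lieDer (L.cLift η) σ := by
  rw [smul_eq_fmul, L.lieDer_fmul η contMDiff_const hσ]
  have : along IE (L.completeLiftField η) (fun _ => c) = fun _ => 0 := by
    funext e; rw [along, mvfderiv_const]; rfl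
  rw [this]
  funext e
  change (0 : ℝ) • σ e + c • L.lieDer (L.cLift η) σ e = c • L.lieDer (L.cLift η) σ e
  rw [zero_smul, zero_add]

theorem lieDer_sub (η : Sec EM F V) {σ τ : PullSec F V} (hσ : IsSmoothPullSec EM σ)
    (hτ : IsSmoothPullSec EM τ) :
    L.lieDer (L.cLift η) (σ - τ) = L.lieDer (L.cLift η) σ - L.lieDer (L.cLift η) τ := by
  have := L.lieDer_add η hσ (hτ.const_smul (-1))
  rw [L.lieDer_const_smul η _ hτ] at this
  simpa only [neg_smul, one_smul, ← sub_eq_add_neg] using this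

/-- The Lie derivative along `η^C` is a derivation of the vertical derivative. -/
theorem lieDer_vderiv (η : Sec EM F V) {σ τ : PullSec F V} (hσ : IsSmoothPullSec EM σ)
    (hτ : IsSmoothPullSec EM τ) :
    L.lieDer (L.cLift η) (vderiv EM σ τ) = vderiv EM (L.lieDer (L.cLift η) σ) τ +
      vderiv EM σ (L.lieDer (L.cLift η) τ) := by
  funext e
  have hx := mem_frameDom (EM := EM) (F := F) (V := V) e.proj
  have hd := dom_of_frame hx
  refine loc_inj hd ?_
  refine (L.coord_lieDer η (vderiv_smooth hσ hτ) hx).trans ?_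
  refine Eq.trans ?_ (loc_add hd _ _).symm
  refine Eq.trans ?_ (congrArg₂ _ (coord_vderiv hd (σ := L.lieDer (L.cLift η) σ) hτ)
    (coord_vderiv hd (σ := σ) (L.lieDer_smooth η hτ))).symm
  have h1 : coord e.proj (vderiv EM σ τ) =ᶠ[𝓝 e] along IE (vf EM σ) (coord e.proj τ) :=
    (eventually_proj_dom hd).mono fun e' he' => coord_vderiv he' hτ
  have h2 : coord e.proj (L.lieDer (L.cLift η) τ) =ᶠ[𝓝 e] fun e' =>
      along IE (L.completeLiftField η) (coord e.proj τ) e' -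
        L.lieMat e.proj η e'.proj (coord e.proj τ e') :=
    (eventually_proj_frameDom hx).mono fun e' he' => L.coord_lieDer η hτ he'
  have hs1 := hτ.coord hd
  have hs2 := contMDiffAt_along hs1 (L.cl_smooth η e)
  have hB := L.lieMat_smooth hd η
  have h3 : along IE (vf EM σ) (coord e.proj (L.lieDer (L.cLift η) τ)) e =
      along IE (vf EM σ) (along IE (L.completeLiftField η) (coord e.proj τ)) e -
        L.lieMat e.proj η e.proj (along IE (vf EM σ) (coord e.proj τ) e) := by
    rw [along, mvfderiv_congr h2]
    refine (DFunLike.congr_fun (mvfderiv_fun_sub (mdiff_of_smooth hs2)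
      (mdiff_of_smooth ((smooth_comp_proj hB).clm_apply hs1))) _).trans ?_
    refine congrArg (fun w : F => _ - w) ?_
    refine (mvfderiv_clm_apply (mdiff_of_smooth (smooth_comp_proj hB))
      (mdiff_of_smooth hs1) _).trans ?_
    have h4 := along_vf_comp_proj (σ := σ) (mdiff_of_smooth hB)
    rw [along] at h4
    rw [h4]
    simp only [zero_apply, zero_add]
    rfl
  rw [h3, L.vf_lieDer η hσ, along_bracket hs1 (L.cl_smooth η e) (hσ.vf e), h1.self_of_nhds,
    along, mvfderiv_congr h1]
  change along IE (L.completeLiftField η) _ e - _ = _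
  abel

/-! ### Brackets of complete lifts -/

theorem cl_bracket_vert (η ξ : Sec EM F V) :
    mlieBracket IE (L.completeLiftField η) (vf EM (hat ξ)) = vf EM (hat (L.bracket η ξ)) := by
  rw [← L.vf_lieDer η (hat_smooth ξ), lieDer_hat]

/-- The matrix of the bracket of two sections; this is the Jacobi identity in a trivialization. -/
theorem lieMat_bracket (hx : x ∈ frameDom EM F V x₀) (η ξ : Sec EM F V) (v : F) :
    L.lieMat x₀ (L.bracket η ξ) x v =
      mvfderiv 𝓘(ℝ, EM) (L.lieMat x₀ ξ) x (L.rho η x) v +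
        L.lieMat x₀ ξ x (L.lieMat x₀ η x v) -
      (mvfderiv 𝓘(ℝ, EM) (L.lieMat x₀ η) x (L.rho ξ x) v +
        L.lieMat x₀ η x (L.lieMat x₀ ξ x v)) := by
  have hd := dom_of_frame hx
  have key : ∀ η ξ : Sec EM F V,
      loc F x₀ x (L.bracket η (L.bracket ξ (cst EM F V x₀ v)) x) =
      L.lieMat x₀ η x (L.lieMat x₀ ξ x v) -
        mvfderiv 𝓘(ℝ, EM) (L.lieMat x₀ ξ) x (L.rho η x) v := by
    intro η ξ
    have h : (fun y => loc F x₀ y (L.bracket ξ (cst EM F V x₀ v) y)) =ᶠ[𝓝 x]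
        fun y => (L.lieMat x₀ ξ y) (-v) := by
      filter_upwards [eventually_dom hd] with y hy
      rw [map_neg, L.lieMat_apply hy, neg_neg]
    have h' : loc F x₀ x (L.bracket ξ (cst EM F V x₀ v) x) = L.lieMat x₀ ξ x (-v) :=
      h.self_of_nhds
    rw [L.loc_bracket_lieMat hx, along, mvfderiv_congr h,
      mvfderiv_clm_apply (mdiff_of_smooth (L.lieMat_smooth hd ξ)) (g := fun _ => -v)
      (mdiff_of_smooth contMDiffAt_const), mvfderiv_const, h']
    simp only [map_neg, zero_apply, map_zero, add_zero]
    abel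
  have hJ := congrArg (loc F x₀ x) (DFunLike.congr_fun (L.jacobi η ξ (cst EM F V x₀ v)) x)
  replace hJ := hJ.trans (loc_add hd _ _)
  rw [key η ξ, key ξ η] at hJ
  rw [L.lieMat_apply hd]
  rw [← sub_eq_iff_eq_add] at hJ
  rw [← hJ]
  abel

theorem cl_bracket_cl (η ξ : Sec EM F V) :
    mlieBracket IE (L.completeLiftField η) (L.completeLiftField ξ) =
      L.completeLiftField (L.bracket η ξ) := by
  funext e
  have hx := mem_frameDom (EM := EM) (F := F) (V := V) e.proj
  have hd := dom_of_frame hx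
  refine tangent_ext hd ?_ ?_
  · refine (along_bracket (bc_smooth hd) (L.cl_smooth η e) (L.cl_smooth ξ e)).trans ?_
    have key : ∀ η ξ, along IE (L.completeLiftField η)
        (along IE (L.completeLiftField ξ) (bc EM e.proj)) e =
        along 𝓘(ℝ, EM) (L.rho η) (along 𝓘(ℝ, EM) (L.rho ξ)
          (extChartAt 𝓘(ℝ, EM) e.proj)) e.proj := by
      intro η ξ
      have h : along IE (L.completeLiftField ξ) (bc EM e.proj) =ᶠ[𝓝 e]
          fun e' => along 𝓘(ℝ, EM) (L.rho ξ) (extChartAt 𝓘(ℝ, EM) e.proj) e'.proj :=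
        (eventually_proj_dom hd).mono fun e' he' => L.along_cl_bc he' ξ
      rw [along, mvfderiv_congr h, mvfderiv_comp_proj (mdiff_of_smooth
        (contMDiffAt_along (chart_smooth hd) (L.rho_smooth ξ e.proj))), mfderiv_proj_cl]
      rfl
    rw [key, key]
    refine Eq.trans ?_ (L.along_cl_bc hd (L.bracket η ξ)).symm
    refine (along_bracket (chart_smooth hd) (L.rho_smooth η e.proj)
      (L.rho_smooth ξ e.proj)).symm.trans ?_
    rw [along, along, ← L.anchor_bracket]
    rfl
  · refine (along_bracket (fc_smooth hd) (L.cl_smooth η e) (L.cl_smooth ξ e)).trans ?_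
    have key : ∀ η ξ, along IE (L.completeLiftField η)
        (along IE (L.completeLiftField ξ) (fc e.proj)) e =
        mvfderiv 𝓘(ℝ, EM) (L.lieMat e.proj ξ) e.proj (L.rho η e.proj) (fc e.proj e) +
          L.lieMat e.proj ξ e.proj (L.lieMat e.proj η e.proj (fc e.proj e)) := by
      intro η ξ
      have h : along IE (L.completeLiftField ξ) (fc e.proj) =ᶠ[𝓝 e]
          fun e' => L.lieMat e.proj ξ e'.proj (fc e.proj e') :=
        (eventually_proj_frameDom hx).mono fun e' he' => L.mvfderiv_fc_cl he' ξ
      have hB := L.lieMat_smooth hd ξ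
      rw [along, mvfderiv_congr h, mvfderiv_clm_apply (mdiff_of_smooth (smooth_comp_proj hB))
        (mdiff_of_smooth (fc_smooth hd)), mvfderiv_comp_proj (mdiff_of_smooth hB),
        mfderiv_proj_cl, L.mvfderiv_fc_cl hx]
      rfl
    rw [key, key, L.mvfderiv_fc_cl hx, L.lieMat_bracket hx]

/-! ### The horizontal lift -/

/-- The vector field on `E` underlying a section of the prolongation. -/
abbrev sf (S : PairSec EM F V) : ∀ e : TotalSpace F V, TangentSpace IE e := fun e => (S e).2

/-- The horizontal lift `½ (ξ^c + [ξ^∨, S])` at `e` of the vector `u = ξ(π(e))`. -/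
def horVec (S : PairSec EM F V) (e : TotalSpace F V) (u : V e.proj) : TangentSpace IE e :=
  (1 / 2 : ℝ) • (L.completeLiftField (ext EM F u) e +
    mlieBracket IE (vf EM (hat (ext EM F u))) (sf S) e)

/-- The horizontal lift of a section of `π^*E`, a vector field on `E`. -/
def hor (S : PairSec EM F V) (σ : PullSec F V) : ∀ e : TotalSpace F V, TangentSpace IE e :=
  fun e => L.horVec S e (σ e)

variable {L} {S : PairSec EM F V}

/-- The condition `J S = C` says that the first component of `S` is the canonical section. -/
theorem jSec_eq_delta (h : Jmap S = liouville EM F V) : jSec S = delta := by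
  funext e
  exact iMap_injective (EM := EM) e (congrFun h e)

theorem jSec_pbracket_vLift (hS : L.IsProlSection S) (hj : jSec S = delta) (ξ : Sec EM F V) :
    jSec (L.pbracket (vLift ξ) S) = hat ξ := by
  refine (L.jSec_pbracket_iSec (hat_smooth ξ) hS).trans ?_
  rw [hj, vderiv_delta]

/-- The vector field `½ (ξ^c + [ξ^∨, S])` projects to `ρ(ξ)`. -/
theorem mfderiv_proj_lift (hS : L.IsProlSection S) (hj : jSec S = delta) (ξ : Sec EM F V)
    (e : TotalSpace F V) :
    dπ e ((1 / 2 : ℝ) • (L.completeLiftField ξ e + mlieBracket IE (vf EM (hat ξ)) (sf S) e)) =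
      L.anchor e.proj (ξ e.proj) := by
  have h : dπ e (mlieBracket IE (vf EM (hat ξ)) (sf S) e) = L.anchor e.proj (ξ e.proj) := by
    refine Eq.trans (Eq.symm (L.pbracket_mem (L.iSec_isProl (hat_smooth ξ)) hS e)) ?_
    exact congrArg _ (congrFun (jSec_pbracket_vLift hS hj ξ) e)
  rw [map_smul, map_add, L.mfderiv_proj_cl, h, ← two_smul ℝ, smul_smul]
  norm_num

theorem along_sf_hat (hS : L.IsProlSection S) (hj : jSec S = delta) (ξ : Sec EM F V)
    (e : TotalSpace F V) :
    along IE (sf S) (coord e.proj (hat ξ)) e =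
      along 𝓘(ℝ, EM) (L.rho (ext EM F e.2)) (fun y => loc F e.proj y (ξ y)) e.proj := by
  have hx := mem_dom (EM := EM) (F := F) (V := V) e.proj
  refine (mvfderiv_comp_proj (mdiff_of_smooth (sec_smooth ξ hx)) _).trans ?_
  have h : L.anchor e.proj (S e).1 = dπ e (S e).2 := hS.mem e
  rw [← h, along, rho, ext_apply, show (S e).1 = e.2 from congrFun hj e]

/-- The fibre coordinates of the horizontal lift only depend on the value of the section. -/
theorem mvfderiv_fc_lift (hS : L.IsProlSection S) (hj : jSec S = delta) (ξ : Sec EM F V)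
    (e : TotalSpace F V) :
    mvfderiv IE (fc e.proj : TotalSpace F V → F) e ((1 / 2 : ℝ) • (L.completeLiftField ξ e +
        mlieBracket IE (vf EM (hat ξ)) (sf S) e)) =
      (1 / 2 : ℝ) • (mvfderiv IE (along IE (sf S) (fc e.proj)) e (vert EM e (ξ e.proj)) +
        loc F e.proj e.proj (L.bracket (cst EM F V e.proj (fc e.proj e))
          (cst EM F V e.proj (loc F e.proj e.proj (ξ e.proj))) e.proj)) := by
  have hg := mem_frameDom (EM := EM) (F := F) (V := V) e.proj
  have hx := dom_of_frame hg
  have h1 : along IE (vf EM (hat ξ)) (fc e.proj) =ᶠ[𝓝 e] coord e.proj (hat ξ) :=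
    (eventually_proj_dom hx).mono fun e' he' => along_vf_fc he'
  have h2 : mvfderiv IE (fc e.proj : TotalSpace F V → F) e
      (mlieBracket IE (vf EM (hat ξ)) (sf S) e) = _ :=
    along_bracket (fc_smooth hx) ((hat_smooth ξ).vf e) (hS.smooth_snd e)
  have h3 : along IE (sf S) (along IE (vf EM (hat ξ)) (fc e.proj)) e =
      along 𝓘(ℝ, EM) (L.rho (ext EM F e.2)) (fun y => loc F e.proj y (ξ y)) e.proj := by
    rw [along, mvfderiv_congr h1]
    exact along_sf_hat hS hj ξ e
  have h4 : L.lieMat e.proj ξ e.proj (fc e.proj e) =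
      along 𝓘(ℝ, EM) (L.rho (ext EM F e.2)) (fun y => loc F e.proj y (ξ y)) e.proj +
      loc F e.proj e.proj (L.bracket (cst EM F V e.proj (fc e.proj e))
          (cst EM F V e.proj (loc F e.proj e.proj (ξ e.proj))) e.proj) := by
    have h5 : ∀ ζ ζ' : Sec EM F V, -loc F e.proj e.proj (L.bracket ζ ζ' e.proj) =
        loc F e.proj e.proj (L.bracket ζ' ζ e.proj) := by
      intro ζ ζ'
      rw [L.bracket_neg_swap ζ' ζ, ← loc_neg hx]
      rfl
    rw [L.lieMat_apply hx, h5, L.loc_bracket hg]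
    congr 1
    simp only [along, rho]
    rw [ext_apply]
    exact congrArg _ (congrArg _ (cst_loc hg e.2))
  rw [map_smul, map_add, L.mvfderiv_fc_cl hg, h2, h3, h4]
  refine congrArg _ ?_
  change _ + (mvfderiv IE (along IE (sf S) (fc e.proj)) e (vert EM e (ξ e.proj)) - _) = _
  abel

/-- The horizontal lift at `e` may be computed with any section with the given value. -/
theorem horVec_eq (hS : L.IsProlSection S) (hj : jSec S = delta) (ξ : Sec EM F V)
    (e : TotalSpace F V) :
    L.horVec S e (ξ e.proj) = (1 / 2 : ℝ) • (L.completeLiftField ξ e +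
      mlieBracket IE (vf EM (hat ξ)) (sf S) e) := by
  have hx := mem_dom (EM := EM) (F := F) (V := V) e.proj
  refine tangent_ext hx ?_ ?_
  · rw [mvfderiv_bc hx, mvfderiv_bc hx, horVec, mfderiv_proj_lift hS hj,
      mfderiv_proj_lift hS hj, ext_apply]
  · rw [horVec, mvfderiv_fc_lift hS hj, mvfderiv_fc_lift hS hj, ext_apply]

theorem mfderiv_proj_horVec (hS : L.IsProlSection S) (hj : jSec S = delta) (e : TotalSpace F V)
    (u : V e.proj) : dπ e (L.horVec S e u) = L.anchor e.proj u := by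
  rw [horVec, mfderiv_proj_lift hS hj, ext_apply]

theorem mvfderiv_fc_horVec (hS : L.IsProlSection S) (hj : jSec S = delta) (e : TotalSpace F V)
    (u : V e.proj) :
    mvfderiv IE (fc e.proj : TotalSpace F V → F) e (L.horVec S e u) =
      (1 / 2 : ℝ) • (mvfderiv IE (along IE (sf S) (fc e.proj)) e (vert EM e u) +
        loc F e.proj e.proj (L.bracket (cst EM F V e.proj (fc e.proj e))
          (cst EM F V e.proj (loc F e.proj e.proj u)) e.proj)) := by
  rw [horVec, mvfderiv_fc_lift hS hj, ext_apply]

theorem horVec_isLinear (hS : L.IsProlSection S) (hj : jSec S = delta) (e : TotalSpace F V) :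
    IsLinearMap ℝ (L.horVec S e) := by
  have hx := mem_dom (EM := EM) (F := F) (V := V) e.proj
  constructor
  · intro u v
    refine tangent_ext hx ?_ ?_
    · rw [map_add]
      simp only [mvfderiv_bc hx, mfderiv_proj_horVec hS hj]
      rw [map_add, map_add]
    · rw [map_add]
      simp only [mvfderiv_fc_horVec hS hj]
      rw [vert_add, map_add, loc_add hx, map_add, map_add]
      refine Eq.trans (congrArg (fun w => (1 / 2 : ℝ) • (_ + w)) (loc_add hx _ _)) ?_
      module
  · intro c u
    refine tangent_ext hx ?_ ?_
    · rw [map_smul]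
      simp only [mvfderiv_bc hx, mfderiv_proj_horVec hS hj]
      rw [map_smul, map_smul]
    · rw [map_smul]
      simp only [mvfderiv_fc_horVec hS hj]
      rw [vert_smul, map_smul, loc_smul hx, map_smul, map_smul]
      refine Eq.trans (congrArg (fun w => (1 / 2 : ℝ) • (_ + w)) (loc_smul hx _ _)) ?_
      module

theorem hor_hat (hS : L.IsProlSection S) (hj : jSec S = delta) (ξ : Sec EM F V) :
    L.hor S (hat ξ) = (1 / 2 : ℝ) • (L.completeLiftField ξ +
      mlieBracket IE (vf EM (hat ξ)) (sf S)) :=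
  funext fun e => horVec_eq hS hj ξ e

theorem hor_hat_smooth (hS : L.IsProlSection S) (hj : jSec S = delta) (ξ : Sec EM F V)
    (e : TotalSpace F V) : SmoothFieldAt IE (L.hor S (hat ξ)) e := by
  rw [hor_hat hS hj]
  exact ((L.cl_smooth ξ e).add (((hat_smooth ξ).vf e).bracket (hS.smooth_snd e))).const_smul _

/-- The components of a section of `π^*E` in a local frame. -/
def comp (x₀ : M) (σ : PullSec F V) (i : Fin (Module.finrank ℝ F)) (e : TotalSpace F V) : ℝ :=
  (Module.finBasis ℝ F).coord i (coord x₀ σ e)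

theorem comp_smooth {e : TotalSpace F V} (hx : e.proj ∈ frameDom EM F V x₀) {σ : PullSec F V}
    (hσ : IsSmoothPullSec EM σ) (i : Fin (Module.finrank ℝ F)) :
    ContMDiffAt IE 𝓘(ℝ, ℝ) ∞ (comp x₀ σ i) e :=
  (LinearMap.toContinuousLinearMap
    ((Module.finBasis ℝ F).coord i)).contMDiff.contMDiffAt.comp e (hσ.coord (dom_of_frame hx))

/-- The expansion of a section of `π^*E` in a local frame. -/
theorem eq_sum_frame {e : TotalSpace F V} (hx : e.proj ∈ frameDom EM F V x₀) (σ : PullSec F V) :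
    σ e = ∑ i, comp x₀ σ i e •
      hat (cst EM F V x₀ (Module.finBasis ℝ F i)) e := by
  have hd := dom_of_frame hx
  refine (locEquiv hd).injective ?_
  rw [map_sum]
  have : ∀ i, locEquiv hd (comp x₀ σ i e •
      hat (cst EM F V x₀ (Module.finBasis ℝ F i)) e) =
      comp x₀ σ i e • Module.finBasis ℝ F i := by
    intro i
    rw [map_smul]
    exact congrArg _ (loc_cst hx _)
  rw [Finset.sum_congr rfl fun i _ => this i]
  exact ((Module.finBasis ℝ F).sum_repr _).symm

theorem hor_eq_sum (hS : L.IsProlSection S) (hj : jSec S = delta) {e : TotalSpace F V}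
    (hx : e.proj ∈ frameDom EM F V x₀) (σ : PullSec F V) :
    L.hor S σ e = ∑ i, comp x₀ σ i e •
      L.hor S (hat (cst EM F V x₀ (Module.finBasis ℝ F i))) e := by
  have h := congrArg (IsLinearMap.mk' _ (horVec_isLinear hS hj e)) (eq_sum_frame hx σ)
  rw [map_sum] at h
  simp only [map_smul] at h
  exact h

theorem hor_eventuallyEq (hS : L.IsProlSection S) (hj : jSec S = delta) {e : TotalSpace F V}
    (hx : e.proj ∈ frameDom EM F V x₀) (σ : PullSec F V) :
    L.hor S σ =ᶠ[𝓝 e] ∑ i, comp x₀ σ i •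
      L.hor S (hat (cst EM F V x₀ (Module.finBasis ℝ F i))) :=
  (eventually_proj_frameDom hx).mono fun _ he' =>
    (hor_eq_sum hS hj he' σ).trans (Eq.symm (Finset.sum_apply _ _ _))

theorem hor_smooth (hS : L.IsProlSection S) (hj : jSec S = delta) {σ : PullSec F V}
    (hσ : IsSmoothPullSec EM σ) (e : TotalSpace F V) : SmoothFieldAt IE (L.hor S σ) e :=
  SmoothFieldAt.congr (SmoothFieldAt.sum _ fun i _ => SmoothFieldAt.smul
    (comp_smooth (mem_frameDom e.proj) hσ i) (hor_hat_smooth hS hj _ e))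
    (hor_eventuallyEq hS hj (mem_frameDom e.proj) σ)

/-- The Berwald connection is a splitting: `j ∘ 𝓗` is the identity. -/
theorem jSec_berwald (hS : L.IsProlSection S) (hj : jSec S = delta) (σ : PullSec F V) :
    jSec (L.berwald S σ) = σ := by
  funext e
  change (1 / 2 : ℝ) • (ext EM F (σ e) e.proj + jSec (L.pbracket (vLift (ext EM F (σ e))) S) e) = _
  rw [jSec_pbracket_vLift hS hj, hat, ext_apply, ← two_smul ℝ, smul_smul]
  norm_num

theorem berwald_isProl (hS : L.IsProlSection S) (hj : jSec S = delta) {σ : PullSec F V}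
    (hσ : IsSmoothPullSec EM σ) : L.IsProlSection (L.berwald S σ) where
  mem e := by
    refine Eq.trans ?_ (mfderiv_proj_horVec hS hj e (σ e)).symm
    exact congrArg _ (congrFun (jSec_berwald hS hj σ) e)
  smooth_fst := by rwa [jSec_berwald hS hj]
  smooth_snd := hor_smooth hS hj hσ

/-- The operator `∇^v` defined by the Berwald connection is the derivative along the fibres. -/
theorem vertDeriv_eq (hS : L.IsProlSection S) (hj : jSec S = delta) {σ τ : PullSec F V}
    (hσ : IsSmoothPullSec EM σ) (hτ : IsSmoothPullSec EM τ) :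
    L.vertDeriv S σ τ = vderiv EM σ τ := by
  rw [vertDeriv, L.jSec_pbracket_iSec hσ (berwald_isProl hS hj hτ), jSec_berwald hS hj]

/-- The Lie derivative of a section expanded in a local frame. -/
theorem lieDer_eq_sum {e : TotalSpace F V} (hx : e.proj ∈ frameDom EM F V x₀) (η : Sec EM F V)
    {σ : PullSec F V} (hσ : IsSmoothPullSec EM σ) :
    L.lieDer (L.cLift η) σ e = ∑ i, (along IE (L.completeLiftField η) (comp x₀ σ i) e •
        hat (cst EM F V x₀ (Module.finBasis ℝ F i)) e +
      comp x₀ σ i e • hat (L.bracket η (cst EM F V x₀ (Module.finBasis ℝ F i))) e) := by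
  have hd := dom_of_frame hx
  let b := Module.finBasis ℝ F
  refine (locEquiv hd).injective ?_
  have h1 : ∀ i, along IE (L.completeLiftField η) (comp x₀ σ i) e =
      b.coord i (along IE (L.completeLiftField η) (coord x₀ σ) e) := fun i =>
    mvfderiv_clm_comp (LinearMap.toContinuousLinearMap (b.coord i))
      (mdiff_of_smooth (hσ.coord hd)) _
  have h2 : ∀ i, locEquiv hd (along IE (L.completeLiftField η) (comp x₀ σ i) e •
        hat (cst EM F V x₀ (b i)) e +
      comp x₀ σ i e • hat (L.bracket η (cst EM F V x₀ (b i))) e) =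
      b.coord i (along IE (L.completeLiftField η) (coord x₀ σ) e) • b i -
        b.coord i (coord x₀ σ e) • L.lieMat x₀ η e.proj (b i) := by
    intro i
    have h3 : locEquiv hd (hat (cst EM F V x₀ (b i)) e) = b i := loc_cst hx _
    have h4 : locEquiv hd (hat (L.bracket η (cst EM F V x₀ (b i))) e) =
        -L.lieMat x₀ η e.proj (b i) := by
      rw [L.lieMat_apply hd, neg_neg]
      rfl
    rw [map_add, map_smul, map_smul, h1, h3, h4, smul_neg, sub_eq_add_neg]
    rfl
  rw [map_sum, Finset.sum_congr rfl fun i _ => h2 i, Finset.sum_sub_distrib]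
  refine (L.coord_lieDer η hσ hx).trans ?_
  refine congrArg₂ _ (b.sum_repr _).symm ?_
  conv_lhs => rw [← b.sum_repr (coord x₀ σ e), map_sum]
  simp only [map_smul]
  rfl

/-- The horizontal lift commutes with the Lie derivative along a Lie symmetry. For `σ = ξ̂` this is
the Jacobi identity, applied to `½ (ξ^c + [ξ^∨, S])`; in general `σ` is expanded in a local
frame. -/
theorem cl_bracket_hor (hS : L.IsProlSection S) (hj : jSec S = delta) {η : Sec EM F V}
    (hη : mlieBracket IE (L.completeLiftField η) (sf S) = 0) {σ : PullSec F V}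
    (hσ : IsSmoothPullSec EM σ) :
    mlieBracket IE (L.completeLiftField η) (L.hor S σ) =
      L.hor S (L.lieDer (L.cLift η) σ) := by
  have h1 : ∀ ξ, mlieBracket IE (L.completeLiftField η) (L.hor S (hat ξ)) =
      L.hor S (hat (L.bracket η ξ)) := by
    intro ξ
    funext e
    have hb := ((hat_smooth ξ).vf e).bracket (hS.smooth_snd e)
    rw [hor_hat hS hj, hor_hat hS hj, mlieBracket_const_smul_right
      (((L.cl_smooth ξ e).add hb).mdiff), mlieBracket_add_right (L.cl_smooth ξ e).mdiff hb.mdiff,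
      cl_bracket_cl, bracket_jacobi (L.cl_smooth η e) ((hat_smooth ξ).vf e) (hS.smooth_snd e),
      cl_bracket_vert, hη, mlieBracket_zero_right]
    simp
  funext e
  have hg := mem_frameDom (EM := EM) (F := F) (V := V) e.proj
  let b := Module.finBasis ℝ F
  have h2 := (EventuallyEq.refl (𝓝 e) (L.completeLiftField η)).mlieBracket_vectorField_eq (I := IE)
    (hor_eventuallyEq hS hj hg σ)
  have h3 : ∀ i, SmoothFieldAt IE (comp e.proj σ i • L.hor S (hat (cst EM F V e.proj (b i)))) e :=
    fun i => SmoothFieldAt.smul (comp_smooth hg hσ i) (hor_hat_smooth hS hj _ e)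
  refine (h2.trans (bracket_sum_right _ fun i _ => h3 i)).trans ?_
  have h4 := congrArg (IsLinearMap.mk' _ (horVec_isLinear hS hj e)) (lieDer_eq_sum (L := L) hg η hσ)
  rw [map_sum] at h4
  refine Eq.trans (Finset.sum_congr rfl fun i _ => ?_) h4.symm
  rw [bracket_smul_right (mdiff_of_smooth (comp_smooth hg hσ i))
    (hor_hat_smooth hS hj _ e).mdiff, h1, map_add, map_smul, map_smul]
  rfl

/-! ### The Jacobi endomorphism -/

theorem sf_smooth (hS : L.IsProlSection S) (e : TotalSpace F V) :
    SmoothFieldAt IE (sf S) e := hS.smooth_snd e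

theorem vf_injective : Function.Injective (vf EM : PullSec F V → _) :=
  fun _ _ h => funext fun e => vert_injective e (congrFun h e)

variable (L) in
/-- The section `j ⟦S, 𝓗 σ⟧`, which is the covariant derivative of `σ` along the spray. -/
def dyn (S : PairSec EM F V) (σ : PullSec F V) : PullSec F V :=
  jSec (L.pbracket S (L.berwald S σ))

/-- The vertical lift of `j ⟦S, 𝓗 σ⟧` is `[S, σ^∨] + 𝓗 σ`. -/
theorem vf_dyn (hS : L.IsProlSection S) (hj : jSec S = delta) {σ : PullSec F V}
    (hσ : IsSmoothPullSec EM σ) :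
    vf EM (L.dyn S σ) = mlieBracket IE (sf S) (vf EM σ) + L.hor S σ := by
  funext e
  have hg := mem_frameDom (EM := EM) (F := F) (V := V) e.proj
  have hx := dom_of_frame hg
  have h1 : (L.pbracket S (iSec EM σ) e).1 = -σ e := by
    have h : jSec (L.pbracket (iSec EM σ) S) = σ := by
      rw [L.jSec_pbracket_iSec hσ hS, hj, vderiv_delta]
    rw [pbracket_swap]
    exact congrArg _ (congrFun h e)
  have h2 : dπ e (mlieBracket IE (sf S) (vf EM σ) e) = -L.anchor e.proj (σ e) := by
    refine Eq.trans (Eq.symm (L.pbracket_mem hS (L.iSec_isProl hσ) e)) ?_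
    rw [h1, map_neg]
  have h3 : L.hor S σ e = L.horVec S e (σ e) := rfl
  refine tangent_ext hx ?_ ?_
  · refine (mvfderiv_bc_vert hx _).trans ?_
    rw [Pi.add_apply, map_add, mvfderiv_bc hx, mvfderiv_bc hx, h2, h3,
      mfderiv_proj_horVec hS hj, ← map_add, neg_add_cancel, map_zero]
  · have hb := berwald_isProl hS hj hσ
    refine (mvfderiv_fc_vert hx _).trans ((L.loc_pbracket hS hb e).trans ?_)
    have h4 : mvfderiv IE (fc e.proj : TotalSpace F V → F) e
        (mlieBracket IE (sf S) (vf EM σ) e) =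
        mvfderiv IE (coord e.proj σ) e (sf S e) -
          mvfderiv IE (along IE (sf S) (fc e.proj)) e (vert EM e (σ e)) := by
      refine (along_bracket (fc_smooth hx) (hS.smooth_snd e) (hσ.vf e)).trans ?_
      refine congrArg₂ _ ?_ rfl
      have h5 : along IE (vf EM σ) (fc e.proj) =ᶠ[𝓝 e] coord e.proj σ :=
        (eventually_proj_dom hx).mono fun e' he' => along_vf_fc he'
      rw [along, mvfderiv_congr h5]
    have h6 : (L.berwald S σ e).1 = σ e := congrFun (jSec_berwald hS hj σ) e
    have h7 : (S e).1 = e.2 := congrFun hj e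
    have h8 := mvfderiv_fc_horVec hS hj e (σ e)
    rw [Pi.add_apply, map_add, h4, h3, jSec_berwald hS hj, hj, coord_delta, h6, h7]
    change _ - mvfderiv IE (fc e.proj) e (L.horVec S e (σ e)) + _ = _
    rw [h8]
    change _ - _ + loc F e.proj e.proj (L.bracket (cst EM F V e.proj (fc e.proj e)) _ e.proj) = _
    module

theorem dyn_smooth (hS : L.IsProlSection S) (hj : jSec S = delta) {σ : PullSec F V}
    (hσ : IsSmoothPullSec EM σ) : IsSmoothPullSec EM (L.dyn S σ) := by
  rw [← vf_smooth_iff, vf_dyn hS hj hσ]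
  exact fun e => ((sf_smooth hS e).bracket (hσ.vf e)).add (hor_smooth hS hj hσ e)

variable (L) in
/-- The Jacobi endomorphism as an operator on sections. -/
def jac (S : PairSec EM F V) (σ : PullSec F V) : PullSec F V :=
  L.vmap S (L.pbracket S (L.berwald S σ))

/-- The vertical lift of `K σ` is `[S, 𝓗 σ] - 𝓗 j ⟦S, 𝓗 σ⟧`. -/
theorem vf_jac (hS : L.IsProlSection S) (hj : jSec S = delta) {σ : PullSec F V}
    (hσ : IsSmoothPullSec EM σ) :
    vf EM (L.jac S σ) = mlieBracket IE (sf S) (L.hor S σ) - L.hor S (L.dyn S σ) := by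
  funext e
  have hb := berwald_isProl hS hj hσ
  refine vert_iInv ?_ ?_
  · change L.dyn S σ e - jSec (L.berwald S (L.dyn S σ)) e = 0
    rw [jSec_berwald hS hj, sub_self]
  · change dπ e (mlieBracket IE (sf S) (L.hor S σ) e - L.horVec S e (L.dyn S σ e)) = 0
    rw [map_sub, mfderiv_proj_horVec hS hj]
    exact sub_eq_zero.2 (Eq.symm (L.pbracket_mem hS hb e))

theorem jac_smooth (hS : L.IsProlSection S) (hj : jSec S = delta) {σ : PullSec F V}
    (hσ : IsSmoothPullSec EM σ) : IsSmoothPullSec EM (L.jac S σ) := by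
  rw [← vf_smooth_iff, vf_jac hS hj hσ]
  exact fun e => ((sf_smooth hS e).bracket (hor_smooth hS hj hσ e)).sub
    (hor_smooth hS hj (dyn_smooth hS hj hσ) e)

/-- The operator `j ⟦S, 𝓗 ·⟧` commutes with the Lie derivative along a Lie symmetry. -/
theorem lieDer_dyn (hS : L.IsProlSection S) (hj : jSec S = delta) {η : Sec EM F V}
    (hη : mlieBracket IE (L.completeLiftField η) (sf S) = 0) {σ : PullSec F V}
    (hσ : IsSmoothPullSec EM σ) :
    L.lieDer (L.cLift η) (L.dyn S σ) = L.dyn S (L.lieDer (L.cLift η) σ) := by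
  refine vf_injective (EM := EM) ?_
  rw [L.vf_lieDer η (dyn_smooth hS hj hσ), vf_dyn hS hj hσ,
    vf_dyn hS hj (L.lieDer_smooth η hσ), L.vf_lieDer η hσ, ← cl_bracket_hor hS hj hη hσ]
  funext e
  rw [Pi.add_apply, mlieBracket_add_right ((sf_smooth hS e).bracket (hσ.vf e)).mdiff
    (hor_smooth hS hj hσ e).mdiff, bracket_jacobi (L.cl_smooth η e) (hS.smooth_snd e) (hσ.vf e),
    hη, mlieBracket_zero_left]
  simp

/-- The Jacobi endomorphism is invariant under Lie symmetries. -/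
theorem lieDer_jac (hS : L.IsProlSection S) (hj : jSec S = delta) {η : Sec EM F V}
    (hη : mlieBracket IE (L.completeLiftField η) (sf S) = 0) {σ : PullSec F V}
    (hσ : IsSmoothPullSec EM σ) :
    L.lieDer (L.cLift η) (L.jac S σ) = L.jac S (L.lieDer (L.cLift η) σ) := by
  have hd := dyn_smooth hS hj hσ
  refine vf_injective (EM := EM) ?_
  rw [L.vf_lieDer η (jac_smooth hS hj hσ), vf_jac hS hj hσ,
    vf_jac hS hj (L.lieDer_smooth η hσ), ← lieDer_dyn hS hj hη hσ, ← cl_bracket_hor hS hj hη hσ,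
    ← cl_bracket_hor hS hj hη hd]
  funext e
  have h1 := (hor_smooth hS hj hd e).const_smul (-1)
  rw [sub_eq_add_neg, ← neg_one_smul ℝ (L.hor S (L.dyn S σ)), Pi.sub_apply,
    mlieBracket_add_right ((sf_smooth hS e).bracket (hor_smooth hS hj hσ e)).mdiff h1.mdiff,
    mlieBracket_const_smul_right (hor_smooth hS hj hd e).mdiff,
    bracket_jacobi (L.cl_smooth η e) (hS.smooth_snd e) (hor_smooth hS hj hσ e),
    hη, mlieBracket_zero_left]
  simp [sub_eq_add_neg]

/-- For a Lie symmetry `η`, the complete lift `η^c` commutes with the vector field of the spray. -/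
theorem cl_bracket_sf {η : Sec EM F V} (hη : L.IsLieSymmetry S η) :
    mlieBracket IE (L.completeLiftField η) (sf S) = 0 := by
  rw [mlieBracket_swap, neg_eq_zero]
  funext e
  exact congrArg Prod.snd (congrFun hη e)

end LieAlgebroid

/-! ### Tensor fields and traces -/

/-- The operator `P` on sections of `π^*E` is a tensor field of type `(1, 1)`: it preserves
smoothness and is given by a linear map in each fibre. -/
structure IsEndo (P : PullSec F V → PullSec F V) : Prop where
  smooth : ∀ {σ}, IsSmoothPullSec EM σ → IsSmoothPullSec EM (P σ)
  linear : ∀ e : TotalSpace F V, ∃ T : V e.proj →ₗ[ℝ] V e.proj,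
    ∀ σ, IsSmoothPullSec EM σ → P σ e = T (σ e)

/-- The operator `B` on pairs of sections of `π^*E` is a tensor field of type `(1, 2)`. -/
structure IsBi (B : PullSec F V → PullSec F V → PullSec F V) : Prop where
  smooth : ∀ {σ τ}, IsSmoothPullSec EM σ → IsSmoothPullSec EM τ → IsSmoothPullSec EM (B σ τ)
  linear : ∀ e : TotalSpace F V, ∃ T : V e.proj →ₗ[ℝ] V e.proj →ₗ[ℝ] V e.proj,
    ∀ σ τ, IsSmoothPullSec EM σ → IsSmoothPullSec EM τ → B σ τ e = T (σ e) (τ e)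

theorem IsEndo.add {P : PullSec F V → PullSec F V} (hP : IsEndo (EM := EM) P) {σ τ : PullSec F V}
    (hσ : IsSmoothPullSec EM σ) (hτ : IsSmoothPullSec EM τ) : P (σ + τ) = P σ + P τ := by
  funext e
  obtain ⟨T, hT⟩ := hP.linear e
  rw [Pi.add_apply, hT _ (hσ.add hτ), hT _ hσ, hT _ hτ, ← map_add]
  rfl

theorem IsBi.add_left {B : PullSec F V → PullSec F V → PullSec F V} (hB : IsBi (EM := EM) B)
    {σ σ' τ : PullSec F V} (hσ : IsSmoothPullSec EM σ) (hσ' : IsSmoothPullSec EM σ')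
    (hτ : IsSmoothPullSec EM τ) : B (σ + σ') τ = B σ τ + B σ' τ := by
  funext e
  obtain ⟨T, hT⟩ := hB.linear e
  rw [Pi.add_apply, hT _ _ (hσ.add hσ') hτ, hT _ _ hσ hτ, hT _ _ hσ' hτ,
    ← LinearMap.add_apply, ← map_add]
  rfl

theorem IsBi.add_right {B : PullSec F V → PullSec F V → PullSec F V} (hB : IsBi (EM := EM) B)
    {σ τ τ' : PullSec F V} (hσ : IsSmoothPullSec EM σ) (hτ : IsSmoothPullSec EM τ)
    (hτ' : IsSmoothPullSec EM τ') : B σ (τ + τ') = B σ τ + B σ τ' := by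
  funext e
  obtain ⟨T, hT⟩ := hB.linear e
  rw [Pi.add_apply, hT _ _ hσ (hτ.add hτ'), hT _ _ hσ hτ, hT _ _ hσ hτ', ← map_add]
  rfl

theorem IsBi.endo {B : PullSec F V → PullSec F V → PullSec F V} (hB : IsBi (EM := EM) B)
    {τ : PullSec F V} (hτ : IsSmoothPullSec EM τ) : IsEndo (EM := EM) fun σ => B σ τ where
  smooth hσ := hB.smooth hσ hτ
  linear e := by
    obtain ⟨T, hT⟩ := hB.linear e
    exact ⟨T.flip (τ e), fun σ hσ => hT σ τ hσ hτ⟩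

variable (EM) in
/-- The matrix of a tensor field of type `(1, 1)` in the frame `cst x₀`. -/
def opMat (x₀ : M) (P : PullSec F V → PullSec F V) : TotalSpace F V → F →L[ℝ] F :=
  matL fun v e => loc F x₀ e.proj (P (hat (cst EM F V x₀ v)) e)

variable (EM) in
/-- The trace of an operator on sections of `π^*E` that is a tensor field. -/
def trOp (P : PullSec F V → PullSec F V) (e : TotalSpace F V) : ℝ :=
  fibreTrace fun u : V e.proj => P (hat (ext EM F u)) e

theorem opMat_apply {P : PullSec F V → PullSec F V} (hP : IsEndo (EM := EM) P)
    {e : TotalSpace F V} (hx : e.proj ∈ dom EM F V x₀) (v : F) :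
    opMat EM x₀ P e v = loc F x₀ e.proj (P (hat (cst EM F V x₀ v)) e) := by
  obtain ⟨T, hT⟩ := hP.linear e
  refine matL_apply (g := fun v (e : TotalSpace F V) =>
    loc F x₀ e.proj (P (hat (cst EM F V x₀ v)) e)) ⟨fun v w => ?_, fun a v => ?_⟩ v
  · rw [hT _ (hat_smooth _), hT _ (hat_smooth _), hT _ (hat_smooth _), ← loc_add hx, ← map_add,
      map_add]
    rfl
  · rw [hT _ (hat_smooth _), hT _ (hat_smooth _), ← loc_smul hx, ← map_smul, map_smul]
    rfl

theorem opMat_smooth {P : PullSec F V → PullSec F V} (hP : IsEndo (EM := EM) P)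
    {e : TotalSpace F V} (hx : e.proj ∈ dom EM F V x₀) :
    ContMDiffAt IE 𝓘(ℝ, F →L[ℝ] F) ∞ (opMat EM x₀ P) e :=
  matL_smooth fun _ => (hP.smooth (hat_smooth _)).coord hx

/-- In a trivialization, a tensor field of type `(1, 1)` acts by its matrix. -/
theorem coord_endo {P : PullSec F V → PullSec F V} (hP : IsEndo (EM := EM) P)
    {e : TotalSpace F V} (hx : e.proj ∈ frameDom EM F V x₀) {σ : PullSec F V}
    (hσ : IsSmoothPullSec EM σ) : coord x₀ (P σ) e = opMat EM x₀ P e (coord x₀ σ e) := by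
  obtain ⟨T, hT⟩ := hP.linear e
  rw [opMat_apply hP (dom_of_frame hx), hT _ (hat_smooth _), coord, hT _ hσ]
  refine congrArg (fun u => loc F x₀ e.proj (T u)) ?_
  exact (cst_loc hx (σ e)).symm

variable (F) in
/-- The trace of endomorphisms of `F`, as a continuous linear functional. -/
def traceL : (F →L[ℝ] F) →L[ℝ] ℝ :=
  LinearMap.toContinuousLinearMap (LinearMap.trace ℝ F ∘ₗ ContinuousLinearMap.coeLM ℝ)

theorem trOp_of_linear {P : PullSec F V → PullSec F V} {e : TotalSpace F V}
    {T : V e.proj →ₗ[ℝ] V e.proj} (hT : ∀ σ, IsSmoothPullSec EM σ → P σ e = T (σ e)) :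
    trOp EM P e = LinearMap.trace ℝ (V e.proj) T := by
  have h : (fun u : V e.proj => P (hat (ext EM F u)) e) = T := by
    funext u
    rw [hT _ (hat_smooth _), hat, ext_apply]
  rw [trOp, h, fibreTrace, dif_pos T.isLinear]
  rfl

/-- The fibrewise trace is the trace of the matrix in a local frame, hence smooth. -/
theorem trOp_eq {P : PullSec F V → PullSec F V} (hP : IsEndo (EM := EM) P)
    {e : TotalSpace F V} (hx : e.proj ∈ frameDom EM F V x₀) :
    trOp EM P e = traceL F (opMat EM x₀ P e) := by
  obtain ⟨T, hT⟩ := hP.linear e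
  rw [trOp_of_linear hT, ← LinearMap.trace_conj' T (locEquiv (dom_of_frame hx))]
  refine congrArg (LinearMap.trace ℝ F) (LinearMap.ext fun v => ?_)
  refine Eq.trans ?_ (opMat_apply hP (dom_of_frame hx) v).symm
  rw [hT _ (hat_smooth _), LinearEquiv.conj_apply]
  refine congrArg (fun u => loc F x₀ e.proj (T u)) ?_
  refine loc_inj (dom_of_frame hx) ?_
  exact (loc_locSymm (dom_of_frame hx) v).trans (loc_cst hx v).symm

theorem trOp_eventuallyEq {P : PullSec F V → PullSec F V} (hP : IsEndo (EM := EM) P)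
    (e : TotalSpace F V) :
    trOp EM P =ᶠ[𝓝 e] fun e' => traceL F (opMat EM e.proj P e') :=
  (eventually_proj_frameDom (mem_frameDom e.proj)).mono fun _ he' => trOp_eq hP he'

theorem trOp_smooth {P : PullSec F V → PullSec F V} (hP : IsEndo (EM := EM) P) :
    ContMDiff IE 𝓘(ℝ, ℝ) ∞ (trOp EM P) := fun e =>
  ((traceL F).contMDiff.contMDiffAt.comp e
    (opMat_smooth hP (mem_dom e.proj))).congr_of_eventuallyEq (trOp_eventuallyEq hP e)

/-- The alternation of the vertical derivative of a tensor field of type `(1, 1)`. -/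
def altOp (EM : Type*) [NormedAddCommGroup EM] [NormedSpace ℝ EM] {M : Type*}
    [TopologicalSpace M] [ChartedSpace EM M]
    {F : Type*} [NormedAddCommGroup F] [NormedSpace ℝ F]
    {V : M → Type*} [TopologicalSpace (TotalSpace F V)]
    [∀ x, AddCommGroup (V x)] [∀ x, Module ℝ (V x)] [∀ x, TopologicalSpace (V x)]
    [FiberBundle F V] (P : PullSec F V → PullSec F V) (σ τ : PullSec F V) : PullSec F V :=
  (1 / 3 : ℝ) • ((vderiv EM τ (P σ) - P (vderiv EM τ σ)) -
    (vderiv EM σ (P τ) - P (vderiv EM σ τ)))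

/-- The vertical derivative of a tensor field is the derivative of its matrix. -/
theorem coord_vderiv_endo {P : PullSec F V → PullSec F V} (hP : IsEndo (EM := EM) P)
    {σ τ : PullSec F V} (hσ : IsSmoothPullSec EM σ) (hτ : IsSmoothPullSec EM τ)
    (e : TotalSpace F V) :
    loc F e.proj e.proj (vderiv EM σ (P τ) e - P (vderiv EM σ τ) e) =
      mvfderiv IE (opMat EM e.proj P) e (vert EM e (σ e)) (loc F e.proj e.proj (τ e)) := by
  have hg := mem_frameDom (EM := EM) (F := F) (V := V) e.proj
  have hx := dom_of_frame hg
  have h1 : coord e.proj (P τ) =ᶠ[𝓝 e] fun e' => opMat EM e.proj P e' (coord e.proj τ e') :=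
    (eventually_proj_frameDom hg).mono fun e' he' => coord_endo hP he' hτ
  have h2 : loc F e.proj e.proj (vderiv EM σ (P τ) e) = _ := coord_vderiv hx (hP.smooth hτ)
  have h3 : loc F e.proj e.proj (P (vderiv EM σ τ) e) = _ :=
    coord_endo hP hg (vderiv_smooth hσ hτ)
  rw [loc_sub hx, h2, h3, coord_vderiv hx hτ, along, mvfderiv_congr h1,
    mvfderiv_clm_apply (mdiff_of_smooth (opMat_smooth hP hx)) (mdiff_of_smooth (hτ.coord hx))]
  exact add_sub_cancel_right _ _

/-- The alternated vertical derivative of a tensor field is a tensor field: in coordinates it is the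
alternation of the derivative of the matrix in vertical directions. -/
theorem altOp_isBi {P : PullSec F V → PullSec F V} (hP : IsEndo (EM := EM) P) :
    IsBi (EM := EM) (altOp EM P) where
  smooth {σ τ} hσ hτ := by
    have h : ∀ {σ τ}, IsSmoothPullSec EM σ → IsSmoothPullSec EM τ →
        IsSmoothPullSec EM (vderiv EM σ (P τ) - P (vderiv EM σ τ)) := fun hσ hτ =>
      (vderiv_smooth hσ (hP.smooth hτ)).sub (hP.smooth (vderiv_smooth hσ hτ))
    exact ((h hτ hσ).sub (h hσ hτ)).const_smul _
  linear e := by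
    have hx := mem_dom (EM := EM) (F := F) (V := V) e.proj
    let A : F →L[ℝ] F →L[ℝ] F := (mvfderiv IE (opMat EM e.proj P) e).comp
      (LinearMap.toContinuousLinearMap ((vertL EM e) ∘ₗ (locEquiv hx).symm.toLinearMap))
    have hA : ∀ (u : V e.proj) (w : F), A (loc F e.proj e.proj u) w =
        mvfderiv IE (opMat EM e.proj P) e (vert EM e u) w := by
      intro u w
      refine congrArg (fun z => mvfderiv IE (opMat EM e.proj P) e z w) ?_
      exact congrArg (vert EM e) (locSymm_loc hx u)
    let l := (locEquiv hx).toLinearMap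
    let T' : F →ₗ[ℝ] F →ₗ[ℝ] F := LinearMap.mk₂ ℝ (fun u v => (1 / 3 : ℝ) • (A v u - A u v))
      (by intro u u' v; simp only [map_add, add_apply]; module)
      (by intro c u v; simp only [map_smul, smul_apply]; module)
      (by intro u u' v; simp only [map_add, add_apply]; module)
      (by intro c u v; simp only [map_smul, smul_apply]; module)
    refine ⟨(T'.compl₁₂ l l).compr₂ (locEquiv hx).symm.toLinearMap, fun σ τ hσ hτ => ?_⟩
    refine loc_inj hx ?_
    refine Eq.trans ?_ (loc_locSymm hx _).symm
    change loc F e.proj e.proj ((1 / 3 : ℝ) • ((vderiv EM τ (P σ) e - P (vderiv EM τ σ) e) -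
      (vderiv EM σ (P τ) e - P (vderiv EM σ τ) e))) = (1 / 3 : ℝ) • (_ - _)
    rw [loc_smul hx, loc_sub hx, coord_vderiv_endo hP hτ hσ, coord_vderiv_endo hP hσ hτ]
    refine congrArg _ (congrArg₂ _ ?_ ?_)
    · exact (hA _ _).symm
    · exact (hA _ _).symm

namespace LieAlgebroid

variable {L : LieAlgebroid EM F V} {S : PairSec EM F V} {η : Sec EM F V}

/-! ### Invariant tensor fields -/

variable (L) in
/-- The Lie derivative along `η^C`. -/
abbrev lieC (η : Sec EM F V) : PullSec F V → PullSec F V := L.lieDer (L.cLift η)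

/-- The trace commutes with the Lie derivative along `η^C`: if `Q` is the Lie derivative of `P`,
then the trace of `Q` is the derivative of the trace of `P`. The zeroth order part of the Lie
derivative contributes a commutator, which has no trace. -/
theorem along_cl_trOp {P Q : PullSec F V → PullSec F V} (hP : IsEndo (EM := EM) P)
    (hQ : IsEndo (EM := EM) Q)
    (h : ∀ σ, IsSmoothPullSec EM σ → L.lieC η (P σ) - P (L.lieC η σ) = Q σ) :
    along IE (L.completeLiftField η) (trOp EM P) = trOp EM Q := by
  funext e
  have hg := mem_frameDom (EM := EM) (F := F) (V := V) e.proj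
  have hx := dom_of_frame hg
  have hm := mdiff_of_smooth (opMat_smooth hP hx)
  have key : opMat EM e.proj Q e =
      mvfderiv IE (opMat EM e.proj P) e (L.completeLiftField η e) -
        (L.lieMat e.proj η e.proj ∘L opMat EM e.proj P e -
          opMat EM e.proj P e ∘L L.lieMat e.proj η e.proj) := by
    ext v
    let c := hat (cst EM F V e.proj v)
    have hc : IsSmoothPullSec EM c := hat_smooth _
    have h0 : coord e.proj c =ᶠ[𝓝 e] fun _ => v :=
      (eventually_proj_frameDom hg).mono fun e' he' => loc_cst he' v
    have h1 : coord e.proj (P c) =ᶠ[𝓝 e] fun e' => opMat EM e.proj P e' v :=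
      (eventually_proj_dom hx).mono fun e' he' => (opMat_apply hP he' v).symm
    have h2 : coord e.proj (L.lieC η (P c)) e =
        mvfderiv IE (opMat EM e.proj P) e (L.completeLiftField η e) v -
          L.lieMat e.proj η e.proj (opMat EM e.proj P e v) := by
      rw [L.coord_lieDer η (hP.smooth hc) hg, h1.self_of_nhds, along, mvfderiv_congr h1,
        mvfderiv_clm_apply hm (g := fun _ => v) (mdiff_of_smooth contMDiffAt_const),
        mvfderiv_const]
      simp
    have h3 : coord e.proj (P (L.lieC η c)) e =
        -opMat EM e.proj P e (L.lieMat e.proj η e.proj v) := by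
      rw [coord_endo hP hg (L.lieDer_smooth η hc), L.coord_lieDer η hc hg, h0.self_of_nhds,
        along, mvfderiv_congr h0, mvfderiv_const]
      simp
    rw [opMat_apply hQ hx, ← h c hc]
    refine (loc_sub hx _ _).trans ((congrArg₂ _ h2 h3).trans ?_)
    simp only [sub_apply, ContinuousLinearMap.comp_apply]
    abel
  -- The zeroth order part is a commutator of matrices.
  have hcomm : ∀ A B : F →L[ℝ] F, traceL F (A ∘L B) = traceL F (B ∘L A) := fun A B =>
    LinearMap.trace_mul_comm ℝ (A : F →ₗ[ℝ] F) (B : F →ₗ[ℝ] F)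
  rw [trOp_eq hQ hg, key, map_sub, map_sub, hcomm, sub_self, sub_zero, along,
    mvfderiv_congr (trOp_eventuallyEq hP e), mvfderiv_clm_comp _ hm]

/-- The trace of an invariant tensor field is invariant. -/
theorem along_cl_trOp_eq_zero {P : PullSec F V → PullSec F V} (hP : IsEndo (EM := EM) P)
    (h : ∀ σ, IsSmoothPullSec EM σ → L.lieC η (P σ) = P (L.lieC η σ)) :
    along IE (L.completeLiftField η) (trOp EM P) = 0 := by
  have h0 : IsEndo (EM := EM) (fun _ : PullSec F V => 0) :=
    ⟨fun _ => zero_smooth, fun e => ⟨0, fun _ _ => rfl⟩⟩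
  rw [along_cl_trOp hP h0 fun σ hσ => sub_eq_zero.2 (h σ hσ)]
  funext e
  rw [trOp_of_linear (T := 0) fun _ _ => rfl, map_zero]
  rfl

/-- The alternated vertical derivative of an invariant tensor field is invariant. -/
theorem lieC_altOp {P : PullSec F V → PullSec F V} (hP : IsEndo (EM := EM) P)
    (h : ∀ σ, IsSmoothPullSec EM σ → L.lieC η (P σ) = P (L.lieC η σ))
    {σ τ : PullSec F V} (hσ : IsSmoothPullSec EM σ) (hτ : IsSmoothPullSec EM τ) :
    L.lieC η (altOp EM P σ τ) = altOp EM P (L.lieC η σ) τ + altOp EM P σ (L.lieC η τ) := by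
  have key : ∀ {σ τ}, IsSmoothPullSec EM σ → IsSmoothPullSec EM τ →
      L.lieC η (vderiv EM σ (P τ) - P (vderiv EM σ τ)) =
        (vderiv EM (L.lieC η σ) (P τ) - P (vderiv EM (L.lieC η σ) τ)) +
        (vderiv EM σ (P (L.lieC η τ)) - P (vderiv EM σ (L.lieC η τ))) := by
    intro σ τ hσ hτ
    have h1 := vderiv_smooth hσ hτ
    rw [lieC, L.lieDer_sub η (vderiv_smooth hσ (hP.smooth hτ)) (hP.smooth h1), ← lieC,
      h _ h1, lieC, L.lieDer_vderiv η hσ (hP.smooth hτ), L.lieDer_vderiv η hσ hτ,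
      hP.add (vderiv_smooth (L.lieDer_smooth η hσ) hτ) (vderiv_smooth hσ (L.lieDer_smooth η hτ)),
      ← lieC, h _ hτ]
    abel
  have hs : ∀ {σ τ}, IsSmoothPullSec EM σ → IsSmoothPullSec EM τ →
      IsSmoothPullSec EM (vderiv EM σ (P τ) - P (vderiv EM σ τ)) := fun hσ hτ =>
    (vderiv_smooth hσ (hP.smooth hτ)).sub (hP.smooth (vderiv_smooth hσ hτ))
  rw [altOp, lieC, L.lieDer_const_smul η _ ((hs hτ hσ).sub (hs hσ hτ)),
    L.lieDer_sub η (hs hτ hσ) (hs hσ hτ), ← lieC, key hτ hσ, key hσ hτ, altOp, altOp]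
  module

/-- The vertical derivative of a tensor field `B` of type `(1, 2)`, in the direction `ζ`. -/
def starOp (EM : Type*) [NormedAddCommGroup EM] [NormedSpace ℝ EM] {M : Type*}
    [TopologicalSpace M] [ChartedSpace EM M]
    {F : Type*} [NormedAddCommGroup F] [NormedSpace ℝ F]
    {V : M → Type*} [TopologicalSpace (TotalSpace F V)]
    [∀ x, AddCommGroup (V x)] [∀ x, Module ℝ (V x)] [∀ x, TopologicalSpace (V x)]
    [FiberBundle F V] (B : PullSec F V → PullSec F V → PullSec F V) (σ τ ζ : PullSec F V) :
    PullSec F V :=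
  vderiv EM ζ (B σ τ) - (B (vderiv EM ζ σ) τ + B σ (vderiv EM ζ τ))

/-- The vertical derivative of an invariant tensor field is invariant. -/
theorem lieC_starOp {B : PullSec F V → PullSec F V → PullSec F V} (hB : IsBi (EM := EM) B)
    (h : ∀ σ τ, IsSmoothPullSec EM σ → IsSmoothPullSec EM τ →
      L.lieC η (B σ τ) = B (L.lieC η σ) τ + B σ (L.lieC η τ))
    {σ τ ζ : PullSec F V} (hσ : IsSmoothPullSec EM σ) (hτ : IsSmoothPullSec EM τ)
    (hζ : IsSmoothPullSec EM ζ) :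
    L.lieC η (starOp EM B σ τ ζ) = starOp EM B (L.lieC η σ) τ ζ + starOp EM B σ (L.lieC η τ) ζ +
      starOp EM B σ τ (L.lieC η ζ) := by
  have hD : ∀ {σ}, IsSmoothPullSec EM σ → IsSmoothPullSec EM (L.lieC η σ) :=
    fun hσ => L.lieDer_smooth η hσ
  have h1 := vderiv_smooth hζ hσ
  have h2 := vderiv_smooth hζ hτ
  have hv : ∀ {σ τ}, IsSmoothPullSec EM σ → IsSmoothPullSec EM τ →
      L.lieC η (vderiv EM σ τ) = vderiv EM (L.lieC η σ) τ + vderiv EM σ (L.lieC η τ) :=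
    fun hσ hτ => L.lieDer_vderiv η hσ hτ
  rw [starOp, lieC, L.lieDer_sub η (vderiv_smooth hζ (hB.smooth hσ hτ))
    ((hB.smooth h1 hτ).add (hB.smooth hσ h2)), L.lieDer_add η (hB.smooth h1 hτ)
    (hB.smooth hσ h2), ← lieC, hv hζ (hB.smooth hσ hτ), h _ _ h1 hτ, h _ _ hσ h2, h _ _ hσ hτ,
    hv hζ hσ, hv hζ hτ, vderiv_add (hB.smooth (hD hσ) hτ) (hB.smooth hσ (hD hτ)),
    hB.add_left (vderiv_smooth (hD hζ) hσ) (vderiv_smooth hζ (hD hσ)) hτ,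
    hB.add_right hσ (vderiv_smooth (hD hζ) hτ) (vderiv_smooth hζ (hD hτ)), starOp, starOp, starOp]
  abel

/-! ### Tensoriality of the Jacobi endomorphism -/

theorem vf_eventuallyEq {e : TotalSpace F V} (hx : e.proj ∈ frameDom EM F V x₀) (σ : PullSec F V) :
    vf EM σ =ᶠ[𝓝 e] ∑ i, comp x₀ σ i •
      vf EM (hat (cst EM F V x₀ (Module.finBasis ℝ F i))) := by
  refine (eventually_proj_frameDom hx).mono fun e' he' => ?_
  have h := congrArg (vertL EM e') (eq_sum_frame he' σ)
  rw [map_sum] at h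
  simp only [map_smul] at h
  exact h.trans (Eq.symm (Finset.sum_apply _ _ _))

/-- The operator `j ⟦S, 𝓗 ·⟧` satisfies the Leibniz rule with respect to the vector field of `S`. -/
theorem dyn_eq_sum (hS : L.IsProlSection S) (hj : jSec S = delta) {e : TotalSpace F V}
    (hx : e.proj ∈ frameDom EM F V x₀) {σ : PullSec F V} (hσ : IsSmoothPullSec EM σ) :
    L.dyn S σ e = ∑ i, (along IE (sf S) (comp x₀ σ i) e •
        hat (cst EM F V x₀ (Module.finBasis ℝ F i)) e +
      comp x₀ σ i e • L.dyn S (hat (cst EM F V x₀ (Module.finBasis ℝ F i))) e) := by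
  let c := fun i => hat (cst EM F V x₀ (Module.finBasis ℝ F i))
  refine vert_injective (EM := EM) e ?_
  have h1 : mlieBracket IE (sf S) (vf EM σ) e =
      ∑ i, mlieBracket IE (sf S) (comp x₀ σ i • vf EM (c i)) e :=
    ((EventuallyEq.refl (𝓝 e) (sf S)).mlieBracket_vectorField_eq (I := IE)
      (vf_eventuallyEq hx σ)).trans (bracket_sum_right _ fun i _ =>
        SmoothFieldAt.smul (comp_smooth hx hσ i) ((hat_smooth _).vf e))
  have h2 : ∀ i, vertL EM e (L.dyn S (c i) e) = _ := fun i =>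
    congrFun (vf_dyn hS hj (hat_smooth _)) e
  refine (congrFun (vf_dyn hS hj hσ) e).trans ?_
  change mlieBracket IE (sf S) (vf EM σ) e + L.hor S σ e = vertL EM e _
  rw [map_sum, h1, hor_eq_sum hS hj hx σ, ← Finset.sum_add_distrib]
  refine Finset.sum_congr rfl fun i _ => ?_
  rw [map_add, map_smul, map_smul, h2, bracket_smul_right
    (mdiff_of_smooth (comp_smooth hx hσ i)) ((hat_smooth _).vf e).mdiff, Pi.add_apply, smul_add,
    add_assoc]
  rfl

/-- The derivatives of the coefficients cancel in the Jacobi endomorphism, so that its value at `e`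
only involves the coefficients at `e`. -/
theorem jac_eq_sum (hS : L.IsProlSection S) (hj : jSec S = delta) {e : TotalSpace F V}
    (hx : e.proj ∈ frameDom EM F V x₀) {σ : PullSec F V} (hσ : IsSmoothPullSec EM σ) :
    L.jac S σ e =
      ∑ i, comp x₀ σ i e • L.jac S (hat (cst EM F V x₀ (Module.finBasis ℝ F i))) e := by
  let c := fun i => hat (cst EM F V x₀ (Module.finBasis ℝ F i))
  refine vert_injective (EM := EM) e ?_
  have h1 : mlieBracket IE (sf S) (L.hor S σ) e =
      ∑ i, mlieBracket IE (sf S) (comp x₀ σ i • L.hor S (c i)) e :=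
    ((EventuallyEq.refl (𝓝 e) (sf S)).mlieBracket_vectorField_eq (I := IE)
      (hor_eventuallyEq hS hj hx σ)).trans (bracket_sum_right _ fun i _ =>
        SmoothFieldAt.smul (comp_smooth hx hσ i) (hor_hat_smooth hS hj _ e))
  have h2 : ∀ i, vertL EM e (L.jac S (c i) e) = _ := fun i =>
    congrFun (vf_jac hS hj (hat_smooth _)) e
  have h3 := congrArg (IsLinearMap.mk' _ (horVec_isLinear hS hj e)) (dyn_eq_sum hS hj hx hσ)
  rw [map_sum] at h3
  refine (congrFun (vf_jac hS hj hσ) e).trans ?_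
  change mlieBracket IE (sf S) (L.hor S σ) e -
    IsLinearMap.mk' _ (horVec_isLinear hS hj e) (L.dyn S σ e) = vertL EM e _
  rw [map_sum, h1, h3, ← Finset.sum_sub_distrib]
  refine Finset.sum_congr rfl fun i _ => ?_
  rw [map_smul, h2, bracket_smul_right
    (mdiff_of_smooth (comp_smooth hx hσ i)) (hor_hat_smooth hS hj _ e).mdiff, map_add, map_smul,
    map_smul, Pi.sub_apply, smul_sub]
  exact add_sub_add_left_eq_sub _ _ _

/-- The Jacobi endomorphism is a tensor field. -/
theorem jac_isEndo (hS : L.IsProlSection S) (hj : jSec S = delta) :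
    IsEndo (EM := EM) (L.jac S) where
  smooth := jac_smooth hS hj
  linear e := by
    have hg := mem_frameDom (EM := EM) (F := F) (V := V) e.proj
    refine ⟨∑ i, ((Module.finBasis ℝ F).coord i ∘ₗ
      (locEquiv (dom_of_frame hg)).toLinearMap).smulRight
        (L.jac S (hat (cst EM F V e.proj (Module.finBasis ℝ F i))) e), fun σ hσ => ?_⟩
    rw [jac_eq_sum hS hj hg hσ, LinearMap.sum_apply]
    rfl

/-! ### The projective deviation tensor -/

variable (L) in
/-- The projective deviation tensor, as an operator on sections. -/
def devOp (S : PairSec EM F V) (n : ℝ) (σ : PullSec F V) : PullSec F V :=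
  L.jac S σ - fmul (fun e => 1 / (n - 1) * trOp EM (L.jac S) e) σ +
    fmul (fun e => 3 / (n + 1) * trOp EM (fun ζ => altOp EM (L.jac S) ζ σ) e) delta +
    fmul (fun e => (2 - n) / (n ^ 2 - 1) * vertDiff EM (trOp EM (L.jac S)) σ e) delta

/-- The projective deviation tensor is a tensor field. -/
theorem devOp_isEndo (hS : L.IsProlSection S) (hj : jSec S = delta) (n : ℝ) :
    IsEndo (EM := EM) (L.devOp S n) := by
  have hK := jac_isEndo hS hj
  have hR := altOp_isBi hK
  have hc : ∀ {f : TotalSpace F V → ℝ} (c : ℝ), ContMDiff IE 𝓘(ℝ, ℝ) ∞ f →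
      ContMDiff IE 𝓘(ℝ, ℝ) ∞ fun e => c * f e := fun c hf =>
    (c • ContinuousLinearMap.id ℝ ℝ).contMDiff.comp hf
  refine ⟨fun {σ} hσ => ?_, fun e => ?_⟩
  · have h1 := IsSmoothPullSec.fmul (hc (1 / (n - 1)) (trOp_smooth hK)) hσ
    have h2 := IsSmoothPullSec.fmul (hc (3 / (n + 1)) (trOp_smooth (hR.endo hσ)))
      (delta_smooth (EM := EM) (F := F) (V := V))
    have h3 : ContMDiff IE 𝓘(ℝ, ℝ) ∞ (vertDiff EM (trOp EM (L.jac S)) σ) := fun e =>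
      contMDiffAt_along (trOp_smooth hK e) (hσ.vf e)
    exact (((hK.smooth hσ).sub h1).add h2).add (IsSmoothPullSec.fmul (hc _ h3) delta_smooth)
  · obtain ⟨T, hT⟩ := hK.linear e
    obtain ⟨B, hB⟩ := hR.linear e
    refine ⟨T - (1 / (n - 1) * trOp EM (L.jac S) e) • LinearMap.id +
      ((3 / (n + 1)) • (LinearMap.trace ℝ (V e.proj) ∘ₗ B.flip)).smulRight (delta e) +
      (((2 - n) / (n ^ 2 - 1)) • ((mvfderiv IE (trOp EM (L.jac S)) e).toLinearMap ∘ₗ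
        vertL EM e)).smulRight (delta e), fun σ hσ => ?_⟩
    have h1 : trOp EM (fun ζ => altOp EM (L.jac S) ζ σ) e =
        LinearMap.trace ℝ (V e.proj) (B.flip (σ e)) :=
      trOp_of_linear fun ζ hζ => hB ζ σ hζ hσ
    change L.jac S σ e - _ • σ e + _ • delta e + _ • delta e = _
    beta_reduce
    rw [hT σ hσ, h1]
    rfl

/-- The projective deviation tensor is invariant under Lie symmetries. -/
theorem lieC_devOp (hS : L.IsProlSection S) (hj : jSec S = delta)
    (hη : mlieBracket IE (L.completeLiftField η) (sf S) = 0) (n : ℝ) {σ : PullSec F V}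
    (hσ : IsSmoothPullSec EM σ) : L.lieC η (L.devOp S n σ) = L.devOp S n (L.lieC η σ) := by
  have hK := jac_isEndo hS hj
  have hR := altOp_isBi hK
  have hI : ∀ σ, IsSmoothPullSec EM σ → L.lieC η (L.jac S σ) = L.jac S (L.lieC η σ) :=
    fun σ hσ => lieDer_jac hS hj hη hσ
  have hD := L.lieDer_smooth η hσ
  have ht := along_cl_trOp_eq_zero hK hI
  have hr : along IE (L.completeLiftField η) (trOp EM fun ζ => altOp EM (L.jac S) ζ σ) =
      trOp EM fun ζ => altOp EM (L.jac S) ζ (L.lieC η σ) := by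
    -- The derivative of the endomorphism `R(·, σ)` is `R(·, Dσ)`, as `R` is invariant.
    refine along_cl_trOp (hR.endo hσ) (hR.endo hD) fun ζ hζ => ?_
    rw [lieC_altOp hK hI hζ hσ, add_sub_cancel_left]
  have h3 : ∀ {σ}, IsSmoothPullSec EM σ → ContMDiff IE 𝓘(ℝ, ℝ) ∞
      (vertDiff EM (trOp EM (L.jac S)) σ) := fun hσ e =>
    contMDiffAt_along (trOp_smooth hK e) (hσ.vf e)
  have hv : along IE (L.completeLiftField η) (vertDiff EM (trOp EM (L.jac S)) σ) =
      vertDiff EM (trOp EM (L.jac S)) (L.lieC η σ) := by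
    funext e
    -- `η^c (σ^∨ f) = [η^c, σ^∨] f = (Dσ)^∨ f` for `f = tr K`, since `η^c f = 0`.
    have h := along_bracket (trOp_smooth hK e) (L.cl_smooth η e) (hσ.vf e)
    rw [← L.vf_lieDer η hσ, ht] at h
    have h0 : along IE (vf EM σ) (0 : TotalSpace F V → ℝ) e = 0 := by
      change mvfderiv IE (fun _ => (0 : ℝ)) e _ = 0
      rw [mvfderiv_const]; rfl
    rw [h0, sub_zero] at h
    exact h.symm
  have hc : ∀ {f : TotalSpace F V → ℝ} (c : ℝ), ContMDiff IE 𝓘(ℝ, ℝ) ∞ f →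
      ContMDiff IE 𝓘(ℝ, ℝ) ∞ fun e => c * f e := fun c hf =>
    (c • ContinuousLinearMap.id ℝ ℝ).contMDiff.comp hf
  have hca : ∀ {f : TotalSpace F V → ℝ} (c : ℝ), ContMDiff IE 𝓘(ℝ, ℝ) ∞ f →
      along IE (L.completeLiftField η) (fun e => c * f e) =
        fun e => c * along IE (L.completeLiftField η) f e := fun c hf => funext fun e =>
    mvfderiv_clm_comp (c • ContinuousLinearMap.id ℝ ℝ) (mdiff_of_smooth (hf e)) _
  have hd := delta_smooth (EM := EM) (F := F) (V := V)
  have f1 := hc (1 / (n - 1)) (trOp_smooth hK)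
  have f2 := hc (3 / (n + 1)) (trOp_smooth (hR.endo hσ))
  have f3 := hc ((2 - n) / (n ^ 2 - 1)) (h3 hσ)
  have s1 := IsSmoothPullSec.fmul f1 hσ
  have s2 := IsSmoothPullSec.fmul f2 hd
  have s3 := IsSmoothPullSec.fmul f3 hd
  have s0 := hK.smooth hσ
  rw [devOp, lieC, L.lieDer_add η ((s0.sub s1).add s2) s3, L.lieDer_add η (s0.sub s1) s2,
    L.lieDer_sub η s0 s1, L.lieDer_fmul η f1 hσ, L.lieDer_fmul η f2 hd, L.lieDer_fmul η f3 hd,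
    lieDer_delta, hca _ (trOp_smooth hK), hca _ (trOp_smooth (hR.endo hσ)), hca _ (h3 hσ), ht, hr,
    hv, lieDer_jac hS hj hη hσ, devOp]
  have z1 : ∀ f : TotalSpace F V → ℝ, fmul f (0 : PullSec F V) = 0 := fun f =>
    funext fun e => smul_zero _
  have z2 : ∀ (c : ℝ), fmul (fun e => c * (0 : TotalSpace F V → ℝ) e) σ = 0 := fun c =>
    funext fun e => by simp [fmul]
  rw [z1, z1, z2, zero_add, add_zero, add_zero]

/-! ### Curvature collineations -/

/-- On smooth arguments, `altVertDeriv` is the operator `altOp`. -/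
theorem altVertDeriv_eq (hS : L.IsProlSection S) (hj : jSec S = delta) {A : Tens F V 1}
    {P : PullSec F V → PullSec F V} (hP : IsEndo (EM := EM) P)
    (hA : ∀ Y : Fin 1 → PullSec F V, (∀ i, IsSmoothPullSec EM (Y i)) → A Y = P (Y 0))
    {X : Fin 2 → PullSec F V} (hX : ∀ i, IsSmoothPullSec EM (X i)) :
    L.altVertDeriv S A X = altOp EM P (X 0) (X 1) := by
  have key : ∀ {σ τ}, IsSmoothPullSec EM σ → IsSmoothPullSec EM τ →
      L.vertDerivTens S A ![σ, τ] = vderiv EM σ (P τ) - P (vderiv EM σ τ) := by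
    intro σ τ hσ hτ
    have h1 : A ![τ] = P τ := hA _ (by simpa using hτ)
    have h2 : A ![vderiv EM σ τ] = P (vderiv EM σ τ) := hA _ (by simpa using vderiv_smooth hσ hτ)
    change L.vertDeriv S σ (A ![τ]) -
      ∑ i : Fin 1, A (Function.update ![τ] i (L.vertDeriv S σ (![τ] i))) = _
    have h3 : Function.update ![τ] 0 (L.vertDeriv S σ τ) = ![vderiv EM σ τ] := by
      rw [vertDeriv_eq hS hj hσ hτ]
      ext i : 1
      fin_cases i
      rfl
    rw [Fin.sum_univ_one, Matrix.cons_val_zero, h3, h1, h2, vertDeriv_eq hS hj hσ (hP.smooth hτ)]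
  rw [altVertDeriv, key (hX 1) (hX 0), key (hX 0) (hX 1)]
  rfl

theorem projDeviation_eq (hS : L.IsProlSection S) (hj : jSec S = delta) (n : ℝ)
    {X : Fin 1 → PullSec F V} (hX : ∀ i, IsSmoothPullSec EM (X i)) :
    L.projDeviation S n X = L.devOp S n (X 0) := by
  have hK := jac_isEndo hS hj
  have h : ∀ e, tr EM (L.affineCurv S) X e =
      trOp EM (fun ζ => altOp EM (L.jac S) ζ (X 0)) e := by
    intro e
    refine congrArg fibreTrace (funext fun u => ?_)
    refine congrFun (altVertDeriv_eq hS hj hK (fun _ _ => rfl) fun i => ?_) e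
    refine Fin.cases (hat_smooth _) (fun j => ?_) i
    exact hX j
  funext e
  rw [projDeviation, h]
  rfl

theorem projCurv_eq (hS : L.IsProlSection S) (hj : jSec S = delta) (n : ℝ)
    {X : Fin 2 → PullSec F V} (hX : ∀ i, IsSmoothPullSec EM (X i)) :
    L.projCurv S n X = altOp EM (L.devOp S n) (X 0) (X 1) :=
  altVertDeriv_eq hS hj (devOp_isEndo hS hj n) (fun _ hY => projDeviation_eq hS hj n hY) hX

theorem projCurvStar_eq (hS : L.IsProlSection S) (hj : jSec S = delta) (n : ℝ)
    {X : Fin 3 → PullSec F V} (hX : ∀ i, IsSmoothPullSec EM (X i)) :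
    L.projCurvStar S n X = starOp EM (altOp EM (L.devOp S n)) (X 0) (X 1) (X 2) := by
  have hB := altOp_isBi (devOp_isEndo hS hj n)
  have hp : ∀ {σ τ}, IsSmoothPullSec EM σ → IsSmoothPullSec EM τ →
      L.projCurv S n ![σ, τ] = altOp EM (L.devOp S n) σ τ := fun {σ τ} hσ hτ =>
    projCurv_eq hS hj n (X := ![σ, τ]) fun i => by fin_cases i; exacts [hσ, hτ]
  change L.vertDeriv S (X 2) (L.projCurv S n ![X 0, X 1]) - ∑ i : Fin 2, L.projCurv S n
    (Function.update ![X 0, X 1] i (L.vertDeriv S (X 2) (![X 0, X 1] i))) = _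
  have h0 : Function.update ![X 0, X 1] 0 (L.vertDeriv S (X 2) (X 0)) =
      ![vderiv EM (X 2) (X 0), X 1] := by
    rw [vertDeriv_eq hS hj (hX 2) (hX 0)]
    ext i : 1
    fin_cases i <;> rfl
  have h1 : Function.update ![X 0, X 1] 1 (L.vertDeriv S (X 2) (X 1)) =
      ![X 0, vderiv EM (X 2) (X 1)] := by
    rw [vertDeriv_eq hS hj (hX 2) (hX 1)]
    ext i : 1
    fin_cases i <;> rfl
  rw [Fin.sum_univ_two, Matrix.cons_val_zero, Matrix.cons_val_one, Matrix.cons_val_zero, h0, h1,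
    hp (hX 0) (hX 1), hp (vderiv_smooth (hX 2) (hX 0)) (hX 1),
    hp (hX 0) (vderiv_smooth (hX 2) (hX 1)), vertDeriv_eq hS hj (hX 2) (hB.smooth (hX 0) (hX 1))]
  rfl

theorem update_smooth {k : ℕ} {X : Fin k → PullSec F V} (hX : ∀ i, IsSmoothPullSec EM (X i))
    (i : Fin k) (j : Fin k) :
    IsSmoothPullSec EM (Function.update X i (L.lieC η (X i)) j) := by
  rcases eq_or_ne j i with rfl | h
  · rw [Function.update_self]
    exact L.lieDer_smooth η (hX j)
  · rw [Function.update_of_ne h]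
    exact hX j

theorem projDeviation_invariant (hS : L.IsProlSection S) (hj : jSec S = delta)
    (hη : mlieBracket IE (L.completeLiftField η) (sf S) = 0) (n : ℝ)
    {X : Fin 1 → PullSec F V} (hX : ∀ i, IsSmoothPullSec EM (X i)) :
    derivTens (L.lieC η) (L.projDeviation S n) X = 0 := by
  rw [derivTens, Fin.sum_univ_one, projDeviation_eq hS hj n hX,
    projDeviation_eq hS hj n (update_smooth hX 0), lieC_devOp hS hj hη n (hX 0), sub_eq_zero]
  simp

theorem projCurv_invariant (hS : L.IsProlSection S) (hj : jSec S = delta)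
    (hη : mlieBracket IE (L.completeLiftField η) (sf S) = 0) (n : ℝ)
    {X : Fin 2 → PullSec F V} (hX : ∀ i, IsSmoothPullSec EM (X i)) :
    derivTens (L.lieC η) (L.projCurv S n) X = 0 := by
  rw [derivTens, Fin.sum_univ_two, projCurv_eq hS hj n hX,
    projCurv_eq hS hj n (update_smooth hX 0), projCurv_eq hS hj n (update_smooth hX 1),
    lieC_altOp (devOp_isEndo hS hj n) (fun _ hσ => lieC_devOp hS hj hη n hσ) (hX 0) (hX 1),
    sub_eq_zero]
  simp

theorem projCurvStar_invariant (hS : L.IsProlSection S) (hj : jSec S = delta)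
    (hη : mlieBracket IE (L.completeLiftField η) (sf S) = 0) (n : ℝ)
    {X : Fin 3 → PullSec F V} (hX : ∀ i, IsSmoothPullSec EM (X i)) :
    derivTens (L.lieC η) (L.projCurvStar S n) X = 0 := by
  have hW := devOp_isEndo hS hj n
  rw [derivTens, Fin.sum_univ_three, projCurvStar_eq hS hj n hX,
    projCurvStar_eq hS hj n (update_smooth hX 0), projCurvStar_eq hS hj n (update_smooth hX 1),
    projCurvStar_eq hS hj n (update_smooth hX 2),
    lieC_starOp (altOp_isBi hW) (fun _ _ hσ hτ => lieC_altOp hW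
      (fun _ hσ => lieC_devOp hS hj hη n hσ) hσ hτ) (hX 0) (hX 1) (hX 2), sub_eq_zero]
  simp

end LieAlgebroid

end Algebroid

end LieAlgd

end

theorem mainTheorem2
    {EM : Type*} [NormedAddCommGroup EM] [NormedSpace ℝ EM] [FiniteDimensional ℝ EM]
    {M : Type*} [TopologicalSpace M] [ChartedSpace EM M] [IsManifold 𝓘(ℝ, EM) ∞ M] [T2Space M]
    {F : Type*} [NormedAddCommGroup F] [NormedSpace ℝ F] [FiniteDimensional ℝ F]
    {V : M → Type*} [TopologicalSpace (TotalSpace F V)]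
    [∀ x, AddCommGroup (V x)] [∀ x, Module ℝ (V x)] [∀ x, TopologicalSpace (V x)]
    [FiberBundle F V] [VectorBundle ℝ F V] [ContMDiffVectorBundle ∞ F V 𝓘(ℝ, EM)]
    (L : LieAlgd.LieAlgebroid EM F V)
    (n : ℝ) (hn₁ : n ≠ 1) (hn₂ : n ≠ -1)
    (S : LieAlgd.PairSec EM F V) (hS : L.IsSpray S)
    (η : LieAlgd.Sec EM F V) (hη : L.IsLieSymmetry S η) :
    L.IsCurvatureCollineation (L.cLift η) (L.projDeviation S n) ∧
    L.IsCurvatureCollineation (L.cLift η) (L.projCurv S n) ∧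
    L.IsCurvatureCollineation (L.cLift η) (L.projCurvStar S n) := by
  have hj := LieAlgd.LieAlgebroid.jSec_eq_delta hS.semispray
  have hc := LieAlgd.LieAlgebroid.cl_bracket_sf hη
  have hp := L.cLift_isProjectable η
  exact ⟨⟨hp, fun X hX =>
      LieAlgd.LieAlgebroid.projDeviation_invariant hS.isSection hj hc n hX⟩,
    ⟨hp, fun X hX => LieAlgd.LieAlgebroid.projCurv_invariant hS.isSection hj hc n hX⟩,
    ⟨hp, fun X hX => LieAlgd.LieAlgebroid.projCurvStar_invariant hS.isSection hj hc n hX⟩⟩
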